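/- **Theorem 3.1 (Iwasawa decomposition of $SL(n,m,\mathbb C)$).** Let $n,m\ge 0$. For $1\le i\le n+m$ put $|i|=0$ if $i\le n$ and $|i|=1$ if $i>n$. *Notation.* Let $\mathbb C[[x,x^\ddagger]]$ be the superalgebra of formal power series in generators $x_{ij},x^\ddagger_{ij}$ ($1\le i,j\le n+m$) of parity $|i|+|j|$, where two generators $a,b$ satisfy $ab=(-1)^{|a||b|}ba$. Let $y=1+x$ and $y^\ddagger=1+x^\ddagger$, and $$\mathrm{sdet}\begin{pmatrix}A&B\\C&D\end{pmatrix}=\det(A-BD^{-1}C)\,\det(D)^{-1}.$$ - $\mathrm{Fun}(SL(n,m,\mathbb C))=\mathbb C[[x,x^\ddagger]]/(\mathrm{sdet}\,y-1,\ \mathrm{sdet}\,y^\ddagger-1)$. This is the completed tensor product of the holomorphic and the antiholomorphic copy of $\mathbb C[[x]]/(\mathrm{sdet}\,y-1)$. Its coproduct $\Delta$ takes values in the completed tensor square and is the superalgebra morphism with $\Delta(y_{ij})=\sum_k y_{ik}\otimes y_{kj}$ and $\Delta(y^\ddagger_{ij})=\sum_k y^\ddagger_{ik}\otimes y^\ddagger_{kj}$.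 We write $\Delta(f)=f_{(1)}\otimes f_{(2)}$. - $\mathrm{Fun}(SU(n,m))$ is the quotient of $\mathrm{Fun}(SL(n,m,\mathbb C))$ by the ideal generated by all $(-1)^{(|i|+|j|)|j|}S(x_{ji})-x^\ddagger_{ij}$, where $S(x_{ij})=-\delta_{ij}+(y^{-1})_{ij}$. Let $i$ be the projection onto it. - $\mathrm{Fun}(s(AN))$ is the quotient of $\mathrm{Fun}(SL(n,m,\mathbb C))$ by the ideal generated by $x_{ij},x^\ddagger_{ij}$ for $i>j$ and by all $x_{ii}-x^\ddagger_{ii}$. Let $j$ be the projection onto it. - $\ddagger$ is the antilinear multiplicative map of $\mathrm{Fun}(SL(n,m,\mathbb C))$ to itself with $x_{ij}\mapsto x^\ddagger_{ij}$ and $x^\ddagger_{ij}\mapsto(-1)^{|i|+|j|}x_{ij}$. The supertranspose is $\begin{pmatrix}A&B\\C&D\end{pmatrix}^{st}=\begin{pmatrix}A^t&C^t\\-B^t&D^t\end{pmatrix}$. - A supermatrix over $\mathrm{Fun}(SL(n,m,\mathbb C))$ is an $(n+m)\times(n+m)$ matrix whose $(i,j)$ entry has parity $|i|+|j|$. An element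 is called normalized if its constant term is $1$, and real if $\ddagger$ fixes it. *Statement.* 1. There is exactly one pair of (parity-preserving, $\mathbb C$-linear) superalgebra morphisms $$\phi:\mathrm{Fun}(SU(n,m))\to\mathrm{Fun}(SL(n,m,\mathbb C)),\qquad \psi:\mathrm{Fun}(s(AN))\to\mathrm{Fun}(SL(n,m,\mathbb C))$$ such that $$\phi(i(f_{(1)}))\cdot\psi(j(f_{(2)}))=f\qquad\text{for all } f\in\mathrm{Fun}(SL(n,m,\mathbb C)).$$ Here the left side is the image of $\Delta(f)$ under the superalgebra morphism from the completed tensor square to $\mathrm{Fun}(SL(n,m,\mathbb C))$ with $f\otimes g\mapsto\phi(i(f))\,\psi(j(g))$. 2. In matrix form, the generic supermatrix $M=y$ has exactly one factorization $M=\Phi\Psi$ with supermatrices $\Phi,\Psi$ over $\mathrm{Fun}(SL(n,m,\mathbb C))$ such that $\mathrm{sdet}\,\Phi=1$, $(\Phi^{\ddagger})^{st}\Phi=1$ and the diagonal entries of $\Phi$ are normalized, and $\mathrm{sdet}\,\Psi=1$, $\Psi$ is upper triangular and its diagonal entries are real and normalized. 3. These correspond to each other: $\phi(i(y_{kl}))=\Phi_{kl}$,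 $\phi(i(y^\ddagger_{kl}))=\Phi_{kl}^\ddagger$, $\psi(j(y_{kl}))=\Psi_{kl}$ and $\psi(j(y^\ddagger_{kl}))=\Psi_{kl}^\ddagger$ for all $k,l$. -/

import Mathlib

namespace SuperIwasawa

noncomputable section

/-- `(-1) ^ a` for a parity `a`. -/
def sgn (a : ZMod 2) : ℂ := (-1) ^ a.val

theorem sgn_zero : sgn 0 = 1 := by simp [sgn]

theorem sgn_one : sgn 1 = -1 := pow_one _

theorem sgn_add (a b : ZMod 2) : sgn (a + b) = sgn a * sgn b := by
  have h : ∀ a b : ZMod 2, (-1 : ℤ) ^ (a + b).val = (-1) ^ a.val * (-1) ^ b.val := by decide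
  have h2 := congrArg (Int.cast : ℤ → ℂ) (h a b)
  push_cast at h2
  exact h2

theorem sgn_mul_self (a : ZMod 2) : sgn a * sgn a = 1 := by
  fin_cases a <;> simp [sgn, ZMod.val]

/-- A `ℤ/2`-grading given by its two homogeneous subspaces. -/
class SuperGraded (A : Type) [Ring A] [Algebra ℂ A] where
  homog : ZMod 2 → Submodule ℂ A

/-- The homogeneous subspace of the given parity. -/
def homog {A : Type} [Ring A] [Algebra ℂ A] [SuperGraded A] (q : ZMod 2) : Submodule ℂ A :=
  SuperGraded.homog q

/-- A morphism of superalgebras is an algebra morphism that preserves parity. -/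
def IsSuperHom {A B : Type} [Ring A] [Algebra ℂ A] [SuperGraded A]
    [Ring B] [Algebra ℂ B] [SuperGraded B] (f : A →ₐ[ℂ] B) : Prop :=
  ∀ q : ZMod 2, ∀ a ∈ homog (A := A) q, f a ∈ homog (A := B) q

/-- The quotient of an algebra by the two-sided ideal generated by the relations `r`. -/
def SQuot {A : Type} [Ring A] [Algebra ℂ A] (r : A → A → Prop) : Type := RingQuot r

namespace SQuot

variable {A : Type} [Ring A] [Algebra ℂ A] (r : A → A → Prop)

instance : Ring (SQuot r) := inferInstanceAs (Ring (RingQuot r))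

instance : Algebra ℂ (SQuot r) := inferInstanceAs (Algebra ℂ (RingQuot r))

/-- The canonical projection. -/
def mk : A →ₐ[ℂ] SQuot r := RingQuot.mkAlgHom ℂ r

theorem mk_rel {a b : A} (h : r a b) : mk r a = mk r b := RingQuot.mkAlgHom_rel ℂ h

theorem mk_surjective : Function.Surjective (mk r) := RingQuot.mkAlgHom_surjective ℂ r

variable {r}

/-- The universal property, for ring homomorphisms. -/
def lift {T : Type} [Ring T] (f : A →+* T) (w : ∀ ⦃x y⦄, r x y → f x = f y) : SQuot r →+* T :=
  RingQuot.lift ⟨f, w⟩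

theorem lift_mk {T : Type} [Ring T] (f : A →+* T) (w : ∀ ⦃x y⦄, r x y → f x = f y) (a : A) :
    lift f w (mk r a) = f a := by
  have := congrArg (fun g : A →+* RingQuot r => RingQuot.lift ⟨f, w⟩ (g a))
    (RingQuot.mkAlgHom_coe ℂ r)
  exact this.trans (RingQuot.lift_mkRingHom_apply f w a)

/-- The universal property, for algebra morphisms. -/
def liftAlg {T : Type} [Ring T] [Algebra ℂ T] (f : A →ₐ[ℂ] T)
    (w : ∀ ⦃x y⦄, r x y → f x = f y) : SQuot r →ₐ[ℂ] T :=
  RingQuot.liftAlgHom ℂ ⟨f, w⟩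

theorem liftAlg_mk {T : Type} [Ring T] [Algebra ℂ T] (f : A →ₐ[ℂ] T)
    (w : ∀ ⦃x y⦄, r x y → f x = f y) (a : A) : liftAlg f w (mk r a) = f a :=
  RingQuot.liftAlgHom_mkAlgHom_apply ℂ f w a

variable (r)

/-- The quotient grading: the classes of the homogeneous elements. -/
instance [SuperGraded A] : SuperGraded (SQuot r) where
  homog q := (homog (A := A) q).map (mk r).toLinearMap

end SQuot

/-! ### Formal power series in commuting and anticommuting variables -/

/-- The Grassmann rules for variables of parity `p`, together with the vanishing of all
monomials of degree `k`. -/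
inductive TruncRel {X : Type} (p : X → ZMod 2) (k : ℕ) :
    FreeAlgebra ℂ X → FreeAlgebra ℂ X → Prop
  | comm (x y : X) : TruncRel p k (FreeAlgebra.ι ℂ x * FreeAlgebra.ι ℂ y)
      (sgn (p x * p y) • (FreeAlgebra.ι ℂ y * FreeAlgebra.ι ℂ x))
  | nil (w : List X) (hw : w.length = k) : TruncRel p k (w.map (FreeAlgebra.ι ℂ)).prod 0

/-- The polynomial superalgebra modulo the monomials of degree at least `k`. -/
abbrev Trunc {X : Type} (p : X → ZMod 2) (k : ℕ) : Type := SQuot (TruncRel p k)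

section Trunc

variable {X : Type} (p : X → ZMod 2) (k : ℕ)

/-- A variable, truncated. -/
def tgen (x : X) : Trunc p k := SQuot.mk (TruncRel p k) (FreeAlgebra.ι ℂ x)

/-- A monomial, truncated. -/
def word (w : List X) : Trunc p k := (w.map (tgen p k)).prod

theorem mk_word (w : List X) :
    SQuot.mk (TruncRel p k) (w.map (FreeAlgebra.ι ℂ)).prod = word p k w := by
  rw [map_list_prod, List.map_map]; rfl

theorem word_append (v w : List X) : word p k (v ++ w) = word p k v * word p k w := by
  simp [word]

theorem tgen_comm (x y : X) :
    tgen p k x * tgen p k y = sgn (p x * p y) • (tgen p k y * tgen p k x) := by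
  have := SQuot.mk_rel _ (TruncRel.comm (p := p) (k := k) x y)
  simpa [tgen] using this

theorem word_eq_zero (w : List X) (hw : k ≤ w.length) : word p k w = 0 := by
  have h := SQuot.mk_rel _
    (TruncRel.nil (p := p) (k := k) (w.take k) (by simpa using hw))
  rw [mk_word, map_zero] at h
  rw [← List.take_append_drop k w, word_append, h, zero_mul]

/-- Evaluation of noncommutative polynomials, along a ring homomorphism on the scalars. -/
def freeEval {T : Type} [Ring T] (κ : ℂ →+* T) (hκ : ∀ c x, κ c * x = x * κ c) (s : X → T) :
    FreeAlgebra ℂ X →+* T :=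
  letI : Algebra ℂ T := κ.toAlgebra' hκ
  (FreeAlgebra.lift ℂ s).toRingHom

theorem freeEval_ι {T : Type} [Ring T] (κ : ℂ →+* T) (hκ : ∀ c x, κ c * x = x * κ c)
    (s : X → T) (x : X) : freeEval κ hκ s (FreeAlgebra.ι ℂ x) = s x := by
  let _ : Algebra ℂ T := κ.toAlgebra' hκ
  exact FreeAlgebra.lift_ι_apply s x

theorem freeEval_algebraMap {T : Type} [Ring T] (κ : ℂ →+* T)
    (hκ : ∀ c x, κ c * x = x * κ c) (s : X → T) (c : ℂ) :
    freeEval κ hκ s (algebraMap ℂ _ c) = κ c := by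
  let _ : Algebra ℂ T := κ.toAlgebra' hκ
  exact (FreeAlgebra.lift ℂ s).commutes c

/-- The semilinear evaluation of noncommutative polynomials. -/
def freeSemi (τ : ℂ →+* ℂ) {T : Type} [Ring T] [Algebra ℂ T] (s : X → T) :
    FreeAlgebra ℂ X →+* T :=
  freeEval ((algebraMap ℂ T).comp τ) (fun c x => Algebra.commutes (τ c) x) s

theorem freeSemi_ι (τ : ℂ →+* ℂ) {T : Type} [Ring T] [Algebra ℂ T] (s : X → T) (x : X) :
    freeSemi τ s (FreeAlgebra.ι ℂ x) = s x := freeEval_ι _ _ s x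

theorem freeSemi_algebraMap (τ : ℂ →+* ℂ) {T : Type} [Ring T] [Algebra ℂ T] (s : X → T)
    (c : ℂ) : freeSemi τ s (algebraMap ℂ _ c) = algebraMap ℂ T (τ c) :=
  freeEval_algebraMap _ _ s c

theorem span_word : Submodule.span ℂ (Set.range (word p k)) = ⊤ := by
  rw [eq_top_iff]
  rintro a -
  obtain ⟨b, rfl⟩ := SQuot.mk_surjective (TruncRel p k) a
  induction b using FreeAlgebra.induction with
  | grade0 r =>
    rw [AlgHom.commutes, Algebra.algebraMap_eq_smul_one]
    exact Submodule.smul_mem _ _ (Submodule.subset_span ⟨[], by simp [word]⟩)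
  | grade1 x => exact Submodule.subset_span ⟨[x], by simp [word, tgen]⟩
  | mul a b ha hb =>
    rw [map_mul]
    have := Submodule.mul_mem_mul ha hb
    rw [Submodule.span_mul_span] at this
    refine Submodule.span_mono ?_ this
    rintro _ ⟨_, ⟨v, rfl⟩, _, ⟨w, rfl⟩, rfl⟩
    exact ⟨v ++ w, word_append p k v w⟩
  | add a b ha hb => rw [map_add]; exact Submodule.add_mem _ ha hb

/-- Polynomials all of whose monomials have parity `q`. -/
def thomog (q : ZMod 2) : Submodule ℂ (Trunc p k) :=
  Submodule.span ℂ {a | ∃ w : List X, (w.map p).sum = q ∧ word p k w = a}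

theorem one_mem_thomog : (1 : Trunc p k) ∈ thomog p k 0 :=
  Submodule.subset_span ⟨[], by simp, by simp [word]⟩

theorem mul_mem_thomog {q r : ZMod 2} {a b : Trunc p k} (ha : a ∈ thomog p k q)
    (hb : b ∈ thomog p k r) : a * b ∈ thomog p k (q + r) := by
  have := Submodule.mul_mem_mul ha hb
  unfold thomog at this
  rw [Submodule.span_mul_span] at this
  refine Submodule.span_mono ?_ this
  rintro _ ⟨_, ⟨v, rfl, rfl⟩, _, ⟨w, rfl, rfl⟩, rfl⟩
  exact ⟨v ++ w, by simp, word_append p k v w⟩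

theorem tgen_word_comm (x : X) (w : List X) :
    tgen p k x * word p k w = sgn (p x * (w.map p).sum) • (word p k w * tgen p k x) := by
  induction w with
  | nil => simp [word, sgn_zero]
  | cons y w ih =>
    have e : word p k (y :: w) = tgen p k y * word p k w := by simp [word]
    rw [e, ← mul_assoc, tgen_comm, smul_mul_assoc, mul_assoc, ih, mul_smul_comm, smul_smul,
      mul_assoc, List.map_cons, List.sum_cons, mul_add, sgn_add]

theorem word_comm (v w : List X) :
    word p k v * word p k w =
      sgn ((v.map p).sum * (w.map p).sum) • (word p k w * word p k v) := by
  induction v with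
  | nil => simp [word, sgn_zero]
  | cons y v ih =>
    have e : word p k (y :: v) = tgen p k y * word p k v := by simp [word]
    rw [e, mul_assoc, ih, mul_smul_comm, ← mul_assoc, tgen_word_comm, smul_mul_assoc, smul_smul,
      mul_assoc, List.map_cons, List.sum_cons, add_mul, sgn_add, mul_comm (sgn _)]

theorem thomog_comm {q r : ZMod 2} {a b : Trunc p k} (ha : a ∈ thomog p k q)
    (hb : b ∈ thomog p k r) : a * b = sgn (q * r) • (b * a) := by
  induction ha using Submodule.span_induction with
  | zero => simp
  | add a a' _ _ h h' => rw [add_mul, h, h', mul_add, smul_add]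
  | smul c a _ h => rw [smul_mul_assoc, h, mul_smul_comm, smul_comm]
  | mem a ha =>
    obtain ⟨v, rfl, rfl⟩ := ha
    induction hb using Submodule.span_induction with
    | zero => simp
    | add a a' _ _ h h' => rw [mul_add, h, h', add_mul, smul_add]
    | smul c a _ h => rw [smul_mul_assoc, mul_smul_comm, h, smul_comm]
    | mem b hb =>
      obtain ⟨w, rfl, rfl⟩ := hb
      exact word_comm p k v w

theorem thomog_zero_comm {a : Trunc p k} (ha : a ∈ thomog p k 0) (b : Trunc p k) :
    a * b = b * a := by
  have hb : b ∈ Submodule.span ℂ (Set.range (word p k)) := by rw [span_word]; trivial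
  induction hb using Submodule.span_induction with
  | zero => simp
  | add x y _ _ h h' => rw [mul_add, h, h', add_mul]
  | smul c x _ h => rw [smul_mul_assoc, mul_smul_comm, h]
  | mem b hb =>
    obtain ⟨w, rfl⟩ := hb
    rw [thomog_comm p k ha (Submodule.subset_span ⟨w, rfl, rfl⟩), zero_mul, sgn_zero, one_smul]

/-- Polynomials all of whose monomials have degree at least `j`. -/
def filt (j : ℕ) : Submodule ℂ (Trunc p k) :=
  Submodule.span ℂ {a | ∃ w : List X, j ≤ w.length ∧ word p k w = a}

theorem mul_mem_filt {i j : ℕ} {a b : Trunc p k} (ha : a ∈ filt p k i)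
    (hb : b ∈ filt p k j) : a * b ∈ filt p k (i + j) := by
  have := Submodule.mul_mem_mul ha hb
  unfold filt at this
  rw [Submodule.span_mul_span] at this
  refine Submodule.span_mono ?_ this
  rintro _ ⟨_, ⟨v, hv, rfl⟩, _, ⟨w, hw, rfl⟩, rfl⟩
  exact ⟨v ++ w, by simp; omega, word_append p k v w⟩

theorem filt_eq_zero {a : Trunc p k} (ha : a ∈ filt p k k) : a = 0 := by
  induction ha using Submodule.span_induction with
  | zero => rfl
  | add x y _ _ h h' => rw [h, h', add_zero]
  | smul c x _ h => rw [h, smul_zero]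
  | mem b hb => obtain ⟨w, hw, rfl⟩ := hb; exact word_eq_zero p k w hw

theorem list_prod_mem_filt (l : List (Trunc p k)) (h : ∀ a ∈ l, a ∈ filt p k 1) :
    l.prod ∈ filt p k l.length := by
  induction l with
  | nil => exact Submodule.subset_span ⟨[], by simp, by simp [word]⟩
  | cons a l ih =>
    rw [List.prod_cons, List.length_cons, add_comm]
    exact mul_mem_filt p k (h a (by simp)) (ih fun b hb => h b (by simp [hb]))

theorem exists_const (a : Trunc p k) : ∃ c : ℂ, a - algebraMap ℂ _ c ∈ filt p k 1 := by
  have ha : a ∈ Submodule.span ℂ (Set.range (word p k)) := by rw [span_word]; trivial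
  induction ha using Submodule.span_induction with
  | zero => exact ⟨0, by simp⟩
  | add x y _ _ h h' =>
    obtain ⟨c, hc⟩ := h
    obtain ⟨d, hd⟩ := h'
    refine ⟨c + d, ?_⟩
    have := Submodule.add_mem _ hc hd
    rw [map_add]
    convert this using 1
    abel
  | smul e x _ h =>
    obtain ⟨c, hc⟩ := h
    refine ⟨e * c, ?_⟩
    have := Submodule.smul_mem _ e hc
    rwa [smul_sub, Algebra.smul_def e (algebraMap ℂ _ c), ← map_mul] at this
  | mem b hb =>
    obtain ⟨w, rfl⟩ := hb
    cases w with
    | nil => exact ⟨1, by simp [word]⟩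
    | cons x w =>
      refine ⟨0, ?_⟩
      rw [map_zero, sub_zero]
      exact Submodule.subset_span ⟨x :: w, by simp, rfl⟩

/-- The constant term of a truncated polynomial. -/
def tconst : Trunc p (k + 1) →ₐ[ℂ] ℂ :=
  SQuot.liftAlg (FreeAlgebra.lift ℂ fun _ : X => (0 : ℂ)) (by
    rintro _ _ (⟨x, y⟩ | ⟨w, hw⟩)
    · simp
    · cases w with
      | nil => simp at hw
      | cons x w => simp)

theorem tconst_word (x : X) (w : List X) : tconst p k (word p (k + 1) (x :: w)) = 0 := by
  rw [← mk_word, tconst, SQuot.liftAlg_mk]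
  simp

theorem tconst_filt {a : Trunc p (k + 1)} (ha : a ∈ filt p (k + 1) 1) : tconst p k a = 0 := by
  induction ha using Submodule.span_induction with
  | zero => simp
  | add x y _ _ h h' => rw [map_add, h, h', add_zero]
  | smul c x _ h => rw [map_smul, h, smul_zero]
  | mem b hb =>
    obtain ⟨w, hw, rfl⟩ := hb
    cases w with
    | nil => simp at hw
    | cons x w => exact tconst_word p k x w

theorem mem_filt_one_iff (a : Trunc p (k + 1)) : a ∈ filt p (k + 1) 1 ↔ tconst p k a = 0 := by
  refine ⟨tconst_filt p k, fun h => ?_⟩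
  obtain ⟨c, hc⟩ := exists_const p (k + 1) a
  have := tconst_filt p k hc
  rw [map_sub, h, AlgHom.commutes] at this
  have hc0 : c = 0 := by simpa using this
  simpa [hc0] using hc

/-- The projection that forgets the monomials of degree `k`. -/
def res : Trunc p (k + 1) →ₐ[ℂ] Trunc p k :=
  SQuot.liftAlg (FreeAlgebra.lift ℂ (tgen p k)) (by
    rintro _ _ (⟨x, y⟩ | ⟨w, hw⟩)
    · simpa using tgen_comm p k x y
    · rw [map_zero, map_list_prod, List.map_map]
      have : (FreeAlgebra.lift ℂ (tgen p k)) ∘ FreeAlgebra.ι ℂ = tgen p k := by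
        ext x; simp
      rw [this]
      exact word_eq_zero p k w (by omega))

theorem res_tgen (x : X) : res p k (tgen p (k + 1) x) = tgen p k x := by
  simp [res, tgen, SQuot.liftAlg_mk]

theorem res_word (w : List X) : res p k (word p (k + 1) w) = word p k w := by
  rw [word, map_list_prod, List.map_map, word]
  congr 2
  ext x
  exact res_tgen p k x

theorem tconst_res (a : Trunc p (k + 2)) :
    tconst p k (res p (k + 1) a) = tconst p (k + 1) a := by
  obtain ⟨b, rfl⟩ := SQuot.mk_surjective _ a
  have : ((tconst p k).comp (res p (k + 1))).comp (SQuot.mk _) =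
      (tconst p (k + 1)).comp (SQuot.mk _) := by
    apply FreeAlgebra.hom_ext
    ext x
    change tconst p k (res p (k + 1) (tgen p (k + 2) x)) = tconst p (k + 1) (tgen p (k + 2) x)
    rw [res_tgen]
    simp [tconst, tgen, SQuot.liftAlg_mk]
  exact DFunLike.congr_fun this b

end Trunc

/-- The superalgebra of formal power series in variables `X` of parity `p`: the inverse limit of
the truncated polynomial superalgebras. -/
def superSeries {X : Type} (p : X → ZMod 2) : Subalgebra ℂ (∀ k, Trunc p k) where
  carrier := {a | ∀ k, res p k (a (k + 1)) = a k}
  mul_mem' ha hb k := by simp [ha k, hb k]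
  add_mem' ha hb k := by simp [ha k, hb k]
  algebraMap_mem' _ _ := by simp

/-- The type of formal power series in variables `X` of parity `p`. -/
def Series {X : Type} (p : X → ZMod 2) : Type := superSeries p

instance {X : Type} (p : X → ZMod 2) : Ring (Series p) := inferInstanceAs (Ring (superSeries p))

instance {X : Type} (p : X → ZMod 2) : Algebra ℂ (Series p) :=
  inferInstanceAs (Algebra ℂ (superSeries p))

section Series

variable {X : Type} (p : X → ZMod 2)

/-- The truncation that forgets the monomials of degree at least `k`. -/
def trunc (k : ℕ) : Series p →ₐ[ℂ] Trunc p k :=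
  (Pi.evalAlgHom ℂ (fun k => Trunc p k) k).comp (superSeries p).val

variable {p} in
theorem series_ext {a b : Series p} (h : ∀ k, trunc p k a = trunc p k b) : a = b :=
  Subtype.ext (funext h)

theorem res_trunc (a : Series p) (k : ℕ) : res p k (trunc p (k + 1) a) = trunc p k a := a.2 k

/-- A power series from a compatible sequence of truncations. -/
def mkSeries (f : ∀ k, Trunc p k) (hf : ∀ k, res p k (f (k + 1)) = f k) : Series p := ⟨f, hf⟩

theorem trunc_mkSeries (f : ∀ k, Trunc p k) (hf : ∀ k, res p k (f (k + 1)) = f k) (k : ℕ) :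
    trunc p k (mkSeries p f hf) = f k := rfl

/-- A power series is homogeneous of parity `q` when all its monomials are. -/
instance : SuperGraded (Series p) where
  homog q :=
    { carrier := {a | ∀ k, trunc p k a ∈ thomog p k q}
      add_mem' := fun ha hb k => by rw [map_add]; exact Submodule.add_mem _ (ha k) (hb k)
      zero_mem' := fun k => by rw [map_zero]; exact Submodule.zero_mem _
      smul_mem' := fun c _ ha k => by rw [map_smul]; exact Submodule.smul_mem _ c (ha k) }

theorem mem_homog_series {q : ZMod 2} {a : Series p} :
    a ∈ homog (A := Series p) q ↔ ∀ k, trunc p k a ∈ thomog p k q := Iff.rfl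

/-- A variable. -/
def var (x : X) : Series p := mkSeries p (fun k => tgen p k x) fun k => res_tgen p k x

theorem var_mem_homog (x : X) : var p x ∈ homog (A := Series p) (p x) :=
  fun k => Submodule.subset_span ⟨[x], by simp, by simp [word, var, trunc_mkSeries]⟩

/-- The constant term of a power series. -/
def const : Series p →ₐ[ℂ] ℂ := (tconst p 0).comp (trunc p 1)

theorem const_var (x : X) : const p (var p x) = 0 := by
  rw [const, AlgHom.comp_apply, var, trunc_mkSeries]
  simp [tconst, tgen, SQuot.liftAlg_mk]

theorem const_eq (a : Series p) (k : ℕ) : const p a = tconst p k (trunc p (k + 1) a) := by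
  induction k with
  | zero => rfl
  | succ k ih => rw [ih, ← res_trunc p a (k + 1), tconst_res]

theorem mem_filt_of_const {a : Series p} (ha : const p a = 0) (k : ℕ) :
    trunc p k a ∈ filt p k 1 := by
  cases k with
  | zero =>
    have : trunc p 0 a = 0 := by
      rw [← mul_one (trunc p 0 a), show (1 : Trunc p 0) = word p 0 [] by simp [word],
        word_eq_zero p 0 [] le_rfl, mul_zero]
    rw [this]; exact Submodule.zero_mem _
  | succ k => rwa [mem_filt_one_iff, ← const_eq]

theorem filt_nilpotent {k : ℕ} {a : Trunc p k} (ha : a ∈ filt p k 1) : a ^ k = 0 := by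
  apply filt_eq_zero p k
  have := list_prod_mem_filt p k (List.replicate k a)
    (fun b hb => (List.eq_of_mem_replicate hb) ▸ ha)
  simpa using this

theorem isUnit_of_const {a : Series p} (ha : const p a = 1) : IsUnit a := by
  have hu : ∀ k, IsUnit (trunc p k a) := by
    intro k
    have h : trunc p k (1 - a) ∈ filt p k 1 := mem_filt_of_const p (by simp [ha]) k
    have h2 : IsNilpotent (trunc p k (1 - a)) := ⟨k, filt_nilpotent p h⟩
    have e : 1 - trunc p k (1 - a) = trunc p k a := by simp
    rw [← e]
    exact h2.isUnit_one_sub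
  have hi : ∀ k, res p k (Ring.inverse (trunc p (k + 1) a)) = Ring.inverse (trunc p k a) := by
    intro k
    have h1 : res p k (Ring.inverse (trunc p (k + 1) a)) * trunc p k a = 1 := by
      rw [← res_trunc p a k, ← map_mul, Ring.inverse_mul_cancel _ (hu _), map_one]
    calc _ = res p k (Ring.inverse (trunc p (k + 1) a)) *
          (trunc p k a * Ring.inverse (trunc p k a)) := by
          rw [Ring.mul_inverse_cancel _ (hu k), mul_one]
      _ = _ := by rw [← mul_assoc, h1, one_mul]
  refine ⟨⟨a, mkSeries p (fun k => Ring.inverse (trunc p k a)) hi, ?_, ?_⟩, rfl⟩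
  · apply series_ext; intro k
    rw [map_mul, trunc_mkSeries, Ring.mul_inverse_cancel _ (hu k), map_one]
  · apply series_ext; intro k
    rw [map_mul, trunc_mkSeries, Ring.inverse_mul_cancel _ (hu k), map_one]

variable {Y : Type} (p' : Y → ZMod 2)

/-- Semilinear substitution of power series for variables, on truncations. -/
def tsubst (τ : ℂ →+* ℂ) (s : X → Series p')
    (hs : ∀ x, s x ∈ homog (A := Series p') (p x)) (h0 : ∀ x, const p' (s x) = 0) (k : ℕ) :
    Trunc p k →+* Trunc p' k :=
  SQuot.lift (freeSemi τ fun x => trunc p' k (s x)) (by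
    rintro _ _ (⟨x, y⟩ | ⟨w, hw⟩)
    · rw [Algebra.smul_def, map_mul, map_mul, map_mul, freeSemi_algebraMap, freeSemi_ι,
        freeSemi_ι]
      have : τ (sgn (p x * p y)) = sgn (p x * p y) := by simp [sgn]
      rw [this, ← Algebra.smul_def]
      exact thomog_comm p' k (hs x k) (hs y k)
    · rw [map_zero, map_list_prod, List.map_map]
      apply filt_eq_zero
      have := list_prod_mem_filt p' k (w.map (freeSemi τ (fun x => trunc p' k (s x)) ∘ FreeAlgebra.ι ℂ))
        (by
          intro a ha
          obtain ⟨x, -, rfl⟩ := List.mem_map.1 ha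
          simpa [freeSemi_ι] using mem_filt_of_const p' (h0 x) k)
      rwa [List.length_map, hw] at this)

variable (τ : ℂ →+* ℂ) (s : X → Series p')
    (hs : ∀ x, s x ∈ homog (A := Series p') (p x)) (h0 : ∀ x, const p' (s x) = 0)

theorem tsubst_tgen (k : ℕ) (x : X) : tsubst p p' τ s hs h0 k (tgen p k x) = trunc p' k (s x) := by
  rw [tsubst, tgen, SQuot.lift_mk, freeSemi_ι]

theorem tsubst_algebraMap (k : ℕ) (c : ℂ) :
    tsubst p p' τ s hs h0 k (algebraMap ℂ _ c) = algebraMap ℂ _ (τ c) := by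
  rw [tsubst, ← AlgHom.commutes (SQuot.mk (TruncRel p k))]
  rw [SQuot.lift_mk, freeSemi_algebraMap]

theorem tsubst_smul (k : ℕ) (c : ℂ) (a : Trunc p k) :
    tsubst p p' τ s hs h0 k (c • a) = τ c • tsubst p p' τ s hs h0 k a := by
  rw [Algebra.smul_def, map_mul, tsubst_algebraMap, ← Algebra.smul_def]

theorem tsubst_word (k : ℕ) (w : List X) :
    tsubst p p' τ s hs h0 k (word p k w) = (w.map fun x => trunc p' k (s x)).prod := by
  rw [word, map_list_prod, List.map_map]
  congr 2
  ext x
  exact tsubst_tgen p p' τ s hs h0 k x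

theorem tsubst_res (k : ℕ) (a : Trunc p (k + 1)) :
    res p' k (tsubst p p' τ s hs h0 (k + 1) a) = tsubst p p' τ s hs h0 k (res p k a) := by
  have ha : a ∈ Submodule.span ℂ (Set.range (word p (k + 1))) := by rw [span_word]; trivial
  induction ha using Submodule.span_induction with
  | zero => simp
  | add x y _ _ h h' => simp only [map_add, h, h']
  | smul c x _ h => rw [tsubst_smul, map_smul, map_smul, tsubst_smul, h]
  | mem b hb =>
    obtain ⟨w, rfl⟩ := hb
    rw [res_word, tsubst_word, tsubst_word, map_list_prod, List.map_map]
    congr 2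
    ext x
    exact res_trunc p' (s x) k

theorem tsubst_mem_thomog (k : ℕ) {q : ZMod 2} {a : Trunc p k} (ha : a ∈ thomog p k q) :
    tsubst p p' τ s hs h0 k a ∈ thomog p' k q := by
  induction ha using Submodule.span_induction with
  | zero => simp
  | add x y _ _ h h' => rw [map_add]; exact Submodule.add_mem _ h h'
  | smul c x _ h => rw [tsubst_smul]; exact Submodule.smul_mem _ _ h
  | mem b hb =>
    obtain ⟨w, rfl, rfl⟩ := hb
    rw [tsubst_word]
    induction w with
    | nil => simpa using one_mem_thomog p' k
    | cons x w ih => simpa using mul_mem_thomog p' k (hs x k) ih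

/-- Semilinear substitution of power series without constant term for the variables. -/
def substSemi : Series p →+* Series p' where
  toFun a := mkSeries p' (fun k => tsubst p p' τ s hs h0 k (trunc p k a)) fun k => by
    rw [tsubst_res, res_trunc]
  map_one' := by apply series_ext; intro k; simp [trunc_mkSeries]
  map_zero' := by apply series_ext; intro k; simp [trunc_mkSeries]
  map_mul' a b := by apply series_ext; intro k; simp [trunc_mkSeries]
  map_add' a b := by apply series_ext; intro k; simp [trunc_mkSeries]

theorem trunc_substSemi (k : ℕ) (a : Series p) :
    trunc p' k (substSemi p p' τ s hs h0 a) = tsubst p p' τ s hs h0 k (trunc p k a) := rfl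

theorem substSemi_var (x : X) : substSemi p p' τ s hs h0 (var p x) = s x := by
  apply series_ext; intro k; exact tsubst_tgen p p' τ s hs h0 k x

theorem substSemi_smul (c : ℂ) (a : Series p) :
    substSemi p p' τ s hs h0 (c • a) = τ c • substSemi p p' τ s hs h0 a := by
  apply series_ext; intro k
  rw [trunc_substSemi, map_smul (trunc p k), map_smul (trunc p' k), tsubst_smul, trunc_substSemi]

theorem substSemi_mem_homog {q : ZMod 2} {a : Series p} (ha : a ∈ homog (A := Series p) q) :
    substSemi p p' τ s hs h0 a ∈ homog (A := Series p') q :=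
  fun k => tsubst_mem_thomog p p' τ s hs h0 k (ha k)

/-- Substitution of power series without constant term for the variables. -/
def subst : Series p →ₐ[ℂ] Series p' :=
  { substSemi p p' (RingHom.id ℂ) s hs h0 with
    commutes' := fun c => by
      have := substSemi_smul p p' (RingHom.id ℂ) s hs h0 c 1
      rw [Algebra.algebraMap_eq_smul_one, Algebra.algebraMap_eq_smul_one]
      change substSemi p p' (RingHom.id ℂ) s hs h0 (c • 1) = _
      rw [this, map_one]; rfl }

theorem subst_var (x : X) : subst p p' s hs h0 (var p x) = s x :=
  substSemi_var p p' (RingHom.id ℂ) s hs h0 x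

theorem subst_mem_homog {q : ZMod 2} {a : Series p} (ha : a ∈ homog (A := Series p) q) :
    subst p p' s hs h0 a ∈ homog (A := Series p') q :=
  substSemi_mem_homog p p' (RingHom.id ℂ) s hs h0 ha

end Series

/-! ### Supermatrices and the superdeterminant -/

section Det

variable {A : Type} [Ring A]

/-- The determinant, by the Leibniz formula. It is used for matrices with commuting entries. -/
def ncdet {k : ℕ} (M : Matrix (Fin k) (Fin k) A) : A :=
  ∑ σ : Equiv.Perm (Fin k), (Equiv.Perm.sign σ : ℤ) • (List.ofFn fun i => M (σ i) i).prod

/-- The superdeterminant of a supermatrix with blocks `P, B, C, D`. -/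
def sdetBlocks {n m : ℕ} (P : Matrix (Fin n) (Fin n) A) (B : Matrix (Fin n) (Fin m) A)
    (C : Matrix (Fin m) (Fin n) A) (D : Matrix (Fin m) (Fin m) A) : A :=
  ncdet (P - B * Ring.inverse D * C) * Ring.inverse (ncdet D)

/-- The superdeterminant of an `(n + m) × (n + m)` supermatrix. -/
def sdet (n m : ℕ) (M : Matrix (Fin (n + m)) (Fin (n + m)) A) : A :=
  sdetBlocks (M.submatrix (Fin.castAdd m) (Fin.castAdd m))
    (M.submatrix (Fin.castAdd m) (Fin.natAdd n)) (M.submatrix (Fin.natAdd n) (Fin.castAdd m))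
    (M.submatrix (Fin.natAdd n) (Fin.natAdd n))

theorem ncdet_map {A' : Type} [Ring A'] (f : A →+* A') {k : ℕ} (M : Matrix (Fin k) (Fin k) A) :
    f (ncdet M) = ncdet (M.map f) := by
  unfold ncdet
  rw [map_sum]
  refine Finset.sum_congr rfl fun σ _ => ?_
  rw [map_zsmul, map_list_prod, List.map_ofFn]
  rfl

theorem ncdet_comm {R : Type} [CommRing R] {k : ℕ} (M : Matrix (Fin k) (Fin k) R) :
    ncdet M = M.det := by
  rw [ncdet, Matrix.det_apply]
  refine Finset.sum_congr rfl fun σ _ => ?_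
  rw [List.prod_ofFn]
  rfl

/-- Matrices with central entries. -/
def CentralMat {k l : ℕ} (M : Matrix (Fin k) (Fin l) A) : Prop :=
  ∀ i j, M i j ∈ Subring.center A

theorem CentralMat.exists_lift {k l : ℕ} {M : Matrix (Fin k) (Fin l) A} (h : CentralMat M) :
    ∃ N : Matrix (Fin k) (Fin l) (Subring.center A), N.map (Subring.center A).subtype = M :=
  ⟨fun i j => ⟨M i j, h i j⟩, rfl⟩

theorem ncdet_lift {k : ℕ} (N : Matrix (Fin k) (Fin k) (Subring.center A)) :
    ncdet (N.map (Subring.center A).subtype) = (Subring.center A).subtype N.det := by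
  rw [← ncdet_map, ncdet_comm]

theorem ncdet_central {k : ℕ} {M : Matrix (Fin k) (Fin k) A} (h : CentralMat M) :
    ncdet M ∈ Subring.center A := by
  obtain ⟨N, rfl⟩ := h.exists_lift
  rw [ncdet_lift]
  exact N.det.2

theorem ncdet_mul {k : ℕ} {M M' : Matrix (Fin k) (Fin k) A} (h : CentralMat M)
    (h' : CentralMat M') : ncdet (M * M') = ncdet M * ncdet M' := by
  obtain ⟨N, rfl⟩ := h.exists_lift
  obtain ⟨N', rfl⟩ := h'.exists_lift
  rw [← Matrix.map_mul, ncdet_lift, ncdet_lift, ncdet_lift, Matrix.det_mul, map_mul]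

theorem center_mul_comm {a : A} (ha : a ∈ Subring.center A) (b : A) : a * b = b * a :=
  (Subring.mem_center_iff.1 ha b).symm

theorem inverse_central {a : A} (ha : a ∈ Subring.center A) (hu : IsUnit a) :
    Ring.inverse a ∈ Subring.center A := by
  rw [Subring.mem_center_iff]
  intro g
  calc g * Ring.inverse a = Ring.inverse a * (a * g) * Ring.inverse a := by
        rw [← mul_assoc, Ring.inverse_mul_cancel _ hu, one_mul]
    _ = Ring.inverse a * g := by
        rw [center_mul_comm ha, mul_assoc, mul_assoc, Ring.mul_inverse_cancel _ hu, mul_one]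

theorem isUnit_lift {a : Subring.center A} (hu : IsUnit (a : A)) : IsUnit a := by
  refine ⟨⟨a, ⟨_, inverse_central a.2 hu⟩, ?_, ?_⟩, rfl⟩
  · exact Subtype.ext (Ring.mul_inverse_cancel _ hu)
  · exact Subtype.ext (Ring.inverse_mul_cancel _ hu)

theorem ringInverse_eq {R : Type} [Ring R] {a b : R} (h : a * b = 1) (h' : b * a = 1) :
    Ring.inverse a = b := Ring.inverse_unit (⟨a, b, h, h'⟩ : Rˣ)

theorem map_ringInverse {R R' : Type} [Ring R] [Ring R'] (f : R →+* R') {a : R}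
    (h : IsUnit a) : f (Ring.inverse a) = Ring.inverse (f a) :=
  (ringInverse_eq (by rw [← map_mul, Ring.mul_inverse_cancel _ h, map_one])
    (by rw [← map_mul, Ring.inverse_mul_cancel _ h, map_one])).symm

theorem isUnit_of_ncdet {k : ℕ} {M : Matrix (Fin k) (Fin k) A} (h : CentralMat M)
    (hu : IsUnit (ncdet M)) : IsUnit M ∧ CentralMat (Ring.inverse M) := by
  obtain ⟨N, rfl⟩ := h.exists_lift
  rw [ncdet_lift] at hu
  have h1 : IsUnit N := (Matrix.isUnit_iff_isUnit_det N).2 (isUnit_lift hu)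
  refine ⟨h1.map (RingHom.mapMatrix (Subring.center A).subtype), ?_⟩
  have := map_ringInverse (RingHom.mapMatrix (Subring.center A).subtype) h1
  rw [RingHom.mapMatrix_apply, RingHom.mapMatrix_apply] at this
  rw [← this]
  exact fun i j => (Ring.inverse N i j).2

theorem CentralMat.mul {k l r : ℕ} {M : Matrix (Fin k) (Fin l) A} {N : Matrix (Fin l) (Fin r) A}
    (h : CentralMat M) (h' : CentralMat N) : CentralMat (M * N) := fun i j => by
  rw [Matrix.mul_apply]
  exact sum_mem fun x _ => mul_mem (h i x) (h' x j)

theorem ncdet_one_add_row {k : ℕ} {M : Matrix (Fin k) (Fin k) A} (h : CentralMat M) (p : Fin k)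
    (hp : ∀ i j, i ≠ p → M i j = 0) : ncdet (1 + M) = 1 + M p p := by
  obtain ⟨N, rfl⟩ := h.exists_lift
  have e : N = Matrix.replicateCol Unit (Pi.single p (1 : Subring.center A)) *
      Matrix.replicateRow Unit (fun j => N p j) := by
    ext i j
    by_cases hi : i = p
    · subst hi; simp [Matrix.mul_apply]
    · have := hp i j hi
      simp only [Matrix.map_apply, Subring.subtype_apply] at this
      simp [Matrix.mul_apply, hi, this]
  have e1 : (1 + N.map (Subring.center A).subtype : Matrix (Fin k) (Fin k) A) =
      (1 + N).map (Subring.center A).subtype := by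
    have := map_add (RingHom.mapMatrix (m := Fin k) (Subring.center A).subtype) 1 N
    rw [map_one] at this
    exact this.symm
  rw [e1, ncdet_lift]
  have : (1 + N).det = 1 + N p p := by
    conv_lhs => rw [e]
    rw [Matrix.det_one_add_replicateCol_mul_replicateRow]
    simp
  rw [this, map_add, map_one]
  rfl

theorem ncdet_transpose {k : ℕ} {M : Matrix (Fin k) (Fin k) A} (h : CentralMat M) :
    ncdet M.transpose = ncdet M := by
  obtain ⟨N, rfl⟩ := h.exists_lift
  rw [← Matrix.transpose_map, ncdet_lift, ncdet_lift, Matrix.det_transpose]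

/-- Matrices with entries in a given set of odd elements. -/
def MatIn {k l : ℕ} (O : Submodule (Subring.center A) A) (M : Matrix (Fin k) (Fin l) A) : Prop :=
  ∀ i j, M i j ∈ O

variable {O : Submodule (Subring.center A) A}

theorem MatIn.mul_central {k l r : ℕ} {M : Matrix (Fin k) (Fin l) A}
    {N : Matrix (Fin l) (Fin r) A} (h : MatIn O M) (h' : CentralMat N) : MatIn O (M * N) :=
  fun i j => by
    rw [Matrix.mul_apply]
    refine sum_mem fun x _ => ?_
    rw [← center_mul_comm (h' x j)]
    exact O.smul_mem ⟨_, h' x j⟩ (h i x)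

theorem MatIn.central_mul {k l r : ℕ} {M : Matrix (Fin k) (Fin l) A}
    {N : Matrix (Fin l) (Fin r) A} (h : CentralMat M) (h' : MatIn O N) : MatIn O (M * N) :=
  fun i j => by
    rw [Matrix.mul_apply]
    exact sum_mem fun x _ => O.smul_mem ⟨_, h i x⟩ (h' x j)

theorem MatIn.add {k l : ℕ} {M N : Matrix (Fin k) (Fin l) A}
    (h : MatIn O M) (h' : MatIn O N) : MatIn O (M + N) := fun i j => add_mem (h i j) (h' i j)

theorem CentralMat.add {k l : ℕ} {M N : Matrix (Fin k) (Fin l) A}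
    (h : CentralMat M) (h' : CentralMat N) : CentralMat (M + N) :=
  fun i j => add_mem (h i j) (h' i j)

theorem CentralMat.sub {k l : ℕ} {M N : Matrix (Fin k) (Fin l) A}
    (h : CentralMat M) (h' : CentralMat N) : CentralMat (M - N) :=
  fun i j => sub_mem (h i j) (h' i j)

theorem CentralMat.one {k : ℕ} : CentralMat (1 : Matrix (Fin k) (Fin k) A) := fun i j => by
  rw [Matrix.one_apply]
  split_ifs
  exacts [one_mem _, zero_mem _]

/-- The products of odd elements are central and anticommute. -/
structure OddLaws (O : Submodule (Subring.center A) A) : Prop where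
  mul_mem : ∀ a ∈ O, ∀ b ∈ O, a * b ∈ Subring.center A
  sq : ∀ a ∈ O, a * a = 0
  anti : ∀ a ∈ O, ∀ b ∈ O, a * b = -(b * a)

theorem MatIn.mul (hO : OddLaws O) {k l r : ℕ} {M : Matrix (Fin k) (Fin l) A}
    {N : Matrix (Fin l) (Fin r) A} (h : MatIn O M) (h' : MatIn O N) : CentralMat (M * N) :=
  fun i j => by
    rw [Matrix.mul_apply]
    exact sum_mem fun x _ => hO.mul_mem _ (h i x) _ (h' x j)

variable {n m : ℕ}

theorem sdetBlocks_upper (P : Matrix (Fin n) (Fin n) A) (B F : Matrix (Fin n) (Fin m) A)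
    (C : Matrix (Fin m) (Fin n) A) {D : Matrix (Fin m) (Fin m) A} (hD : IsUnit D) :
    sdetBlocks (P + F * C) (B + F * D) C D = sdetBlocks P B C D := by
  unfold sdetBlocks
  congr 2
  rw [Matrix.add_mul, Matrix.add_mul, Matrix.mul_assoc F D, Ring.mul_inverse_cancel _ hD,
    Matrix.mul_one]
  abel

theorem sdetBlocks_diag {P Q' : Matrix (Fin n) (Fin n) A} {B : Matrix (Fin n) (Fin m) A}
    {C : Matrix (Fin m) (Fin n) A} {D Q : Matrix (Fin m) (Fin m) A} (hO : OddLaws O)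
    (hP : CentralMat P) (hQ' : CentralMat Q') (hB : MatIn O B) (hC : MatIn O C)
    (hD : CentralMat D) (hQ : CentralMat Q) (uD : IsUnit (ncdet D)) (uQ : IsUnit (ncdet Q)) :
    sdetBlocks (Q' * P) (Q' * B) (Q * C) (Q * D) =
      ncdet Q' * Ring.inverse (ncdet Q) * sdetBlocks P B C D := by
  obtain ⟨vD, cD⟩ := isUnit_of_ncdet hD uD
  obtain ⟨vQ, cQ⟩ := isUnit_of_ncdet hQ uQ
  have h1 : Q' * P - Q' * B * Ring.inverse (Q * D) * (Q * C) =
      Q' * (P - B * Ring.inverse D * C) := by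
    have e : Ring.inverse Q * (Q * C) = C := by
      rw [← Matrix.mul_assoc, Ring.inverse_mul_cancel _ vQ, Matrix.one_mul]
    rw [Ring.inverse_mul (Or.inl vQ), Matrix.mul_sub, Matrix.mul_assoc (Q' * B),
      Matrix.mul_assoc (Ring.inverse D), e]
    simp only [Matrix.mul_assoc]
  unfold sdetBlocks
  rw [h1, ncdet_mul hQ' (hP.sub ((hB.mul_central cD).mul hO hC)), ncdet_mul hQ hD,
    Ring.inverse_mul (Or.inl uQ)]
  have := inverse_central (ncdet_central hQ) uQ
  rw [mul_assoc (ncdet Q'), mul_assoc (ncdet Q'), center_mul_comm this, mul_assoc]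

theorem sdetBlocks_single {P : Matrix (Fin n) (Fin n) A} {B : Matrix (Fin n) (Fin m) A}
    {C : Matrix (Fin m) (Fin n) A} {D : Matrix (Fin m) (Fin m) A} (hO : OddLaws O)
    (hP : CentralMat P) (hB : MatIn O B) (hC : MatIn O C)
    (hD : CentralMat D) (uD : IsUnit (ncdet D)) (p : Fin m) (q : Fin n) {ε : A} (hε : ε ∈ O) :
    IsUnit (ncdet (D + Matrix.single p q ε * B)) ∧
      sdetBlocks P B (C + Matrix.single p q ε * P) (D + Matrix.single p q ε * B) =
        sdetBlocks P B C D := by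
  obtain ⟨vD, cD⟩ := isUnit_of_ncdet hD uD
  have hE : MatIn O (Matrix.single p q ε) := fun i j => by
    rw [Matrix.single_apply]
    split_ifs
    exacts [hε, O.zero_mem]
  set E := Matrix.single p q ε with hEdef
  set W := B * Ring.inverse D with hWdef
  have hW : MatIn O W := hB.mul_central cD
  have hWD : W * D = B := by
    rw [hWdef, Matrix.mul_assoc, Ring.inverse_mul_cancel _ vD, Matrix.mul_one]
  have hEWE : E * W * E = 0 := by
    ext i j
    rw [hEdef, Matrix.mul_assoc, Matrix.zero_apply]
    by_cases hi : i = p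
    · subst hi
      rw [Matrix.single_mul_apply_same]
      by_cases hj : j = q
      · subst hj
        rw [Matrix.mul_single_apply_same, hO.anti _ (hW _ _) _ hε, mul_neg, ← mul_assoc,
          hO.sq _ hε, zero_mul, neg_zero]
      · rw [Matrix.mul_single_apply_of_ne _ _ _ _ _ hj, mul_zero]
    · rw [Matrix.single_mul_apply_of_ne _ _ _ _ _ hi]
  have hEW : CentralMat (E * W) := hE.mul hO hW
  have hWE : CentralMat (W * E) := hW.mul hO hE
  have hD' : D + E * B = (1 + E * W) * D := by
    rw [Matrix.add_mul, Matrix.one_mul, Matrix.mul_assoc, hWD]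
  have hz : E * W * (E * W) = 0 := by rw [← Matrix.mul_assoc, hEWE, Matrix.zero_mul]
  have hinv : Ring.inverse (D + E * B) = Ring.inverse D * (1 - E * W) := by
    rw [hD']
    have i1 : (1 + E * W) * (1 - E * W) = 1 := by
      rw [Matrix.add_mul, Matrix.mul_sub, Matrix.mul_sub, hz]; simp
    have i2 : (1 - E * W) * (1 + E * W) = 1 := by
      rw [Matrix.sub_mul, Matrix.mul_add, Matrix.mul_add, hz]; simp
    apply ringInverse_eq
    · rw [Matrix.mul_assoc, ← Matrix.mul_assoc D, Ring.mul_inverse_cancel _ vD, Matrix.one_mul, i1]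
    · rw [Matrix.mul_assoc, ← Matrix.mul_assoc (1 - E * W), i2, Matrix.one_mul,
        Ring.inverse_mul_cancel _ vD]
  have hS : P - B * Ring.inverse (D + E * B) * (C + E * P) = (1 - W * E) * (P - W * C) := by
    rw [hinv, ← Matrix.mul_assoc, ← hWdef]
    have : W * (1 - E * W) * (C + E * P) = W * C + W * E * P - W * E * W * C
        - W * (E * W * E) * P := by
      simp only [Matrix.mul_add, Matrix.mul_sub, Matrix.sub_mul, Matrix.mul_one, Matrix.mul_assoc]
      abel
    rw [this, hEWE]
    simp only [Matrix.mul_sub, Matrix.sub_mul, Matrix.one_mul, Matrix.mul_assoc, Matrix.mul_zero,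
      Matrix.zero_mul]
    abel
  have hpp : (E * W) p p = ε * W q p := by rw [hEdef, Matrix.single_mul_apply_same]
  have hqq : (W * E) q q = W q p * ε := by rw [hEdef, Matrix.mul_single_apply_same]
  have d1 : ncdet (1 + E * W) = 1 + ε * W q p := by
    rw [ncdet_one_add_row hEW p, hpp]
    intro i j hi
    rw [hEdef, Matrix.single_mul_apply_of_ne _ _ _ _ _ hi]
  have hWEn : CentralMat (-(W * E)) := fun i j => neg_mem (hWE i j)
  have d2 : ncdet (1 - W * E) = 1 + ε * W q p := by
    rw [sub_eq_add_neg, ← ncdet_transpose (CentralMat.one.add hWEn), Matrix.transpose_add,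
      Matrix.transpose_one, ncdet_one_add_row (M := (-(W * E)).transpose)
        (fun i j => hWEn j i) q]
    · rw [Matrix.transpose_apply, Matrix.neg_apply, hqq, hO.anti _ (hW _ _) _ hε, neg_neg]
    · intro i j hi
      rw [Matrix.transpose_apply, Matrix.neg_apply, hEdef,
        Matrix.mul_single_apply_of_ne _ _ _ _ _ hi, neg_zero]
  have ct : ε * W q p ∈ Subring.center A := hO.mul_mem _ hε _ (hW _ _)
  have t2 : ε * W q p * (ε * W q p) = 0 := by
    rw [← mul_assoc, center_mul_comm ct, ← mul_assoc, hO.sq _ hε, zero_mul, zero_mul]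
  have ut : IsUnit (1 + ε * W q p) := by
    have : IsNilpotent (ε * W q p) := ⟨2, by rw [pow_two, t2]⟩
    exact this.isUnit_one_add
  have c1 : CentralMat (1 + E * W) := CentralMat.one.add hEW
  have dD : ncdet (D + E * B) = (1 + ε * W q p) * ncdet D := by
    rw [hD', ncdet_mul c1 hD, d1]
  refine ⟨by rw [dD]; exact ut.mul uD, ?_⟩
  unfold sdetBlocks
  rw [hS, dD, ncdet_mul (CentralMat.one.sub hWE) (hP.sub (hW.mul hO hC)), d2,
    Ring.inverse_mul (Or.inl ut)]
  have c2 : 1 + ε * W q p ∈ Subring.center A := add_mem (one_mem _) ct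
  rw [center_mul_comm c2, mul_assoc, ← mul_assoc (1 + ε * W q p), center_mul_comm c2,
    mul_assoc, Ring.mul_inverse_cancel _ ut, mul_one]

/-- Left multiplication by a lower unipotent supermatrix preserves the superdeterminant. -/
def LowerOK (O : Submodule (Subring.center A) A) (E : Matrix (Fin m) (Fin n) A) : Prop :=
  MatIn O E ∧ ∀ (P : Matrix (Fin n) (Fin n) A) (B : Matrix (Fin n) (Fin m) A)
    (C : Matrix (Fin m) (Fin n) A) (D : Matrix (Fin m) (Fin m) A),
    CentralMat P → MatIn O B → MatIn O C → CentralMat D → IsUnit (ncdet D) →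
    IsUnit (ncdet (D + E * B)) ∧
      sdetBlocks P B (C + E * P) (D + E * B) = sdetBlocks P B C D

theorem LowerOK.add (hO : OddLaws O) {E E' : Matrix (Fin m) (Fin n) A} (h : LowerOK O E)
    (h' : LowerOK O E') : LowerOK O (E + E') := by
  refine ⟨h.1.add h'.1, fun P B C D hP hB hC hD uD => ?_⟩
  obtain ⟨u, e⟩ := h'.2 P B C D hP hB hC hD uD
  obtain ⟨u', e'⟩ := h.2 P B _ _ hP hB (hC.add (h'.1.mul_central hP))
    (hD.add (h'.1.mul hO hB)) u
  rw [Matrix.add_mul, Matrix.add_mul, add_comm (E * B), add_comm (E * P), ← add_assoc,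
    ← add_assoc]
  exact ⟨u', e'.trans e⟩

theorem LowerOK.zero : LowerOK O (0 : Matrix (Fin m) (Fin n) A) :=
  ⟨fun _ _ => O.zero_mem, fun P B C D _ _ _ _ uD => by simpa using uD⟩

theorem sdetBlocks_lower (hO : OddLaws O) (E : Matrix (Fin m) (Fin n) A) (hE : MatIn O E) :
    LowerOK O E := by
  rw [Matrix.matrix_eq_sum_single E]
  refine Finset.sum_induction _ (LowerOK O) (fun _ _ => LowerOK.add hO) LowerOK.zero fun i _ => ?_
  refine Finset.sum_induction _ (LowerOK O) (fun _ _ => LowerOK.add hO) LowerOK.zero fun j _ => ?_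
  refine ⟨fun a b => ?_, fun P B C D hP hB hC hD uD =>
    sdetBlocks_single hO hP hB hC hD uD i j (hE i j)⟩
  rw [Matrix.single_apply]
  split_ifs
  exacts [hE i j, O.zero_mem]

/-- Multiplicativity of the superdeterminant, in block form. -/
theorem sdetBlocks_mul (hO : OddLaws O)
    {P P' : Matrix (Fin n) (Fin n) A} {B B' : Matrix (Fin n) (Fin m) A}
    {C C' : Matrix (Fin m) (Fin n) A} {D D' : Matrix (Fin m) (Fin m) A}
    (hP : CentralMat P) (hB : MatIn O B) (hC : MatIn O C) (hD : CentralMat D)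
    (uD : IsUnit (ncdet D)) (hP' : CentralMat P') (hB' : MatIn O B') (hC' : MatIn O C')
    (hD' : CentralMat D') (uD' : IsUnit (ncdet D')) :
    sdetBlocks (P * P' + B * C') (P * B' + B * D') (C * P' + D * C') (C * B' + D * D') =
      sdetBlocks P B C D * sdetBlocks P' B' C' D' := by
  obtain ⟨vD, cD⟩ := isUnit_of_ncdet hD uD
  have hE : MatIn O (Ring.inverse D * C) := MatIn.central_mul cD hC
  obtain ⟨u, e⟩ := (sdetBlocks_lower hO _ hE).2 _ _ _ _ hP' hB' hC' hD' uD'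
  have cS : CentralMat (P - B * Ring.inverse D * C) := hP.sub ((hB.mul_central cD).mul hO hC)
  have cD2 : CentralMat (D' + Ring.inverse D * C * B') := hD'.add (hE.mul hO hB')
  have e2 := sdetBlocks_diag hO hP' cS hB' (hC'.add (hE.mul_central hP')) cD2 hD u uD
  have u2 : IsUnit (D * (D' + Ring.inverse D * C * B')) :=
    (isUnit_of_ncdet (hD.mul cD2) (by rw [ncdet_mul hD cD2]; exact uD.mul u)).1
  have e3 := sdetBlocks_upper ((P - B * Ring.inverse D * C) * P')
    ((P - B * Ring.inverse D * C) * B') (B * Ring.inverse D)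
    (D * (C' + Ring.inverse D * C * P')) u2
  have f : ∀ {r : ℕ} (Z : Matrix (Fin n) (Fin r) A), D * (Ring.inverse D * C * Z) = C * Z := by
    intro r Z
    rw [← Matrix.mul_assoc, ← Matrix.mul_assoc, Ring.mul_inverse_cancel _ vD, Matrix.one_mul]
  have g : ∀ {r : ℕ} (Z : Matrix (Fin m) (Fin r) A), B * Ring.inverse D * (D * Z) = B * Z := by
    intro r Z
    rw [Matrix.mul_assoc, ← Matrix.mul_assoc _ D, Ring.inverse_mul_cancel _ vD, Matrix.one_mul]
  rw [e] at e2
  rw [e2] at e3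
  rw [show ncdet (P - B * Ring.inverse D * C) * Ring.inverse (ncdet D) = sdetBlocks P B C D
    from rfl] at e3
  rw [← e3]
  have k1 : (P - B * Ring.inverse D * C) * P' +
      B * Ring.inverse D * (D * (C' + Ring.inverse D * C * P')) = P * P' + B * C' := by
    rw [g, Matrix.mul_add, Matrix.sub_mul]
    simp only [Matrix.mul_assoc]
    abel
  have k2 : (P - B * Ring.inverse D * C) * B' +
      B * Ring.inverse D * (D * (D' + Ring.inverse D * C * B')) = P * B' + B * D' := by
    rw [g, Matrix.mul_add, Matrix.sub_mul]
    simp only [Matrix.mul_assoc]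
    abel
  have k3 : D * (C' + Ring.inverse D * C * P') = C * P' + D * C' := by
    rw [Matrix.mul_add, f, add_comm]
  have k4 : D * (D' + Ring.inverse D * C * B') = C * B' + D * D' := by
    rw [Matrix.mul_add, f, add_comm]
  rw [k1, k2, k3, k4]

end Det

section SeriesLaws

variable {X : Type} (p : X → ZMod 2)

theorem homog_zero_central {a : Series p} (ha : a ∈ homog (A := Series p) 0) :
    a ∈ Subring.center (Series p) := by
  rw [Subring.mem_center_iff]
  intro g
  apply series_ext
  intro k
  rw [map_mul, map_mul]
  exact (thomog_zero_comm p k (ha k) (trunc p k g)).symm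

theorem one_mem_homog : (1 : Series p) ∈ homog (A := Series p) 0 :=
  fun k => by rw [map_one]; exact one_mem_thomog p k

theorem mul_mem_homog {q r : ZMod 2} {a b : Series p} (ha : a ∈ homog (A := Series p) q)
    (hb : b ∈ homog (A := Series p) r) : a * b ∈ homog (A := Series p) (q + r) :=
  fun k => by rw [map_mul]; exact mul_mem_thomog p k (ha k) (hb k)

/-- The module over the center that is generated by the odd power series. -/
def oddSpan : Submodule (Subring.center (Series p)) (Series p) :=
  Submodule.span _ (homog (A := Series p) 1 : Set (Series p))

theorem homog_one_anti {a b : Series p} (ha : a ∈ homog (A := Series p) 1)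
    (hb : b ∈ homog (A := Series p) 1) : a * b = -(b * a) := by
  apply series_ext
  intro k
  rw [map_neg, map_mul, map_mul, thomog_comm p k (ha k) (hb k), mul_one, sgn_one,
    neg_smul, one_smul]

theorem oddLaws : OddLaws (oddSpan p) := by
  have anti : ∀ a ∈ oddSpan p, ∀ b ∈ oddSpan p,
      a * b ∈ Subring.center (Series p) ∧ a * b = -(b * a) := by
    intro a ha b hb
    induction ha using Submodule.span_induction with
    | zero => rw [zero_mul, mul_zero, neg_zero]; exact ⟨zero_mem _, rfl⟩
    | add x y _ _ h h' =>
      rw [add_mul, mul_add, neg_add, ← h.2, ← h'.2]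
      exact ⟨add_mem h.1 h'.1, rfl⟩
    | smul c x _ h =>
      have e1 : (c • x) * b = c.1 * (x * b) := mul_assoc c.1 x b
      have e2 : b * (c • x) = c.1 * (b * x) := by
        change b * (c.1 * x) = _
        rw [← mul_assoc, ← center_mul_comm c.2, mul_assoc]
      rw [e1, e2, h.2, mul_neg]
      refine ⟨?_, rfl⟩
      rw [← mul_neg, ← h.2]
      exact mul_mem c.2 h.1
    | mem a ha =>
      induction hb using Submodule.span_induction with
      | zero => rw [zero_mul, mul_zero, neg_zero]; exact ⟨zero_mem _, rfl⟩
      | add x y _ _ h h' =>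
        rw [mul_add, add_mul, neg_add, ← h.2, ← h'.2]
        exact ⟨add_mem h.1 h'.1, rfl⟩
      | smul c x _ h =>
        have e1 : (c • x) * a = c.1 * (x * a) := mul_assoc c.1 x a
        have e2 : a * (c • x) = c.1 * (a * x) := by
          change a * (c.1 * x) = _
          rw [← mul_assoc, ← center_mul_comm c.2, mul_assoc]
        rw [e1, e2, h.2, mul_neg]
        refine ⟨?_, rfl⟩
        rw [← mul_neg, ← h.2]
        exact mul_mem c.2 h.1
      | mem b hb =>
        have h0 := mul_mem_homog p (q := 1) (r := 1) ha hb
        rw [show (1 : ZMod 2) + 1 = 0 from rfl] at h0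
        exact ⟨homog_zero_central p h0, homog_one_anti p ha hb⟩
  refine ⟨fun a ha b hb => (anti a ha b hb).1, fun a ha => ?_, fun a ha b hb => (anti a ha b hb).2⟩
  have h := (anti a ha a ha).2
  have h2 : a * a + a * a = 0 := by
    nth_rewrite 1 [h]
    exact neg_add_cancel _
  have h3 : algebraMap ℂ (Series p) 2⁻¹ * (a * a + a * a) = a * a := by
    rw [← two_mul, ← mul_assoc, ← map_ofNat (algebraMap ℂ (Series p)) 2, ← map_mul,
      inv_mul_cancel₀ two_ne_zero, map_one, one_mul]
  rw [← h3, h2, mul_zero]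

end SeriesLaws

/-- The parity of an index: the first `n` indices are even, the last `m` are odd. -/
def par (n m : ℕ) (i : Fin (n + m)) : ZMod 2 := if i.val < n then 0 else 1

theorem par_castAdd (n m : ℕ) (i : Fin n) : par n m (Fin.castAdd m i) = 0 := by simp [par]

theorem par_natAdd (n m : ℕ) (i : Fin m) : par n m (Fin.natAdd n i) = 1 := by simp [par]

/-- A supermatrix: the entry at `(i, j)` has parity `|i| + |j|`. -/
def IsSupermatrix {A : Type} [Ring A] [Algebra ℂ A] [SuperGraded A] (n m : ℕ)
    (M : Matrix (Fin (n + m)) (Fin (n + m)) A) : Prop :=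
  ∀ i j, M i j ∈ homog (A := A) (par n m i + par n m j)

section SdetSeries

variable {X : Type} {p : X → ZMod 2} {n m : ℕ}

theorem isUnit_ncdet_of_const {k : ℕ} {M : Matrix (Fin k) (Fin k) (Series p)}
    (h : M.map (const p) = 1) : IsUnit (ncdet M) := by
  apply isUnit_of_const
  have := ncdet_map (const p).toRingHom M
  change const p (ncdet M) = ncdet (M.map (const p)) at this
  rw [this, h, ncdet_comm, Matrix.det_one]

theorem const_natAdd {M : Matrix (Fin (n + m)) (Fin (n + m)) (Series p)}
    (h : M.map (const p) = 1) :
    (M.submatrix (Fin.natAdd n) (Fin.natAdd n)).map (const p) = 1 := by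
  ext i j
  have := congrFun (congrFun h (Fin.natAdd n i)) (Fin.natAdd n j)
  simpa [Matrix.one_apply] using this

theorem central_even {M : Matrix (Fin (n + m)) (Fin (n + m)) (Series p)}
    (h : IsSupermatrix n m M) :
    CentralMat (M.submatrix (Fin.castAdd m) (Fin.castAdd m)) := fun i j => by
  have := h (Fin.castAdd m i) (Fin.castAdd m j)
  rw [par_castAdd, par_castAdd, add_zero] at this
  exact homog_zero_central p this

theorem central_odd {M : Matrix (Fin (n + m)) (Fin (n + m)) (Series p)}
    (h : IsSupermatrix n m M) :
    CentralMat (M.submatrix (Fin.natAdd n) (Fin.natAdd n)) := fun i j => by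
  have := h (Fin.natAdd n i) (Fin.natAdd n j)
  rw [par_natAdd, par_natAdd] at this
  exact homog_zero_central p this

theorem matIn_upper {M : Matrix (Fin (n + m)) (Fin (n + m)) (Series p)}
    (h : IsSupermatrix n m M) :
    MatIn (oddSpan p) (M.submatrix (Fin.castAdd m) (Fin.natAdd n)) := fun i j => by
  have := h (Fin.castAdd m i) (Fin.natAdd n j)
  rw [par_castAdd, par_natAdd, zero_add] at this
  exact Submodule.subset_span this

theorem matIn_lower {M : Matrix (Fin (n + m)) (Fin (n + m)) (Series p)}
    (h : IsSupermatrix n m M) :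
    MatIn (oddSpan p) (M.submatrix (Fin.natAdd n) (Fin.castAdd m)) := fun i j => by
  have := h (Fin.natAdd n i) (Fin.castAdd m j)
  rw [par_castAdd, par_natAdd, add_zero] at this
  exact Submodule.subset_span this

theorem submatrix_mul_add {A : Type} [Ring A] {k l : ℕ}
    (M N : Matrix (Fin (n + m)) (Fin (n + m)) A) (f : Fin k → Fin (n + m))
    (g : Fin l → Fin (n + m)) : (M * N).submatrix f g =
      M.submatrix f (Fin.castAdd m) * N.submatrix (Fin.castAdd m) g +
        M.submatrix f (Fin.natAdd n) * N.submatrix (Fin.natAdd n) g := by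
  ext i j
  simp [Matrix.mul_apply, Fin.sum_univ_add]

theorem sdet_mul {M N : Matrix (Fin (n + m)) (Fin (n + m)) (Series p)}
    (hM : IsSupermatrix n m M) (hN : IsSupermatrix n m N)
    (cM : M.map (const p) = 1) (cN : N.map (const p) = 1) :
    sdet n m (M * N) = sdet n m M * sdet n m N := by
  unfold sdet
  simp only [submatrix_mul_add]
  exact sdetBlocks_mul (oddLaws p) (central_even hM) (matIn_upper hM) (matIn_lower hM)
    (central_odd hM) (isUnit_ncdet_of_const (const_natAdd cM)) (central_even hN) (matIn_upper hN)
    (matIn_lower hN) (central_odd hN) (isUnit_ncdet_of_const (const_natAdd cN))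

theorem map_sdet {A : Type} [Ring A] (f : Series p →+* A)
    {M : Matrix (Fin (n + m)) (Fin (n + m)) (Series p)} (hM : IsSupermatrix n m M)
    (cM : M.map (const p) = 1) : f (sdet n m M) = sdet n m (M.map f) := by
  have u := isUnit_ncdet_of_const (const_natAdd cM)
  have v := (isUnit_of_ncdet (central_odd hM) u).1
  have w := map_ringInverse (RingHom.mapMatrix f) v
  rw [RingHom.mapMatrix_apply, RingHom.mapMatrix_apply] at w
  unfold sdet sdetBlocks
  rw [map_mul, map_ringInverse f u, ncdet_map, ncdet_map]
  have e : (M.submatrix (Fin.castAdd m) (Fin.castAdd m) -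
      M.submatrix (Fin.castAdd m) (Fin.natAdd n) *
        Ring.inverse (M.submatrix (Fin.natAdd n) (Fin.natAdd n)) *
        M.submatrix (Fin.natAdd n) (Fin.castAdd m)).map f =
      (M.map f).submatrix (Fin.castAdd m) (Fin.castAdd m) -
      (M.map f).submatrix (Fin.castAdd m) (Fin.natAdd n) *
        Ring.inverse ((M.map f).submatrix (Fin.natAdd n) (Fin.natAdd n)) *
        (M.map f).submatrix (Fin.natAdd n) (Fin.castAdd m) := by
    rw [Matrix.map_sub f (map_sub f), Matrix.map_mul, Matrix.map_mul, w]
    rfl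
  rw [e]
  rfl

theorem sdet_sgn {A : Type} [Ring A] [Algebra ℂ A]
    (M : Matrix (Fin (n + m)) (Fin (n + m)) A) :
    sdet n m (fun i j => sgn (par n m i + par n m j) • M i j) = sdet n m M := by
  have s2 : sgn (1 + 1) = 1 := sgn_zero
  unfold sdet
  have e1 : (Matrix.submatrix (fun i j => sgn (par n m i + par n m j) • M i j)
      (Fin.castAdd m) (Fin.castAdd m)) = M.submatrix (Fin.castAdd m) (Fin.castAdd m) := by
    ext i j
    change sgn (par n m (Fin.castAdd m i) + par n m (Fin.castAdd m j)) • (M _ _) = _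
    rw [par_castAdd, par_castAdd, add_zero, sgn_zero, one_smul]; rfl
  have e2 : (Matrix.submatrix (fun i j => sgn (par n m i + par n m j) • M i j)
      (Fin.castAdd m) (Fin.natAdd n)) = -M.submatrix (Fin.castAdd m) (Fin.natAdd n) := by
    ext i j
    change sgn (par n m (Fin.castAdd m i) + par n m (Fin.natAdd n j)) • (M _ _) = _
    rw [par_castAdd, par_natAdd, zero_add, sgn_one, neg_smul, one_smul]; rfl
  have e3 : (Matrix.submatrix (fun i j => sgn (par n m i + par n m j) • M i j)
      (Fin.natAdd n) (Fin.castAdd m)) = -M.submatrix (Fin.natAdd n) (Fin.castAdd m) := by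
    ext i j
    change sgn (par n m (Fin.natAdd n i) + par n m (Fin.castAdd m j)) • (M _ _) = _
    rw [par_castAdd, par_natAdd, add_zero, sgn_one, neg_smul, one_smul]; rfl
  have e4 : (Matrix.submatrix (fun i j => sgn (par n m i + par n m j) • M i j)
      (Fin.natAdd n) (Fin.natAdd n)) = M.submatrix (Fin.natAdd n) (Fin.natAdd n) := by
    ext i j
    change sgn (par n m (Fin.natAdd n i) + par n m (Fin.natAdd n j)) • (M _ _) = _
    rw [par_natAdd, par_natAdd, s2, one_smul]; rfl
  rw [e1, e2, e3, e4]
  unfold sdetBlocks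
  rw [Matrix.neg_mul, Matrix.neg_mul, Matrix.mul_neg, neg_neg]

end SdetSeries

/-! ### The superalgebras of functions -/

/-- The parity of the generators `x_ij`; there is one family of them for each copy `c ∈ κ`. -/
def genPar (κ : Type) (n m : ℕ) (g : κ × Fin (n + m) × Fin (n + m)) : ZMod 2 :=
  par n m g.2.1 + par n m g.2.2

/-- Formal power series in generators `x_ij`, one family for each copy `c ∈ κ`. -/
abbrev PS (κ : Type) (n m : ℕ) : Type := Series (genPar κ n m)

/-- The supermatrix `y = 1 + x` of the copy `c`. -/
def ymat {κ : Type} (n m : ℕ) (c : κ) : Matrix (Fin (n + m)) (Fin (n + m)) (PS κ n m) :=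
  1 + Matrix.of fun i j => var (genPar κ n m) (c, i, j)

theorem one_isSupermatrix {X : Type} (p : X → ZMod 2) (n m : ℕ) :
    IsSupermatrix (A := Series p) n m 1 := fun i j => by
  rw [Matrix.one_apply]
  split_ifs with h
  · subst h
    have : par n m i + par n m i = 0 := CharTwo.add_self_eq_zero _
    rw [this]
    exact one_mem_homog p
  · exact Submodule.zero_mem _

theorem ymat_isSupermatrix {κ : Type} (n m : ℕ) (c : κ) : IsSupermatrix n m (ymat n m c) :=
  fun i j => Submodule.add_mem _ (one_isSupermatrix _ n m i j) (var_mem_homog _ (c, i, j))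

theorem const_one_map {X : Type} (p : X → ZMod 2) {k : ℕ} :
    (1 : Matrix (Fin k) (Fin k) (Series p)).map (const p) = 1 :=
  map_one (RingHom.mapMatrix (m := Fin k) (const p).toRingHom)

theorem const_ymat {κ : Type} (n m : ℕ) (c : κ) : (ymat n m c).map (const (genPar κ n m)) = 1 := by
  have h := map_add (RingHom.mapMatrix (m := Fin (n + m)) (const (genPar κ n m)).toRingHom) 1
    (Matrix.of fun i j => var (genPar κ n m) (c, i, j))
  rw [map_one] at h
  refine h.trans ?_
  rw [add_eq_left]
  ext i j
  exact const_var _ _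

theorem mul_isSupermatrix {X : Type} {p : X → ZMod 2} {n m : ℕ}
    {M N : Matrix (Fin (n + m)) (Fin (n + m)) (Series p)} (hM : IsSupermatrix n m M)
    (hN : IsSupermatrix n m N) : IsSupermatrix n m (M * N) := fun i j => by
  rw [Matrix.mul_apply]
  refine Submodule.sum_mem _ fun k _ => ?_
  have := mul_mem_homog p (hM i k) (hN k j)
  have e : par n m i + par n m k + (par n m k + par n m j) = par n m i + par n m j := by
    rw [add_assoc, ← add_assoc (par n m k), CharTwo.add_self_eq_zero, zero_add]
  rwa [e] at this

theorem const_mul {X : Type} {p : X → ZMod 2} {k : ℕ}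
    {M N : Matrix (Fin k) (Fin k) (Series p)} (hM : M.map (const p) = 1)
    (hN : N.map (const p) = 1) : (M * N).map (const p) = 1 := by
  refine (map_mul (RingHom.mapMatrix (m := Fin k) (const p).toRingHom) M N).trans ?_
  change M.map (const p) * N.map (const p) = 1
  rw [hM, hN, mul_one]

/-- The relation `sdet (1 + x) = 1`, for each copy. -/
inductive SLRel (κ : Type) (n m : ℕ) : PS κ n m → PS κ n m → Prop
  | sdet (c : κ) : SLRel κ n m (sdet n m (ymat n m c)) 1

/-- The completed tensor product of copies, indexed by `κ`, of the superalgebra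
`Hol(SL(n,m,ℂ)) = ℂ[[x_ij]] / (sdet (1 + x) - 1)`. It is `Hol(SL(n,m,ℂ))` itself when `κ` has one
element. -/
abbrev SLPow (κ : Type) (n m : ℕ) : Type := SQuot (SLRel κ n m)

/-- The quotient map from formal power series. -/
def slMk (κ : Type) (n m : ℕ) : PS κ n m →ₐ[ℂ] SLPow κ n m := SQuot.mk (SLRel κ n m)

/-- The generic supermatrix `1 + x` of the copy `c`. -/
def gmat {κ : Type} (n m : ℕ) (c : κ) : Matrix (Fin (n + m)) (Fin (n + m)) (SLPow κ n m) :=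
  (ymat n m c).map (slMk κ n m)

theorem slMk_sdet {κ : Type} (n m : ℕ) (c : κ) : slMk κ n m (sdet n m (ymat n m c)) = 1 :=
  (SQuot.mk_rel _ (SLRel.sdet c)).trans (map_one _)

/-- The counit, which is the constant term of a power series. -/
def counit (κ : Type) (n m : ℕ) : SLPow κ n m →ₐ[ℂ] ℂ :=
  SQuot.liftAlg (const (genPar κ n m)) (by
    rintro _ _ ⟨c⟩
    have := map_sdet (const (genPar κ n m)).toRingHom (ymat_isSupermatrix n m c)
      (const_ymat n m c)
    refine this.trans ?_
    change sdet n m ((ymat n m c).map (const (genPar κ n m))) = _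
    rw [const_ymat, map_one]
    have e : (1 : Matrix (Fin (n + m)) (Fin (n + m)) ℂ) = (1 : Matrix _ _ ℂ) * 1 := by simp
    have h1 : (1 : Matrix (Fin (n + m)) (Fin (n + m)) ℂ).submatrix (Fin.castAdd m)
        (Fin.natAdd n) = 0 := by
      ext i j
      have : (Fin.castAdd m i : Fin (n + m)) ≠ Fin.natAdd n j := by
        intro h
        have := congrArg Fin.val h
        simp at this
        omega
      simp [this]
    have h2 : (1 : Matrix (Fin (n + m)) (Fin (n + m)) ℂ).submatrix (Fin.castAdd m)
        (Fin.castAdd m) = 1 := Matrix.submatrix_one _ (Fin.castAdd_injective n m)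
    have h3 : (1 : Matrix (Fin (n + m)) (Fin (n + m)) ℂ).submatrix (Fin.natAdd n)
        (Fin.natAdd n) = 1 := Matrix.submatrix_one _ (Fin.natAdd_injective m n)
    unfold sdet sdetBlocks
    rw [h1, h2, h3, Matrix.zero_mul, Matrix.zero_mul, sub_zero, ncdet_comm, ncdet_comm,
      Matrix.det_one, Matrix.det_one, Ring.inverse_one, mul_one])

theorem counit_mk (κ : Type) (n m : ℕ) (a : PS κ n m) :
    counit κ n m (slMk κ n m a) = const (genPar κ n m) a := SQuot.liftAlg_mk _ _ a

/-- A substitution that respects the relations descends to the quotients. -/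
theorem slMk_map_sdet {κ κ' : Type} {n m : ℕ} (f : PS κ n m →+* PS κ' n m) (c : κ)
    {N : Matrix (Fin (n + m)) (Fin (n + m)) (PS κ' n m)} (hf : (ymat n m c).map f = N)
    (hN : slMk κ' n m (sdet n m N) = 1) : slMk κ' n m (f (sdet n m (ymat n m c))) = 1 := by
  rw [map_sdet f (ymat_isSupermatrix n m c) (const_ymat n m c), hf, hN]

theorem ymat_map {κ κ' : Type} {n m : ℕ} (f : PS κ n m →+* PS κ' n m) (c : κ)
    (s : Fin (n + m) → Fin (n + m) → PS κ' n m)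
    (h : ∀ i j, f (var (genPar κ n m) (c, i, j)) = s i j) :
    (ymat n m c).map f = 1 + Matrix.of s := by
  have e := map_add (RingHom.mapMatrix (m := Fin (n + m)) f) 1
    (Matrix.of fun i j => var (genPar κ n m) (c, i, j))
  rw [map_one] at e
  refine e.trans ?_
  congr 1
  ext1 i j
  exact h i j

/-- The substitution of the generators of the copy `g c` for those of the copy `c`. -/
def copySubst {κ κ' : Type} (n m : ℕ) (g : κ → κ') : PS κ n m →ₐ[ℂ] PS κ' n m :=
  subst (genPar κ n m) (genPar κ' n m) (fun t => var (genPar κ' n m) (g t.1, t.2))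
    (fun t => var_mem_homog (genPar κ' n m) (g t.1, t.2)) (fun _ => const_var _ _)

theorem copySubst_var {κ κ' : Type} (n m : ℕ) (g : κ → κ') (c : κ) (i j : Fin (n + m)) :
    copySubst n m g (var (genPar κ n m) (c, i, j)) = var (genPar κ' n m) (g c, i, j) :=
  subst_var _ _ _ _ _ _

/-- The morphism that sends the generators of the copy `c` to the generators of the copy `g c`. -/
def copyMap {κ κ' : Type} (n m : ℕ) (g : κ → κ') : SLPow κ n m →ₐ[ℂ] SLPow κ' n m :=
  SQuot.liftAlg ((slMk κ' n m).comp (copySubst n m g)) (by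
    rintro _ _ ⟨c⟩
    rw [map_one]
    exact slMk_map_sdet (copySubst n m g).toRingHom c
      (ymat_map _ c _ (copySubst_var n m g c)) (slMk_sdet n m (g c)))

/-- The product of the two copies `Sum.inl c` and `Sum.inr c` of the supermatrix `1 + x`. -/
def ymat₂ {κ : Type} (n m : ℕ) (c : κ) : Matrix (Fin (n + m)) (Fin (n + m)) (PS (κ ⊕ κ) n m) :=
  ymat n m (Sum.inl c) * ymat n m (Sum.inr c)

theorem const_ymat₂ {κ : Type} (n m : ℕ) (c : κ) :
    (ymat₂ n m c).map (const (genPar (κ ⊕ κ) n m)) = 1 :=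
  const_mul (const_ymat n m _) (const_ymat n m _)

theorem copyMap_mk {κ κ' : Type} (n m : ℕ) (g : κ → κ') (a : PS κ n m) :
    copyMap n m g (slMk κ n m a) = slMk κ' n m (copySubst n m g a) := SQuot.liftAlg_mk _ _ a

/-- The coproduct on formal power series: `1 + x` is sent to the product of the two copies of
`1 + x`. The two tensor factors are the copies `Sum.inl c` and `Sum.inr c`. -/
def coprodSubst (κ : Type) (n m : ℕ) : PS κ n m →ₐ[ℂ] PS (κ ⊕ κ) n m :=
  subst (genPar κ n m) (genPar (κ ⊕ κ) n m)
    (fun t => ymat₂ n m t.1 t.2.1 t.2.2 -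
      (1 : Matrix _ _ (PS (κ ⊕ κ) n m)) t.2.1 t.2.2)
    (fun t => Submodule.sub_mem _
      (mul_isSupermatrix (ymat_isSupermatrix n m _) (ymat_isSupermatrix n m _) t.2.1 t.2.2)
      (one_isSupermatrix _ n m t.2.1 t.2.2))
    (fun t => by
      have h1 := congrFun (congrFun (const_ymat₂ n m t.1) t.2.1) t.2.2
      have h2 := congrFun (congrFun (const_one_map (k := n + m) (genPar (κ ⊕ κ) n m)) t.2.1) t.2.2
      rw [Matrix.map_apply] at h1 h2
      rw [map_sub, h1, h2, sub_self])

theorem coprodSubst_ymat {κ : Type} (n m : ℕ) (c : κ) :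
    (ymat n m c).map (coprodSubst κ n m).toRingHom = ymat₂ n m c := by
  refine (ymat_map (coprodSubst κ n m).toRingHom c
    (fun i j => ymat₂ n m c i j - (1 : Matrix _ _ (PS (κ ⊕ κ) n m)) i j)
    fun i j => subst_var _ _ _ _ _ (c, i, j)).trans ?_
  ext1 i j
  exact add_sub_cancel _ _

/-- The coproduct, with values in the completed tensor square: `Sum.inl` marks the first tensor
factor and `Sum.inr` the second one. -/
def coprod (κ : Type) (n m : ℕ) : SLPow κ n m →ₐ[ℂ] SLPow (κ ⊕ κ) n m :=
  SQuot.liftAlg ((slMk (κ ⊕ κ) n m).comp (coprodSubst κ n m)) (by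
    rintro _ _ ⟨c⟩
    rw [map_one]
    refine slMk_map_sdet (coprodSubst κ n m).toRingHom c (coprodSubst_ymat n m c) ?_
    rw [ymat₂, sdet_mul (ymat_isSupermatrix n m _) (ymat_isSupermatrix n m _) (const_ymat n m _)
      (const_ymat n m _), map_mul, slMk_sdet, slMk_sdet, mul_one])

theorem coprod_mk (κ : Type) (n m : ℕ) (a : PS κ n m) :
    coprod κ n m (slMk κ n m a) = slMk (κ ⊕ κ) n m (coprodSubst κ n m a) :=
  SQuot.liftAlg_mk _ _ a

/-- The coproduct of a coordinate: `Δ(y_ij) = ∑ y_ik ⊗ y_kj`. -/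
theorem coprod_gmat {κ : Type} (n m : ℕ) (c : κ) (i j : Fin (n + m)) :
    coprod κ n m (gmat n m c i j) =
      ∑ k, gmat n m (Sum.inl c) i k * gmat n m (Sum.inr c) k j := by
  have h : coprodSubst κ n m (ymat n m c i j) = ymat₂ n m c i j :=
    congrFun (congrFun (coprodSubst_ymat n m c) i) j
  refine (coprod_mk κ n m (ymat n m c i j)).trans ?_
  rw [h, ymat₂, Matrix.mul_apply, map_sum]
  exact Finset.sum_congr rfl fun k _ => map_mul _ _ _

/-- `Fun(SL(n,m,ℂ))`, the superalgebra of functions on `SL(n,m,ℂ)` viewed as a real supergroup: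
the completed tensor product of the holomorphic copy `false`, with generators `x_ij`, and the
antiholomorphic copy `true`, with generators `x‡_ij`. -/
abbrev FunSL (n m : ℕ) : Type := SLPow Bool n m

/-- The conjugation of formal power series: antilinear, multiplicative, `x_ij ↦ x‡_ij` and
`x‡_ij ↦ (-1)^(|i|+|j|) x_ij`. -/
def conjSubst (n m : ℕ) : PS Bool n m →+* PS Bool n m :=
  substSemi (genPar Bool n m) (genPar Bool n m) (starRingEnd ℂ)
    (fun t => bif t.1 then sgn (par n m t.2.1 + par n m t.2.2) • var (genPar Bool n m) (false, t.2)
      else var (genPar Bool n m) (true, t.2))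
    (fun t => by
      obtain ⟨_ | _, i, j⟩ := t
      · exact var_mem_homog (genPar Bool n m) (true, i, j)
      · exact Submodule.smul_mem _ _ (var_mem_homog (genPar Bool n m) (false, i, j)))
    (fun t => by
      obtain ⟨_ | _, i, j⟩ := t
      · exact const_var _ _
      · change const _ (_ • var _ _) = 0
        rw [map_smul, const_var, smul_zero])

/-- The conjugation `‡` of `Fun(SL(n,m,ℂ))`: the antilinear ring morphism with `x_ij ↦ x‡_ij` and
`x‡_ij ↦ (-1)^(|i|+|j|) x_ij`. -/
def ddag (n m : ℕ) : FunSL n m →+* FunSL n m :=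
  SQuot.lift ((slMk Bool n m).toRingHom.comp (conjSubst n m)) (by
    rintro _ _ ⟨c⟩
    rw [map_one]
    cases c with
    | false =>
      exact slMk_map_sdet (conjSubst n m) false
        (ymat_map _ false _ fun i j => substSemi_var _ _ _ _ _ _ (false, i, j))
        (slMk_sdet n m true)
    | true =>
      refine slMk_map_sdet (conjSubst n m) true
        (ymat_map _ true _ fun i j => substSemi_var _ _ _ _ _ _ (true, i, j)) ?_
      rw [← slMk_sdet n m false, ← sdet_sgn (ymat n m false)]
      congr 2
      ext1 i j
      change (1 : Matrix _ _ (PS Bool n m)) i j + sgn (par n m i + par n m j) • var _ _ =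
        sgn (par n m i + par n m j) • ((1 : Matrix _ _ (PS Bool n m)) i j + var _ _)
      rw [smul_add]
      congr 1
      rw [Matrix.one_apply]
      split_ifs with h
      · subst h
        rw [CharTwo.add_self_eq_zero, sgn_zero, one_smul]
      · rw [smul_zero])

theorem ddag_mk (n m : ℕ) (a : PS Bool n m) :
    ddag n m (slMk Bool n m a) = slMk Bool n m (conjSubst n m a) := SQuot.lift_mk _ _ a

/-- The coordinate `x_ij` of the copy `c`: on `Fun(SL(n,m,ℂ))` it is `x_ij` for `c = false` and
`x‡_ij` for `c = true`. -/
def coord {κ : Type} (n m : ℕ) (c : κ) (i j : Fin (n + m)) : SLPow κ n m :=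
  slMk κ n m (var (genPar κ n m) (c, i, j))

theorem ddag_coord_false (n m : ℕ) (i j : Fin (n + m)) :
    ddag n m (coord n m false i j) = coord n m true i j := by
  rw [coord, ddag_mk, conjSubst, substSemi_var]
  rfl

theorem ddag_coord_true (n m : ℕ) (i j : Fin (n + m)) :
    ddag n m (coord n m true i j) = sgn (par n m i + par n m j) • coord n m false i j := by
  rw [coord, ddag_mk, conjSubst, substSemi_var]
  exact map_smul (slMk Bool n m) _ _

theorem ddag_algebraMap (n m : ℕ) (c : ℂ) :
    ddag n m (algebraMap ℂ _ c) = algebraMap ℂ _ (starRingEnd ℂ c) := by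
  rw [← AlgHom.commutes (slMk Bool n m), ddag_mk, Algebra.algebraMap_eq_smul_one, conjSubst,
    substSemi_smul, map_smul (slMk Bool n m), map_one, map_one, Algebra.algebraMap_eq_smul_one]

/-- The antipode on the holomorphic coordinates: `S(x_ij) = -δ_ij + ((1 + x)⁻¹)_ij`. -/
def antipodeCoord (n m : ℕ) (i j : Fin (n + m)) : FunSL n m :=
  -(if i = j then 1 else 0) + Ring.inverse (gmat n m false) i j

/-- The relations `σ(x_ij) = x‡_ij`, where `σ(x_ij) = (-1)^((|i|+|j|)|j|) S(x_ji)`. -/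
inductive SURel (n m : ℕ) : FunSL n m → FunSL n m → Prop
  | mk (i j : Fin (n + m)) : SURel n m
      (sgn ((par n m i + par n m j) * par n m j) • antipodeCoord n m j i) (coord n m true i j)

/-- `Fun(SU(n,m))`, the functions on the compact graded real form. -/
abbrev FunSU (n m : ℕ) : Type := SQuot (SURel n m)

/-- The relations `x_ij = x‡_ij = 0` for `i > j` and `x_ii = x‡_ii`. -/
inductive SANRel (n m : ℕ) : FunSL n m → FunSL n m → Prop
  | lower (c : Bool) (i j : Fin (n + m)) (h : j < i) : SANRel n m (coord n m c i j) 0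
  | diag (i : Fin (n + m)) : SANRel n m (coord n m false i i) (coord n m true i i)

/-- `Fun(s(AN))`. -/
abbrev FunSAN (n m : ℕ) : Type := SQuot (SANRel n m)

/-- The canonical projection `i`. -/
def projSU (n m : ℕ) : FunSL n m →ₐ[ℂ] FunSU n m := SQuot.mk (SURel n m)

/-- The canonical projection `j`. -/
def projSAN (n m : ℕ) : FunSL n m →ₐ[ℂ] FunSAN n m := SQuot.mk (SANRel n m)

/-- `φ(i(f₍₁₎)) · ψ(j(f₍₂₎)) = f` for all `f`, for a pair of superalgebra morphisms. Here `μ` is the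
morphism `f ⊗ g ↦ φ(i(f)) · ψ(j(g))` on the completed tensor square, in which `f ⊗ g` is the
product of the image of `f` in the first factor and the image of `g` in the second. -/
def IsIwasawaPair (n m : ℕ) (φ : FunSU n m →ₐ[ℂ] FunSL n m)
    (ψ : FunSAN n m →ₐ[ℂ] FunSL n m) : Prop :=
  IsSuperHom φ ∧ IsSuperHom ψ ∧
    ∃ μ : SLPow (Bool ⊕ Bool) n m →ₐ[ℂ] FunSL n m, IsSuperHom μ ∧
      (∀ f g : FunSL n m, μ (copyMap n m Sum.inl f * copyMap n m Sum.inr g) =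
        φ (projSU n m f) * ψ (projSAN n m g)) ∧
      ∀ f : FunSL n m, μ (coprod Bool n m f) = f

/-- The supertranspose: blocks `A, B, C, D` become `Aᵗ, Cᵗ, -Bᵗ, Dᵗ`. -/
def supertranspose {A : Type} [Ring A] [Algebra ℂ A] (n m : ℕ)
    (M : Matrix (Fin (n + m)) (Fin (n + m)) A) : Matrix (Fin (n + m)) (Fin (n + m)) A :=
  fun i j => sgn (par n m i * (par n m i + par n m j)) • M j i

/-- An `SU(n,m)`-supermatrix over `Fun(SL(n,m,ℂ))`. -/
structure IsSUMatrix (n m : ℕ) (P : Matrix (Fin (n + m)) (Fin (n + m)) (FunSL n m)) : Prop where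
  isSupermatrix : IsSupermatrix n m P
  sdet_eq_one : sdet n m P = 1
  normalized : ∀ i, counit Bool n m (P i i) = 1
  unitary : supertranspose n m (P.map (ddag n m)) * P = 1

/-- An `s(AN)`-supermatrix over `Fun(SL(n,m,ℂ))`. -/
structure IsSANMatrix (n m : ℕ) (Q : Matrix (Fin (n + m)) (Fin (n + m)) (FunSL n m)) : Prop where
  isSupermatrix : IsSupermatrix n m Q
  sdet_eq_one : sdet n m Q = 1
  normalized : ∀ i, counit Bool n m (Q i i) = 1
  real : ∀ i, ddag n m (Q i i) = Q i i
  upper : ∀ i j, j < i → Q i j = 0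

/-- A factorization of the generic supermatrix into an `SU(n,m)`-supermatrix and an
`s(AN)`-supermatrix. -/
def IsIwasawaFactorization (n m : ℕ) (P Q : Matrix (Fin (n + m)) (Fin (n + m)) (FunSL n m)) :
    Prop :=
  IsSUMatrix n m P ∧ IsSANMatrix n m Q ∧ gmat n m false = P * Q

end

end SuperIwasawa

/-! Write M^* for the superadjoint (M^‡)^st. On supermatrices it is an antimultiplicative
involution, so y = ΦΨ with Φ^*Φ = 1 forces y^*y = Ψ^*Ψ. Hence Ψ is a Cholesky factor of y^*y, and Φ
= yΨ⁻¹. The theorem rests on existence and uniqueness of this Cholesky factor (`exists_triangular`,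
`triangular_unique`).

The algebra Fun(SL) is local with residue map the counit (`isUnit_of_counit`), and y^*y reduces to
1. Gauss elimination therefore gives y^*y = LV with L lower unipotent and V upper triangular
(`exists_lower_mul_upper`). Even elements with constant term 1 have unique even square roots with
constant term 1 (`exists_sqrt`, `eq_of_mul_self_eq_of_even`), so the diagonal of V can be shared
equally between the two factors. A factorization with equal diagonals of this kind is unique
(`symmetric_triangular_unique`). Its adjoint is another one, because y^*y is self-adjoint; so the
lower factor is Ψ^* and the diagonal of Ψ is real. Finally (sdet Ψ)² = 1, and the constant term
gives sdet Ψ = 1.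

For a pair of morphisms put F = φ∘i and G = ψ∘j. On coordinates the pair condition says F(y)G(y) = y
and F(y‡)G(y‡) = y‡, and the SU relations say F(y‡)^st F(y) = 1. Eliminating F leaves G(y‡)^st G(y)
= y^*y, where G(y) and G(y‡) are upper triangular with the same diagonal. Uniqueness of the Cholesky
factor applies even though G(y‡) = G(y)^‡ is not assumed, and it proves that equality
(`IsIwasawaPair.map_gmat`). Conversely, the two matrices define the morphisms (`exists_superHom`,
`exists_iwasawaPair`).

The passage between morphisms and matrices needs that a morphism is determined by the coordinates,
with no continuity assumed (`slPow_algHom_ext`). Morphisms preserve constant terms, so they are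
automatically continuous, and the quotient is separated because finitely generated right ideals of
power series in finitely many variables are closed (`exists_eq_sum_of_forall_trunc`).

Parities are handled without computation: ‡‡ is the parity automorphism (`mem_homog_iff_ddag`), so
supermatrices are the fixed points of a multiplicative map, and factors inherit the property from
uniqueness. -/

namespace SuperIwasawa

/-! ### Truncations of power series; closedness of finitely generated ideals -/

section Truncation

variable {X : Type} (p : X → ZMod 2)

theorem res_mk (k : ℕ) (β : FreeAlgebra ℂ X) :
    res p k (SQuot.mk (TruncRel p (k + 1)) β) = SQuot.mk (TruncRel p k) β := by
  have : (res p k).comp (SQuot.mk (TruncRel p (k + 1))) = SQuot.mk (TruncRel p k) := by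
    apply FreeAlgebra.hom_ext
    ext x
    exact res_tgen p k x
  exact DFunLike.congr_fun this β

theorem trunc_eq_mk_of_le {a : Series p} {β : FreeAlgebra ℂ X} {j k : ℕ} (hk : k ≤ j)
    (h : trunc p j a = SQuot.mk (TruncRel p j) β) : trunc p k a = SQuot.mk (TruncRel p k) β := by
  induction j, hk using Nat.le_induction with
  | base => exact h
  | succ j _ ih => exact ih (by rw [← res_trunc, h, res_mk])

theorem trunc_eq_zero_of_le {a : Series p} {j k : ℕ} (hk : k ≤ j) (h : trunc p j a = 0) :
    trunc p k a = 0 := by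
  simpa using trunc_eq_mk_of_le p hk (β := 0) (by simpa using h)

/-- The ideal of the truncated polynomials without monomials of degree less than `j`. -/
def filtIdeal (k j : ℕ) : Ideal (Trunc p k) :=
  { filt p k j with
    smul_mem' := fun a b hb => by
      have ha : a ∈ Submodule.span ℂ (Set.range (word p k)) := by rw [span_word]; trivial
      have : a ∈ filt p k 0 :=
        Submodule.span_mono (by rintro _ ⟨w, rfl⟩; exact ⟨w, by simp, rfl⟩) ha
      have h : a * b ∈ filt p k (0 + j) := mul_mem_filt p k this hb
      rwa [zero_add] at h }

instance (k j : ℕ) : (filtIdeal p k j).IsTwoSided where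
  mul_mem_of_left {b} a hb := by
    have ha : a ∈ Submodule.span ℂ (Set.range (word p k)) := by rw [span_word]; trivial
    have : a ∈ filt p k 0 :=
      Submodule.span_mono (by rintro _ ⟨w, rfl⟩; exact ⟨w, by simp, rfl⟩) ha
    have h : b * a ∈ filt p k (j + 0) := mul_mem_filt p k hb this
    rwa [add_zero] at h

/-- A truncated polynomial is determined by its further truncation, up to monomials of high
degree. -/
theorem mk_mem_filt {k j : ℕ} {β : FreeAlgebra ℂ X} (h : SQuot.mk (TruncRel p k) β = 0) :
    SQuot.mk (TruncRel p j) β ∈ filt p j k := by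
  -- Modulo monomials of degree at least `k`, the relations of the truncation at `k` hold in the
  -- truncation at `j`. So whatever vanishes in the former vanishes in this quotient.
  let θ : Trunc p k →+* Trunc p j ⧸ filtIdeal p j k :=
    SQuot.lift ((Ideal.Quotient.mk (filtIdeal p j k)).comp
      (SQuot.mk (TruncRel p j)).toRingHom) (by
      rintro _ _ (⟨x, y⟩ | ⟨w, hw⟩)
      · exact congrArg (Ideal.Quotient.mk (filtIdeal p j k))
          (SQuot.mk_rel _ (TruncRel.comm (p := p) (k := j) x y))
      · rw [map_zero]
        refine Ideal.Quotient.eq_zero_iff_mem.2 ?_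
        change SQuot.mk (TruncRel p j) (w.map (FreeAlgebra.ι ℂ)).prod ∈ filt p j k
        rw [mk_word]
        exact Submodule.subset_span ⟨w, hw.ge, rfl⟩)
  have h2 : θ (SQuot.mk (TruncRel p k) β) =
      Ideal.Quotient.mk (filtIdeal p j k) (SQuot.mk (TruncRel p j) β) := SQuot.lift_mk _ _ β
  rw [h, map_zero] at h2
  exact Ideal.Quotient.eq_zero_iff_mem.1 h2.symm

theorem trunc_mem_filt {a : Series p} {k : ℕ} (h : trunc p k a = 0) (j : ℕ) :
    trunc p j a ∈ filt p j k := by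
  rcases le_total j k with hj | hj
  · rw [trunc_eq_zero_of_le p hj h]
    exact Submodule.zero_mem _
  · obtain ⟨β, hβ⟩ := SQuot.mk_surjective (TruncRel p j) (trunc p j a)
    rw [← hβ]
    exact mk_mem_filt p (by rw [← trunc_eq_mk_of_le p hj hβ.symm, h])

/-- The power series given by a noncommutative polynomial. -/
def poly : FreeAlgebra ℂ X →ₐ[ℂ] Series p := FreeAlgebra.lift ℂ (var p)

theorem trunc_poly (k : ℕ) (β : FreeAlgebra ℂ X) :
    trunc p k (poly p β) = SQuot.mk (TruncRel p k) β := by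
  have : (trunc p k).comp (poly p) = SQuot.mk (TruncRel p k) := by
    apply FreeAlgebra.hom_ext
    ext x
    simp [poly, var, trunc_mkSeries, tgen]
  exact DFunLike.congr_fun this β

/-- Density of polynomials, used to compare morphisms that agree on the variables. -/
theorem exists_poly (a : Series p) (k : ℕ) : ∃ β, trunc p k (a - poly p β) = 0 := by
  obtain ⟨β, hβ⟩ := SQuot.mk_surjective (TruncRel p k) (trunc p k a)
  exact ⟨β, by rw [map_sub, trunc_poly, hβ, sub_self]⟩

theorem trunc_surjective (k : ℕ) : Function.Surjective (trunc p k) := fun a => by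
  obtain ⟨β, rfl⟩ := SQuot.mk_surjective (TruncRel p k) a
  exact ⟨poly p β, trunc_poly p k β⟩

theorem trunc_word_prod (k : ℕ) (w : List X) : trunc p k (w.map (var p)).prod = word p k w := by
  rw [map_list_prod, List.map_map]
  rfl

theorem trunc_prod_eq_zero {l : List (Series p)} (h : ∀ a ∈ l, const p a = 0) :
    trunc p l.length l.prod = 0 := by
  apply filt_eq_zero
  rw [map_list_prod]
  have := list_prod_mem_filt p l.length (l.map (trunc p l.length)) (by
    intro a ha
    obtain ⟨b, hb, rfl⟩ := List.mem_map.1 ha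
    exact mem_filt_of_const p (h b hb) _)
  rwa [List.length_map] at this

variable [Finite X]

/-- Words of length at least `k` vanish, and a finite alphabet has finitely many shorter ones.
Finite dimension is what makes the Mittag-Leffler argument below work. -/
instance (k : ℕ) : Module.Finite ℂ (Trunc p k) := by
  refine Module.finite_def.2 (Submodule.fg_def.2
    ⟨word p k '' {w | w.length < k}, (List.finite_length_lt X k).image _, ?_⟩)
  rw [eq_top_iff, ← span_word, Submodule.span_le]
  rintro _ ⟨w, rfl⟩
  rcases lt_or_ge w.length k with h | h
  · exact Submodule.subset_span ⟨w, h, rfl⟩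
  · rw [word_eq_zero p k w h]
    exact Submodule.zero_mem _

/-- A finitely generated right ideal of power series is closed. -/
theorem exists_eq_sum_of_forall_trunc {ι : Type} [Fintype ι] (g : ι → Series p) (a : Series p)
    (h : ∀ k, ∃ b : ι → Series p, trunc p k (∑ i, g i * b i) = trunc p k a) :
    ∃ b : ι → Series p, ∑ i, g i * b i = a := by
  -- Solutions of `∑ g i * b i = c • a` modulo degree `k`. The extra scalar `c` turns the affine
  -- solution set into a linear space; the actual solutions are those with `c = 1`.
  let S : ℕ → Submodule ℂ ((ι → Series p) × ℂ) := fun k =>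
    { carrier := {s | trunc p k (∑ i, g i * s.1 i) = s.2 • trunc p k a}
      add_mem' := fun {s t} hs ht => by
        have hs' : trunc p k (∑ i, g i * s.1 i) = s.2 • trunc p k a := hs
        have ht' : trunc p k (∑ i, g i * t.1 i) = t.2 • trunc p k a := ht
        simp only [Set.mem_ofPred_eq, Prod.fst_add, Prod.snd_add, Pi.add_apply, mul_add,
          Finset.sum_add_distrib, map_add, add_smul, hs', ht']
      zero_mem' := by simp
      smul_mem' := fun c s hs => by
        have hs' : trunc p k (∑ i, g i * s.1 i) = s.2 • trunc p k a := hs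
        simp only [Set.mem_ofPred_eq, Prod.smul_fst, Prod.smul_snd, Pi.smul_apply, mul_smul_comm,
          ← Finset.smul_sum, map_smul, hs', smul_eq_mul, mul_smul] }
  have hS : Antitone S := fun k l hkl s hs => by
    have h1 : trunc p l (∑ i, g i * s.1 i - s.2 • a) = 0 := by
      rw [map_sub, map_smul, sub_eq_zero]; exact hs
    have h2 := trunc_eq_zero_of_le p hkl h1
    rw [map_sub, map_smul, sub_eq_zero] at h2
    exact h2
  let π : ∀ j, ((ι → Series p) × ℂ) →ₗ[ℂ] ((ι → Trunc p j) × ℂ) := fun j =>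
    ((trunc p j).toLinearMap.compLeft ι).prodMap LinearMap.id
  -- For fixed `j` the images of the decreasing `S k` lie in a finite-dimensional space, hence
  -- become constant.
  have stab : ∀ j, ∃ N, ∀ m, N ≤ m → (S N).map (π j) = (S m).map (π j) := fun j =>
    IsArtinian.monotone_stabilizes
      ⟨fun k => OrderDual.toDual ((S k).map (π j)), fun k l hkl => Submodule.map_mono (hS hkl)⟩
  choose N hN using stab
  let V : ℕ → Type := fun j => {v : (ι → Trunc p j) × ℂ // v ∈ (S (N j)).map (π j) ∧ v.2 = 1}
  -- An element of the stable image at `j` comes from a solution that is also precise enough for the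
  -- stable image at `j + 1`; truncating that solution one degree later gives the lift. Iterating
  -- builds a compatible sequence.
  have step : ∀ j (v : V j), ∃ v' : V (j + 1), ∀ i, res p j (v'.1.1 i) = v.1.1 i := by
    rintro j ⟨v, hv, hv1⟩
    rw [hN j (max (N j) (N (j + 1))) (le_max_left _ _)] at hv
    obtain ⟨s, hs, rfl⟩ := hv
    exact ⟨⟨π (j + 1) s, ⟨s, hS (le_max_right _ _) hs, rfl⟩, hv1⟩,
      fun i => res_trunc p (s.1 i) j⟩
  obtain ⟨b₀, hb₀⟩ := h (N 0)
  choose f hf using step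
  let u : ∀ j, V j := fun j => Nat.rec
    ⟨π 0 (b₀, 1), ⟨(b₀, 1), by simpa [S] using hb₀, rfl⟩, rfl⟩ (fun j v => f j v) j
  refine ⟨fun i => mkSeries p (fun j => (u j).1.1 i) fun j => hf j (u j) i, ?_⟩
  apply series_ext
  intro k
  -- Stability allows the precision to be raised to at least `k`, so the `k`-th term of the sequence
  -- is the truncation of a solution modulo degree `k`.
  have hk : (u k).1 ∈ (S (max (N k) k)).map (π k) :=
    hN k (max (N k) k) (le_max_left _ _) ▸ (u k).2.1
  obtain ⟨s, hs, hsu⟩ := hk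
  have hs' : trunc p k (∑ i, g i * s.1 i) = s.2 • trunc p k a := hS (le_max_right _ _) hs
  have h1 : s.2 = 1 := (congrArg Prod.snd hsu).trans (u k).2.2
  rw [h1, one_smul, map_sum] at hs'
  rw [← hs', map_sum]
  refine Finset.sum_congr rfl fun i _ => ?_
  rw [map_mul, map_mul, trunc_mkSeries]
  congr 1
  exact (congrFun (congrArg Prod.fst hsu) i).symm

end Truncation

/-- A power series without monomials of degree less than `k` is a finite sum of multiples of the
monomials of degree `k`. -/
theorem exists_eq_sum_word {X : Type} (p : X → ZMod 2) [Fintype X] {a : Series p} {k : ℕ} (h : trunc p k a = 0) :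
    ∃ b : List.Vector X k → Series p, ∑ w, (w.1.map (var p)).prod * b w = a := by
  classical
  -- By closedness it suffices to solve in every truncation. There the element is a finite
  -- combination of words of length at least `k`, and each word splits after its first `k` letters.
  refine exists_eq_sum_of_forall_trunc p _ a fun j => ?_
  have ha := trunc_mem_filt p h j
  generalize trunc p j a = c at ha
  induction ha using Submodule.span_induction with
  | zero => exact ⟨0, by simp⟩
  | add x y _ _ hx hy =>
    obtain ⟨b, hb⟩ := hx
    obtain ⟨b', hb'⟩ := hy
    exact ⟨b + b', by simp only [Pi.add_apply, mul_add, Finset.sum_add_distrib, map_add, hb, hb']⟩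
  | smul c x _ hx =>
    obtain ⟨b, hb⟩ := hx
    exact ⟨c • b, by simp only [Pi.smul_apply, mul_smul_comm, ← Finset.smul_sum, map_smul, hb]⟩
  | mem x hx =>
    obtain ⟨w, hw, rfl⟩ := hx
    let v : List.Vector X k := ⟨w.take k, by simpa using hw⟩
    refine ⟨Pi.single v ((w.drop k).map (var p)).prod, ?_⟩
    rw [Finset.sum_eq_single v (fun u _ hu => by rw [Pi.single_eq_of_ne hu, mul_zero]) (by simp),
      Pi.single_eq_same, ← List.prod_append, ← List.map_append]
    change trunc p j (((w.take k ++ w.drop k).map (var p)).prod) = _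
    rw [List.take_append_drop, trunc_word_prod]

/-! ### Signs, constant terms and semilinear substitution -/

section Conjugation

theorem sgn_ne_zero (a : ZMod 2) : sgn a ≠ 0 := fun h => by
  simpa [h] using sgn_mul_self a

theorem conj_sgn (a : ZMod 2) : starRingEnd ℂ (sgn a) = sgn a := by simp [sgn]

variable {X Y : Type} (p : X → ZMod 2) (p' : Y → ZMod 2) (τ : ℂ →+* ℂ) (s : X → Series p')
    (hs : ∀ x, s x ∈ homog (A := Series p') (p x)) (h0 : ∀ x, const p' (s x) = 0)

theorem trunc_one_eq_zero_iff (a : Series p) : trunc p 1 a = 0 ↔ const p a = 0 :=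
  ⟨fun h => by rw [const, AlgHom.comp_apply, h, map_zero],
    fun h => filt_eq_zero p 1 (mem_filt_of_const p h 1)⟩

theorem const_substSemi (a : Series p) :
    const p' (substSemi p p' τ s hs h0 a) = τ (const p a) := by
  have h : const p (a - const p a • 1) = 0 := by simp
  have h1 : const p' (substSemi p p' τ s hs h0 (a - const p a • 1)) = 0 := by
    rw [← trunc_one_eq_zero_iff] at h ⊢
    rw [trunc_substSemi, h, map_zero]
  rw [map_sub, substSemi_smul, map_one, map_sub, map_smul, map_one, sub_eq_zero] at h1
  simpa using h1

end Conjugation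

/-! ### The local superalgebras `SLPow κ n m` and their morphisms -/

section SLPow

variable {κ κ' : Type} {n m : ℕ}

theorem slMk_surjective : Function.Surjective (slMk κ n m) := SQuot.mk_surjective _

theorem mem_homog_slPow {q : ZMod 2} {a : SLPow κ n m} :
    a ∈ homog (A := SLPow κ n m) q ↔
      ∃ b ∈ homog (A := PS κ n m) q, slMk κ n m b = a := Iff.rfl

/-- A lift to power series is a nonzero scalar times a series with constant term `1`, which is
invertible. Thus the quotient is local, with the counit as residue map. -/
theorem isUnit_of_counit {a : SLPow κ n m} (h : counit κ n m a ≠ 0) : IsUnit a := by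
  obtain ⟨b, rfl⟩ := slMk_surjective a
  rw [counit_mk] at h
  have h1 : IsUnit ((const (genPar κ n m) b)⁻¹ • b) :=
    isUnit_of_const _ (by rw [map_smul, smul_eq_mul, inv_mul_cancel₀ h])
  have h2 := (h1.map (slMk κ n m))
  have h3 : IsUnit (algebraMap ℂ (SLPow κ n m) (const (genPar κ n m) b)) :=
    (IsUnit.mk0 _ h).map _
  have h4 := h3.mul h2
  rwa [map_smul, ← Algebra.smul_def, smul_smul, mul_inv_cancel₀ h, one_smul] at h4

theorem counit_ne_zero_of_isUnit {a : SLPow κ n m} (h : IsUnit a) : counit κ n m a ≠ 0 :=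
  (h.map (counit κ n m)).ne_zero

theorem counit_gmat (c : κ) : (gmat n m c).map (counit κ n m) = 1 := by
  rw [← const_ymat n m c]
  ext i j
  exact counit_mk κ n m _

/-- Morphisms of the local algebras `SLPow κ n m` are local. -/
theorem counit_algHom (f : SLPow κ n m →ₐ[ℂ] SLPow κ' n m) (a : SLPow κ n m) :
    counit κ' n m (f a) = counit κ n m a := by
  by_contra hne
  -- If the constant terms differed, subtracting that of `f a` from `a` would leave a unit, whose
  -- image under `f` has constant term `0` and so is not a unit.
  have h1 : IsUnit (a - algebraMap ℂ _ (counit κ' n m (f a))) := isUnit_of_counit (by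
    rw [map_sub, AlgHom.commutes]
    exact sub_ne_zero.2 (Ne.symm hne))
  apply counit_ne_zero_of_isUnit (h1.map f)
  rw [map_sub, map_sub, AlgHom.commutes, AlgHom.commutes]
  exact sub_self _

/-- Both determinants in the superdeterminant involve only even elements or products of two odd
ones. Centrality makes the one-sided ideal of the relations two-sided. -/
theorem sdet_ymat_central (c : κ) :
    sdet n m (ymat n m c) ∈ Subring.center (PS κ n m) := by
  have hs := ymat_isSupermatrix n m c
  have u := isUnit_ncdet_of_const (const_natAdd (const_ymat n m c))
  obtain ⟨-, hD⟩ := isUnit_of_ncdet (central_odd hs) u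
  exact mul_mem (ncdet_central ((central_even hs).sub
    (((matIn_upper hs).mul_central hD).mul (oddLaws _) (matIn_lower hs))))
    (inverse_central (ncdet_central (central_odd hs)) u)

theorem exists_eq_sum_of_slMk_eq_zero [Fintype κ] {a : PS κ n m} (h : slMk κ n m a = 0) :
    ∃ b : κ → PS κ n m, ∑ c, (sdet n m (ymat n m c) - 1) * b c = a := by
  have cen : ∀ c (x : PS κ n m), (sdet n m (ymat n m c) - 1) * x =
      x * (sdet n m (ymat n m c) - 1) :=
    fun c => center_mul_comm (sub_mem (sdet_ymat_central c) (one_mem _))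
  -- A left ideal, two-sided since its generators are central. The quotient by it satisfies the
  -- defining relations, so the kernel of `slMk` is contained in `J`.
  let J : Ideal (PS κ n m) := Ideal.span (Set.range fun c => sdet n m (ymat n m c) - 1)
  have : J.IsTwoSided := ⟨fun {x} y hx => by
    induction hx using Submodule.span_induction with
    | zero => rw [zero_mul]; exact J.zero_mem
    | add x x' _ _ h h' => rw [add_mul]; exact J.add_mem h h'
    | smul c x _ h => rw [smul_eq_mul, mul_assoc]; exact J.mul_mem_left _ h
    | mem x hx =>
      obtain ⟨c, rfl⟩ := hx
      change (sdet n m (ymat n m c) - 1) * y ∈ J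
      rw [cen]
      exact J.mul_mem_left _ (Ideal.subset_span ⟨c, rfl⟩)⟩
  let θ : SLPow κ n m →+* PS κ n m ⧸ J := SQuot.lift (Ideal.Quotient.mk J) (by
    rintro _ _ ⟨c⟩
    exact Ideal.Quotient.eq.2 (Ideal.subset_span ⟨c, rfl⟩))
  have h2 : θ (slMk κ n m a) = Ideal.Quotient.mk J a := SQuot.lift_mk _ _ a
  rw [h, map_zero] at h2
  obtain ⟨b, hb⟩ := Ideal.mem_span_range_iff_exists_fun.1 (Ideal.Quotient.eq_zero_iff_mem.1 h2.symm)
  exact ⟨b, by simp only [cen]; exact hb⟩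

/-- The quotient `SLPow κ n m` is separated. -/
theorem slMk_eq_zero_of_forall [Fintype κ] {a : PS κ n m}
    (h : ∀ k, ∃ b, trunc (genPar κ n m) k b = 0 ∧ slMk κ n m b = slMk κ n m a) :
    slMk κ n m a = 0 := by
  -- In every truncation `a` agrees with `a - b`, which lies in the ideal of the relations; this
  -- ideal is finitely generated, hence closed, and contains `a` itself.
  have h1 := exists_eq_sum_of_forall_trunc (genPar κ n m)
    (fun c => sdet n m (ymat n m c) - 1) a (fun k => by
      obtain ⟨b, hb, hba⟩ := h k
      obtain ⟨d, hd⟩ := exists_eq_sum_of_slMk_eq_zero (a := a - b) (by rw [map_sub, hba, sub_self])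
      exact ⟨d, by rw [hd, map_sub, hb, sub_zero]⟩)
  obtain ⟨b, rfl⟩ := h1
  rw [map_sum]
  refine Finset.sum_eq_zero fun c _ => ?_
  rw [map_mul, map_sub, slMk_sdet, map_one, sub_self, zero_mul]

/-- A morphism is determined by the images of the coordinates. -/
theorem slPow_algHom_ext [Fintype κ] [Fintype κ'] {f g : SLPow κ n m →ₐ[ℂ] SLPow κ' n m}
    (h : ∀ c i j, f (gmat n m c i j) = g (gmat n m c i j)) : f = g := by
  have hv : ∀ x, f (slMk κ n m (var _ x)) = g (slMk κ n m (var _ x)) := by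
    rintro ⟨c, i, j⟩
    have e : slMk κ n m (var (genPar κ n m) (c, i, j)) =
        gmat n m c i j - slMk κ n m ((1 : Matrix _ _ (PS κ n m)) i j) := by
      rw [gmat, Matrix.map_apply, ← map_sub]
      congr 1
      exact (add_sub_cancel_left _ _).symm
    rw [e, map_sub, map_sub, h, Matrix.one_apply]
    split_ifs <;> simp
  have hp : ∀ β, f (slMk κ n m (poly _ β)) = g (slMk κ n m (poly _ β)) := by
    have : (f.comp (slMk κ n m)).comp (poly _) = (g.comp (slMk κ n m)).comp (poly _) := by
      apply FreeAlgebra.hom_ext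
      ext x
      simpa [poly] using hv x
    exact DFunLike.congr_fun this
  -- Automatic continuity. A series of order at least `k` is a finite sum of multiples of monomials
  -- of degree `k`, and by `counit_algHom` each variable goes to an element that lifts to a series
  -- without constant term; a product of `k` such lifts has order at least `k`.
  have small : ∀ (f : SLPow κ n m →ₐ[ℂ] SLPow κ' n m) k (a : PS κ n m),
      trunc (genPar κ n m) k a = 0 →
      ∃ b, trunc (genPar κ' n m) k b = 0 ∧ slMk κ' n m b = f (slMk κ n m a) := by
    intro f k a ha
    obtain ⟨d, rfl⟩ := exists_eq_sum_word _ ha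
    choose s hs using fun x => slMk_surjective (f (slMk κ n m (var (genPar κ n m) x)))
    choose e he using fun w => slMk_surjective (f (slMk κ n m (d w)))
    refine ⟨∑ w, (w.1.map s).prod * e w, ?_, ?_⟩
    · rw [map_sum]
      refine Finset.sum_eq_zero fun w _ => ?_
      have h1 := trunc_prod_eq_zero (genPar κ' n m) (l := w.1.map s) (by
        intro a ha
        obtain ⟨x, -, rfl⟩ := List.mem_map.1 ha
        rw [← counit_mk, hs, counit_algHom, counit_mk, const_var])
      rw [List.length_map, w.2] at h1
      rw [map_mul, h1, zero_mul]
    · simp only [map_sum, map_mul, map_list_prod, List.map_map, he]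
      refine Finset.sum_congr rfl fun w _ => ?_
      congr 3
      funext x
      exact hs x
  refine AlgHom.ext fun a => ?_
  obtain ⟨a, rfl⟩ := slMk_surjective a
  obtain ⟨b, hb⟩ := slMk_surjective (f (slMk κ n m a) - g (slMk κ n m a))
  rw [← sub_eq_zero, ← hb]
  refine slMk_eq_zero_of_forall fun k => ?_
  -- Since `f` and `g` agree on the polynomial part, their difference at `a` is that at a remainder
  -- of order at least `k`, for every `k`.
  obtain ⟨β, hβ⟩ := exists_poly _ a k
  obtain ⟨u, hu, hu'⟩ := small f k _ hβ
  obtain ⟨v, hv, hv'⟩ := small g k _ hβ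
  refine ⟨u - v, by rw [map_sub, hu, hv, sub_zero], ?_⟩
  rw [map_sub, hu', hv', hb, map_sub, map_sub, map_sub, hp, sub_sub_sub_cancel_right]

theorem slPow_comm {q r : ZMod 2} {a b : SLPow κ n m}
    (ha : a ∈ homog (A := SLPow κ n m) q) (hb : b ∈ homog (A := SLPow κ n m) r) :
    a * b = sgn (q * r) • (b * a) := by
  obtain ⟨a, ha', rfl⟩ := mem_homog_slPow.1 ha
  obtain ⟨b, hb', rfl⟩ := mem_homog_slPow.1 hb
  rw [← map_mul, ← map_mul, ← map_smul]
  congr 1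
  apply series_ext
  intro k
  rw [map_mul, map_smul, map_mul]
  exact thomog_comm _ k (ha' k) (hb' k)

theorem slPow_even_comm {a : SLPow κ n m} (ha : a ∈ homog (A := SLPow κ n m) 0)
    (b : SLPow κ n m) : a * b = b * a := by
  obtain ⟨a, ha', rfl⟩ := mem_homog_slPow.1 ha
  obtain ⟨b, rfl⟩ := slMk_surjective b
  rw [← map_mul, ← map_mul, center_mul_comm (homog_zero_central _ ha')]

end SLPow

/-! ### The conjugation and the parity automorphism -/

section Ddag

variable {n m : ℕ}

theorem counit_ddag (a : FunSL n m) :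
    counit Bool n m (ddag n m a) = starRingEnd ℂ (counit Bool n m a) := by
  obtain ⟨a, rfl⟩ := slMk_surjective a
  rw [ddag_mk, counit_mk, counit_mk]
  exact const_substSemi _ _ _ _ _ _ a

theorem ddag_smul (c : ℂ) (a : FunSL n m) :
    ddag n m (c • a) = starRingEnd ℂ c • ddag n m a := by
  rw [Algebra.smul_def, map_mul, ddag_algebraMap, ← Algebra.smul_def]

theorem ddag_mem_homog {q : ZMod 2} {a : FunSL n m} (ha : a ∈ homog (A := FunSL n m) q) :
    ddag n m a ∈ homog (A := FunSL n m) q := by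
  obtain ⟨a, ha', rfl⟩ := mem_homog_slPow.1 ha
  exact ⟨_, substSemi_mem_homog _ _ _ _ _ _ ha', (ddag_mk n m a).symm⟩

theorem conjSubst_conjSubst_var (x : Bool × Fin (n + m) × Fin (n + m)) :
    conjSubst n m (conjSubst n m (var _ x)) = sgn (genPar Bool n m x) • var _ x := by
  obtain ⟨_ | _, i, j⟩ := x
  · have h : conjSubst n m (var _ (false, i, j)) = var _ (true, i, j) :=
      substSemi_var _ _ _ _ _ _ _
    rw [h]
    exact substSemi_var _ _ _ _ _ _ _
  · have h : conjSubst n m (var _ (true, i, j)) =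
        sgn (par n m i + par n m j) • var _ (false, i, j) := substSemi_var _ _ _ _ _ _ _
    have h' : conjSubst n m (var _ (false, i, j)) = var _ (true, i, j) :=
      substSemi_var _ _ _ _ _ _ _
    rw [h]
    refine (substSemi_smul _ _ _ _ _ _ _ _).trans ?_
    rw [conj_sgn]
    exact congrArg _ h'

theorem conjSubst_conjSubst_word (w : List (Bool × Fin (n + m) × Fin (n + m))) :
    conjSubst n m (conjSubst n m (w.map (var (genPar Bool n m))).prod) =
      sgn (w.map (genPar Bool n m)).sum • (w.map (var (genPar Bool n m))).prod := by
  induction w with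
  | nil => simp [sgn_zero]
  | cons x w ih =>
    rw [List.map_cons, List.map_cons, List.prod_cons, List.sum_cons, map_mul, map_mul, ih,
      conjSubst_conjSubst_var, sgn_add, smul_mul_smul_comm]

theorem exists_conjTrunc (k : ℕ) :
    ∃ C : Trunc (genPar Bool n m) k →+* Trunc (genPar Bool n m) k,
      (∀ a, trunc _ k (conjSubst n m a) = C (trunc _ k a)) ∧
        ∀ c a, C (c • a) = starRingEnd ℂ c • C a :=
  ⟨tsubst _ _ _ _ _ _ k, fun a => trunc_substSemi _ _ _ _ _ _ k a,
    fun c a => tsubst_smul _ _ _ _ _ _ k c a⟩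

/-- The square of an antilinear map is linear, so on truncations the double conjugation is
determined by its eigenvalues on words. -/
theorem exists_conjTrunc_conjTrunc (k : ℕ) :
    ∃ C : Trunc (genPar Bool n m) k →ₗ[ℂ] Trunc (genPar Bool n m) k,
      (∀ a, trunc _ k (conjSubst n m (conjSubst n m a)) = C (trunc _ k a)) ∧
        ∀ w, C (word _ k w) = sgn (w.map (genPar Bool n m)).sum • word _ k w := by
  obtain ⟨C, hC, hs⟩ := exists_conjTrunc (n := n) (m := m) k
  refine ⟨{ toFun := fun a => C (C a)
            map_add' := fun a b => by rw [map_add, map_add]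
            map_smul' := fun c a => by rw [hs, hs, Complex.conj_conj, RingHom.id_apply] },
    fun a => ?_, fun w => ?_⟩
  · rw [hC, hC]; rfl
  · have := congrArg (trunc _ k) (conjSubst_conjSubst_word w)
    rwa [hC, hC, map_smul, trunc_word_prod] at this

theorem conjSubst_conjSubst {q : ZMod 2} {a : PS Bool n m} (ha : a ∈ homog (A := PS Bool n m) q) :
    conjSubst n m (conjSubst n m a) = sgn q • a := by
  apply series_ext
  intro k
  obtain ⟨C, hC, hw⟩ := exists_conjTrunc_conjTrunc (n := n) (m := m) k
  rw [hC, map_smul]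
  have h := ha k
  generalize trunc _ k a = t at h ⊢
  induction h using Submodule.span_induction with
  | zero => simp
  | add x y _ _ hx hy => rw [map_add, hx, hy, smul_add]
  | smul c x _ hx => rw [map_smul, hx, smul_comm]
  | mem x hx =>
    obtain ⟨w, rfl, rfl⟩ := hx
    exact hw w

/-- The expression is twice the projection of `a` to parity `q`: words of parity `q` are doubled and
the others cancel. -/
theorem add_conjSubst_mem_homog (q : ZMod 2) (a : PS Bool n m) :
    a + sgn q • conjSubst n m (conjSubst n m a) ∈ homog (A := PS Bool n m) q := by
  intro k
  obtain ⟨C, hC, hw⟩ := exists_conjTrunc_conjTrunc (n := n) (m := m) k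
  rw [map_add, map_smul, hC]
  have h : trunc _ k a ∈ Submodule.span ℂ (Set.range (word (genPar Bool n m) k)) := by
    rw [span_word]; trivial
  generalize trunc _ k a = t at h ⊢
  induction h using Submodule.span_induction with
  | zero => simp
  | add x y _ _ hx hy =>
    rw [map_add, smul_add, add_add_add_comm]
    exact Submodule.add_mem _ hx hy
  | smul c x _ hx =>
    rw [map_smul, smul_comm, ← smul_add]
    exact Submodule.smul_mem _ _ hx
  | mem x hx =>
    obtain ⟨w, rfl⟩ := hx
    rw [hw, smul_smul, ← sgn_add]
    by_cases h : (w.map (genPar Bool n m)).sum = q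
    · exact Submodule.add_mem _ (Submodule.subset_span ⟨w, h, rfl⟩)
        (Submodule.smul_mem _ _ (Submodule.subset_span ⟨w, h, rfl⟩))
    · have h1 : ∀ a b : ZMod 2, a ≠ b → b + a = 1 := by decide
      rw [h1 _ _ h, sgn_one, neg_smul, one_smul, add_neg_cancel]
      exact Submodule.zero_mem _

/-- The square of the conjugation is the parity automorphism. -/
theorem mem_homog_iff_ddag {q : ZMod 2} {a : FunSL n m} :
    a ∈ homog (A := FunSL n m) q ↔ ddag n m (ddag n m a) = sgn q • a := by
  constructor
  · intro ha
    obtain ⟨b, hb, rfl⟩ := mem_homog_slPow.1 ha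
    rw [ddag_mk, ddag_mk, conjSubst_conjSubst hb, map_smul]
  · intro h
    obtain ⟨b, rfl⟩ := slMk_surjective a
    -- The lift `b` need not be homogeneous. Its parity `q` part is, and by the hypothesis it has
    -- the same class.
    refine mem_homog_slPow.2 ⟨(2⁻¹ : ℂ) • (b + sgn q • conjSubst n m (conjSubst n m b)),
      Submodule.smul_mem _ _ (add_conjSubst_mem_homog q b), ?_⟩
    rw [ddag_mk, ddag_mk] at h
    rw [map_smul, map_add, map_smul, h, smul_smul, sgn_mul_self, one_smul, ← two_smul ℂ, smul_smul,
      inv_mul_cancel₀ two_ne_zero, one_smul]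

end Ddag

/-! ### Square roots of even elements with constant term one -/

section SquareRoot

/-- Commutation gives (a + b)(a - b) = 0, and the first factor can be cancelled. -/
theorem eq_of_mul_self_eq {R : Type} [Ring R] {a b : R} (hab : Commute a b) (h : a * a = b * b)
    (hu : IsUnit (a + b)) : a = b := by
  rw [← sub_eq_zero, ← hu.mul_right_eq_zero, ← hab.mul_self_sub_mul_self_eq, h, sub_self]

theorem isUnit_add_of_isNilpotent {R : Type} [Ring R] [Algebra ℂ R] {a b : R} (hab : Commute a b)
    (ha : IsNilpotent (1 - a)) (hb : IsNilpotent (1 - b)) : IsUnit (a + b) := by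
  have h2 : IsUnit (algebraMap ℂ R 2) := (IsUnit.mk0 _ two_ne_zero).map _
  have hc : Commute (1 - a) (1 - b) :=
    ((Commute.one_left _).sub_left ((Commute.one_right a).sub_right hab))
  have h := (hc.isNilpotent_add ha hb).neg
  have h3 := h.isUnit_add_left_of_commute h2 (Algebra.commutes 2 _).symm
  convert h3 using 1
  rw [map_ofNat, ← one_add_one_eq_two]
  abel

variable {X : Type} (p : X → ZMod 2)

/-- Newton's method for X² - a starting at 1, in the commutative ring given by the centre: the value
1 - a is nilpotent and the derivative 2 is a unit. -/
theorem exists_sqrt_trunc {k : ℕ} {a : Trunc p k} (ha : a ∈ Subring.center (Trunc p k))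
    (hn : IsNilpotent (1 - a)) :
    ∃ b ∈ Subring.center (Trunc p k), IsNilpotent (1 - b) ∧ b * b = a := by
  let R := Subring.center (Trunc p k)
  let P : Polynomial R := Polynomial.X ^ 2 - Polynomial.C ⟨a, ha⟩
  have hinj : Function.Injective R.subtype := Subtype.val_injective
  have h1 : IsNilpotent (Polynomial.aeval (1 : R) P) := by
    rw [← IsNilpotent.map_iff hinj]
    simpa [P] using hn
  have h2 : IsUnit (Polynomial.aeval (1 : R) (Polynomial.derivative P)) := by
    apply isUnit_lift
    have : IsUnit (1 + 1 : Trunc p k) := by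
      rw [one_add_one_eq_two, ← map_ofNat (algebraMap ℂ (Trunc p k)) 2]
      exact (IsUnit.mk0 _ two_ne_zero).map _
    simpa [P] using this
  obtain ⟨b, ⟨hb, hb'⟩, -⟩ := Polynomial.existsUnique_nilpotent_sub_and_aeval_eq_zero h1 h2
  refine ⟨b, b.2, ?_, ?_⟩
  · exact hb.map R.subtype
  · have := congrArg R.subtype hb'
    simp only [P, map_sub, map_pow, Polynomial.aeval_X, Polynomial.aeval_C, map_zero] at this
    rw [← pow_two]
    exact sub_eq_zero.1 this

/-- A central power series with constant term `1` has a central square root. -/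
theorem exists_sqrt_series {a : Series p} (ha : a ∈ Subring.center (Series p))
    (hc : const p a = 1) : ∃ b ∈ Subring.center (Series p), const p b = 1 ∧ b * b = a := by
  have cen : ∀ k, trunc p k a ∈ Subring.center (Trunc p k) := fun k => by
    rw [Subring.mem_center_iff]
    intro g
    obtain ⟨g, rfl⟩ := trunc_surjective p k g
    rw [← map_mul, ← map_mul, center_mul_comm ha]
  have nil : ∀ k, IsNilpotent (1 - trunc p k a) := fun k => by
    rw [← map_one (trunc p k), ← map_sub]
    exact ⟨k, filt_nilpotent p (mem_filt_of_const p (by rw [map_sub, hc, map_one, sub_self]) k)⟩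
  choose b hb hb1 hbb using fun k => exists_sqrt_trunc p (cen k) (nil k)
  -- The roots are chosen separately in each degree; they are compatible because a unipotent root is
  -- unique.
  have hres : ∀ k, res p k (b (k + 1)) = b k := fun k => by
    have hcom : Commute (res p k (b (k + 1))) (b k) := (center_mul_comm (hb k) _).symm
    have hn : IsNilpotent (1 - res p k (b (k + 1))) := by
      rw [← map_one (res p k), ← map_sub]
      exact (hb1 (k + 1)).map _
    refine eq_of_mul_self_eq hcom ?_ (isUnit_add_of_isNilpotent hcom hn (hb1 k))
    rw [← map_mul, hbb, hbb, res_trunc]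
  refine ⟨mkSeries p b hres, ?_, ?_, ?_⟩
  · rw [Subring.mem_center_iff]
    intro g
    apply series_ext
    intro k
    rw [map_mul, map_mul, trunc_mkSeries, center_mul_comm (hb k)]
  · have h := (hb1 1).map (tconst p 0)
    rw [map_sub, map_one, isNilpotent_iff_eq_zero, sub_eq_zero] at h
    exact h.symm
  · apply series_ext
    intro k
    rw [map_mul, trunc_mkSeries, hbb]

/-- The root of a lifted series is only known to be central. Its image under ‡‡ is a root of the
same even element with the same constant term, so the two coincide, which is evenness. -/
theorem exists_sqrt {n m : ℕ} {a : FunSL n m} (ha : a ∈ homog (A := FunSL n m) 0)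
    (hc : counit Bool n m a = 1) :
    ∃ b ∈ homog (A := FunSL n m) 0, counit Bool n m b = 1 ∧ b * b = a := by
  obtain ⟨a, ha', rfl⟩ := mem_homog_slPow.1 ha
  rw [counit_mk] at hc
  obtain ⟨b, hb, hb1, hbb⟩ := exists_sqrt_series _ (homog_zero_central _ ha') hc
  have hb1' : counit Bool n m (slMk Bool n m b) = 1 := by rw [counit_mk, hb1]
  refine ⟨slMk Bool n m b, ?_, hb1', by rw [← map_mul, hbb]⟩
  rw [mem_homog_iff_ddag, sgn_zero, one_smul] at ha ⊢
  refine eq_of_mul_self_eq ?_ ?_ (isUnit_of_counit ?_)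
  · obtain ⟨c, hc⟩ := slMk_surjective (ddag n m (ddag n m (slMk Bool n m b)))
    rw [← hc, Commute, SemiconjBy, ← map_mul, ← map_mul, center_mul_comm hb]
  · rw [← map_mul, ← map_mul, ← map_mul, hbb, ha]
  · rw [map_add, counit_ddag, counit_ddag, hb1']
    norm_num

theorem eq_of_mul_self_eq_of_even {κ : Type} {n m : ℕ} {a b : SLPow κ n m}
    (ha : a ∈ homog (A := SLPow κ n m) 0) (ha1 : counit κ n m a = 1) (hb1 : counit κ n m b = 1)
    (h : a * a = b * b) : a = b :=
  eq_of_mul_self_eq (slPow_even_comm ha b) h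
    (isUnit_of_counit (by rw [map_add, ha1, hb1]; norm_num))

end SquareRoot

/-! ### Triangular factorizations over a noncommutative ring -/

section Triangular

variable {R S : Type} [Ring R] [Ring S]

/-- A matrix over a ring is invertible when it is so modulo the Jacobson radical. -/
theorem isUnit_matrix_of_map_eq_one (ε : R →+* S) (hu : ∀ a, ε a = 1 → IsUnit a) {k : ℕ}
    {M : Matrix (Fin k) (Fin k) R} (h : M.map ε = 1) : IsUnit M := by
  have left : ∀ M : Matrix (Fin k) (Fin k) R, M.map ε = 1 → ∃ Z, Z * M = 1 := by
    intro M h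
    -- The entries of 1 - M lie in the kernel of `ε`, hence in the Jacobson radical, since 1 plus a
    -- multiple of such an entry is a unit.
    have h1 : 1 - M ∈ ((⊥ : Ideal R).jacobson).matrix (Fin k) := by
      intro i j
      refine Ideal.mem_jacobson_iff.2 ?_
      intro y
      have h0 : ε ((1 - M) i j) = 0 := by
        have := congrFun (congrFun h i) j
        rw [Matrix.map_apply] at this
        rw [Matrix.sub_apply, map_sub, this, Matrix.one_apply, Matrix.one_apply]
        split_ifs <;> simp
      obtain ⟨z, hz⟩ := (hu (y * (1 - M) i j + 1) (by
        rw [map_add, map_mul, h0, mul_zero, zero_add, map_one]))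
      refine ⟨↑z⁻¹, ?_⟩
      have : (↑z⁻¹ : R) * (y * (1 - M) i j + 1) = 1 := by rw [← hz, Units.inv_mul]
      rw [Ideal.mem_bot, ← this]
      noncomm_ring
    -- With the multiplier `-1`, the radical condition Z·(-1)·(1 - M) + Z - 1 = 0 reads ZM = 1.
    obtain ⟨Z, hZ⟩ := Ideal.mem_jacobson_iff.1 (Ideal.matrix_jacobson_le _ h1) (-1)
    refine ⟨Z, ?_⟩
    have h2 : Z * -1 * (1 - M) + Z - 1 = 0 := by
      ext i j
      exact hZ i j
    rw [← sub_eq_zero, ← h2]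
    noncomm_ring
  obtain ⟨Z, hZ⟩ := left M h
  -- The left inverse also reduces to `1`, so it has a left inverse of its own, which must be `M`.
  -- This makes the inverse two-sided.
  obtain ⟨W, hW⟩ := left Z (by
    have := congrArg ε.mapMatrix hZ
    rwa [map_mul, map_one, RingHom.mapMatrix_apply, RingHom.mapMatrix_apply, h, mul_one] at this)
  have : W = M := by rw [← mul_one W, ← hZ, ← mul_assoc, hW, one_mul]
  exact ⟨⟨M, Z, this ▸ hW, hZ⟩, rfl⟩

/-- In row or column `k` of the product the terms beyond `k` vanish by triangularity. Only one term
involves column `k` of `L` and row `k` of `V`, which permits induction on `k`. -/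
theorem sum_lower_mul_upper {N : ℕ} {L V : Matrix (Fin N) (Fin N) R}
    (hL : ∀ i j, i < j → L i j = 0) (hV : ∀ i j, j < i → V i j = 0) {k : Fin N} (i j : Fin N)
    (hk : i = k ∨ j = k) :
    (L * V) i j = ∑ l ∈ Finset.univ.filter (· < k), L i l * V l j + L i k * V k j := by
  rw [Matrix.mul_apply, ← Finset.sum_filter_add_sum_filter_not Finset.univ (· < k)]
  congr 1
  refine Finset.sum_eq_single_of_mem k (by simp) fun l hl hlk => ?_
  have hkl : k < l := lt_of_le_of_ne (not_lt.1 (Finset.mem_filter.1 hl).2) (Ne.symm hlk)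
  rcases hk with rfl | rfl
  · rw [hL _ _ hkl, zero_mul]
  · rw [hV _ _ hkl, mul_zero]

/-- Uniqueness of triangular factorizations whose diagonal parts are determined by their
products. -/
theorem lower_mul_upper_unique {N : ℕ} {L V L' V' : Matrix (Fin N) (Fin N) R}
    (hL : ∀ i j, i < j → L i j = 0) (hV : ∀ i j, j < i → V i j = 0)
    (hL' : ∀ i j, i < j → L' i j = 0) (hV' : ∀ i j, j < i → V' i j = 0)
    (uL : ∀ i, IsUnit (L i i)) (uV : ∀ i, IsUnit (V i i))
    (hd : ∀ i, L i i * V i i = L' i i * V' i i → L i i = L' i i ∧ V i i = V' i i)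
    (h : L * V = L' * V') : L = L' ∧ V = V' := by
  have key : ∀ k, (∀ i, L i k = L' i k) ∧ ∀ j, V k j = V' k j := by
    intro k
    induction k using WellFoundedLT.induction with
    | ind k ih =>
      -- The terms before `k` agree by induction and cancel. At i = j = k what remains separates the
      -- diagonal entries through `hd`; these are units and can then be cancelled from the rest.
      have e : ∀ i j, i = k ∨ j = k → L i k * V k j = L' i k * V' k j := fun i j hk => by
        have h1 := congrFun (congrFun h i) j
        rw [sum_lower_mul_upper hL hV i j hk, sum_lower_mul_upper hL' hV' i j hk,
          Finset.sum_congr rfl fun l hl => by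
            rw [(ih l (Finset.mem_filter.1 hl).2).1 i, (ih l (Finset.mem_filter.1 hl).2).2 j]] at h1
        exact add_left_cancel h1
      obtain ⟨e1, e2⟩ := hd k (e k k (Or.inl rfl))
      refine ⟨fun i => (uV k).mul_left_injective ?_, fun j => (uL k).mul_right_injective ?_⟩
      · exact (e i k (Or.inr rfl)).trans (by rw [e2])
      · exact (e k j (Or.inl rfl)).trans (by rw [e1])
  exact ⟨Matrix.ext fun i j => (key j).1 i, Matrix.ext fun i j => (key i).2 j⟩

/-- Gauss decomposition of a matrix that is congruent to `1` modulo the Jacobson radical. -/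
theorem exists_lower_mul_upper (ε : R →+* S) (hu : ∀ a, ε a = 1 → IsUnit a) : ∀ {N : ℕ}
    (H : Matrix (Fin N) (Fin N) R), H.map ε = 1 → ∃ L V : Matrix (Fin N) (Fin N) R,
      (∀ i j, i < j → L i j = 0) ∧ (∀ i j, j < i → V i j = 0) ∧ (∀ i, L i i = 1) ∧
      V.map ε = 1 ∧ L * V = H := by
  intro N
  induction N with
  | zero => exact fun H _ => ⟨H, H, fun i => i.elim0, fun i => i.elim0, fun i => i.elim0,
      Subsingleton.elim _ _, Subsingleton.elim _ _⟩
  | succ N ih =>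
    intro H h
    have hε : ∀ i j, ε (H i j) = (1 : Matrix _ _ S) i j := fun i j => congrFun (congrFun h i) j
    obtain ⟨a, ha⟩ := hu (H 0 0) (hε 0 0)
    have ha' : (↑a⁻¹ : R) * H 0 0 = 1 := by rw [← ha, Units.inv_mul]
    -- Induction is applied to the Schur complement of the first entry. It still reduces to `1`, as
    -- the correction is a product of elements in the kernel of `ε` with a unit between them.
    obtain ⟨L, V, hL, hV, hL1, hV1, hLV⟩ := ih
      (Matrix.of fun i j => H i.succ j.succ - H i.succ 0 * ↑a⁻¹ * H 0 j.succ) (by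
        ext i j
        simp [hε, Matrix.one_apply, Fin.ext_iff])
    refine ⟨Matrix.of (Fin.cons (Fin.cons 1 0) fun i => Fin.cons (H i.succ 0 * ↑a⁻¹) (L i)),
      Matrix.of (Fin.cons (H 0) fun i => Fin.cons 0 (V i)), ?_, ?_, ?_, ?_, ?_⟩
    · intro i j
      refine Fin.cases ?_ (fun i => ?_) i <;> refine Fin.cases ?_ (fun j => ?_) j <;> intro hij
      · simp at hij
      · simp
      · simp at hij
      · simpa using hL i j (by simpa using hij)
    · intro i j
      refine Fin.cases ?_ (fun i => ?_) i <;> refine Fin.cases ?_ (fun j => ?_) j <;> intro hij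
      · simp at hij
      · simp at hij
      · simp
      · simpa using hV i j (by simpa using hij)
    · intro i
      refine Fin.cases ?_ (fun i => ?_) i
      · simp
      · simpa using hL1 i
    · have hV1' : ∀ i j, ε (V i j) = (1 : Matrix _ _ S) i j := fun i j => congrFun (congrFun hV1 i) j
      ext i j
      refine Fin.cases ?_ (fun i => ?_) i <;> refine Fin.cases ?_ (fun j => ?_) j <;>
        simp [hε, hV1', Matrix.one_apply, Fin.ext_iff]
    · have hLV' : ∀ i j, ∑ k, L i k * V k j =
          H i.succ j.succ - H i.succ 0 * ↑a⁻¹ * H 0 j.succ := fun i j =>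
        (Matrix.mul_apply (M := L) (N := V)).symm.trans (congrFun (congrFun hLV i) j)
      ext i j
      refine Fin.cases ?_ (fun i => ?_) i <;> refine Fin.cases ?_ (fun j => ?_) j <;>
        simp [Matrix.mul_apply, Fin.sum_univ_succ, hLV', mul_assoc, ha']

end Triangular

/-! ### Supermatrices, supertranspose and superadjoint -/

section Supermatrix

variable {n m : ℕ}

theorem sgn_mul_sgn (a b c : ZMod 2) : sgn (a + b) * sgn (b + c) = sgn (a + c) := by
  rw [← sgn_add, add_assoc, ← add_assoc b, CharTwo.add_self_eq_zero, zero_add]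

/-- The parity automorphism of matrices. The supermatrices are its fixed points. -/
def parityTwist (M : Matrix (Fin (n + m)) (Fin (n + m)) (FunSL n m)) :
    Matrix (Fin (n + m)) (Fin (n + m)) (FunSL n m) :=
  fun i j => sgn (par n m i + par n m j) • ddag n m (ddag n m (M i j))

theorem isSupermatrix_iff {M : Matrix (Fin (n + m)) (Fin (n + m)) (FunSL n m)} :
    IsSupermatrix n m M ↔ parityTwist M = M := by
  have e : ∀ i j, M i j ∈ homog (A := FunSL n m) (par n m i + par n m j) ↔
      parityTwist M i j = M i j := fun i j => by
    rw [mem_homog_iff_ddag, parityTwist]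
    constructor <;> intro h
    · rw [h, smul_smul, sgn_mul_self, one_smul]
    · rw [← h, smul_smul, sgn_mul_self, one_smul, h]
  exact ⟨fun h => Matrix.ext fun i j => (e i j).1 (h i j),
    fun h i j => (e i j).2 (congrFun (congrFun h i) j)⟩

theorem parityTwist_mul (M N : Matrix (Fin (n + m)) (Fin (n + m)) (FunSL n m)) :
    parityTwist (M * N) = parityTwist M * parityTwist N := by
  ext i j
  simp only [parityTwist, Matrix.mul_apply, map_sum, map_mul, Finset.smul_sum, smul_mul_smul_comm,
    sgn_mul_sgn]

theorem IsSupermatrix.mul {M N : Matrix (Fin (n + m)) (Fin (n + m)) (FunSL n m)}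
    (hM : IsSupermatrix n m M) (hN : IsSupermatrix n m N) : IsSupermatrix n m (M * N) := by
  rw [isSupermatrix_iff] at *
  rw [parityTwist_mul, hM, hN]

/-- The parity twist fixes `M * N` and `N`; cancelling `N` shows that it fixes `M`. No inverse has
to be computed. -/
theorem IsSupermatrix.of_mul {M N : Matrix (Fin (n + m)) (Fin (n + m)) (FunSL n m)}
    (hMN : IsSupermatrix n m (M * N)) (hN : IsSupermatrix n m N) (hu : IsUnit N) :
    IsSupermatrix n m M := by
  rw [isSupermatrix_iff] at *
  rw [parityTwist_mul, hN] at hMN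
  exact hu.mul_left_injective hMN

theorem IsSupermatrix.diag {M : Matrix (Fin (n + m)) (Fin (n + m)) (FunSL n m)}
    (hM : IsSupermatrix n m M) (i : Fin (n + m)) : M i i ∈ homog (A := FunSL n m) 0 := by
  have := hM i i
  rwa [CharTwo.add_self_eq_zero] at this

theorem isSupermatrix_diagonal {d : Fin (n + m) → FunSL n m}
    (hd : ∀ i, d i ∈ homog (A := FunSL n m) 0) : IsSupermatrix n m (Matrix.diagonal d) := by
  intro i j
  rw [Matrix.diagonal_apply]
  split_ifs with h
  · rw [h, CharTwo.add_self_eq_zero]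
    exact hd j
  · exact Submodule.zero_mem _

theorem isSupermatrix_gmat {κ : Type} (c : κ) : IsSupermatrix n m (gmat n m c) := fun i j =>
  mem_homog_slPow.2 ⟨_, ymat_isSupermatrix n m c i j, rfl⟩

theorem gmat_apply {κ : Type} (c : κ) (i j : Fin (n + m)) :
    gmat n m c i j = (1 : Matrix _ _ (SLPow κ n m)) i j + coord n m c i j := by
  change slMk κ n m ((1 : Matrix _ _ (PS κ n m)) i j + var _ _) = _
  rw [map_add, Matrix.one_apply, Matrix.one_apply, apply_ite (slMk κ n m), map_one, map_zero]
  rfl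

theorem gmat_map_ddag : (gmat n m false).map (ddag n m) = gmat n m true := by
  ext i j
  rw [Matrix.map_apply, gmat_apply, gmat_apply, map_add, ddag_coord_false, Matrix.one_apply,
    apply_ite (ddag n m), map_one, map_zero]

/-- The sign from exchanging the entries `M j k` and `N k i` is exactly what the signs of the
supertransposes compensate, in all eight cases of parities. -/
theorem supertranspose_mul {M N : Matrix (Fin (n + m)) (Fin (n + m)) (FunSL n m)}
    (hM : IsSupermatrix n m M) (hN : IsSupermatrix n m N) :
    supertranspose n m (M * N) = supertranspose n m N * supertranspose n m M := by
  ext i j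
  simp only [supertranspose, Matrix.mul_apply, Finset.smul_sum]
  refine Finset.sum_congr rfl fun k _ => ?_
  rw [slPow_comm (hM j k) (hN k i), smul_mul_smul_comm, smul_smul, ← sgn_add, ← sgn_add]
  congr 2
  generalize par n m i = a
  generalize par n m j = b
  generalize par n m k = c
  revert a b c
  decide

theorem ddag_map_mul (M N : Matrix (Fin (n + m)) (Fin (n + m)) (FunSL n m)) :
    (M * N).map (ddag n m) = M.map (ddag n m) * N.map (ddag n m) := Matrix.map_mul

theorem IsSupermatrix.ddag {M : Matrix (Fin (n + m)) (Fin (n + m)) (FunSL n m)}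
    (hM : IsSupermatrix n m M) : IsSupermatrix n m (M.map (ddag n m)) :=
  fun i j => ddag_mem_homog (hM i j)

theorem IsSupermatrix.supertranspose {M : Matrix (Fin (n + m)) (Fin (n + m)) (FunSL n m)}
    (hM : IsSupermatrix n m M) : IsSupermatrix n m (supertranspose n m M) := fun i j =>
  Submodule.smul_mem _ _ (add_comm (par n m i) (par n m j) ▸ hM j i)

/-- The adjoint `(M^‡)^st` of a supermatrix. -/
def superAdjoint (M : Matrix (Fin (n + m)) (Fin (n + m)) (FunSL n m)) :
    Matrix (Fin (n + m)) (Fin (n + m)) (FunSL n m) := supertranspose n m (M.map (ddag n m))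

theorem IsSupermatrix.superAdjoint {M : Matrix (Fin (n + m)) (Fin (n + m)) (FunSL n m)}
    (hM : IsSupermatrix n m M) : IsSupermatrix n m (superAdjoint M) := hM.ddag.supertranspose

theorem superAdjoint_mul {M N : Matrix (Fin (n + m)) (Fin (n + m)) (FunSL n m)}
    (hM : IsSupermatrix n m M) (hN : IsSupermatrix n m N) :
    superAdjoint (M * N) = superAdjoint N * superAdjoint M := by
  rw [superAdjoint, ddag_map_mul, supertranspose_mul hM.ddag hN.ddag]
  rfl

/-- The supertranspose is not an involution: its square multiplies the entry `(i, j)` by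
(-1)^(|i|+|j|). The square of ‡ gives the same sign on a supermatrix, and the two cancel. -/
theorem superAdjoint_superAdjoint {M : Matrix (Fin (n + m)) (Fin (n + m)) (FunSL n m)}
    (hM : IsSupermatrix n m M) : superAdjoint (superAdjoint M) = M := by
  ext i j
  simp only [superAdjoint, supertranspose, Matrix.map_apply, ddag_smul, conj_sgn]
  rw [mem_homog_iff_ddag.1 (hM i j), smul_smul, smul_smul, ← sgn_add, ← sgn_add]
  have : par n m i * (par n m i + par n m j) + par n m j * (par n m j + par n m i) +
      (par n m i + par n m j) = 0 := by
    generalize par n m i = a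
    generalize par n m j = b
    revert a b
    decide
  rw [this, sgn_zero, one_smul]

theorem supertranspose_diag (M : Matrix (Fin (n + m)) (Fin (n + m)) (FunSL n m))
    (i : Fin (n + m)) : supertranspose n m M i i = M i i := by
  rw [supertranspose, CharTwo.add_self_eq_zero, mul_zero, sgn_zero, one_smul]

theorem supertranspose_injective :
    Function.Injective (supertranspose (A := FunSL n m) n m) := fun M N h => by
  ext i j
  have := congrFun (congrFun h j) i
  simp only [supertranspose] at this
  exact smul_right_injective _ (sgn_ne_zero _) this

theorem supertranspose_eq_zero {M : Matrix (Fin (n + m)) (Fin (n + m)) (FunSL n m)}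
    {i j : Fin (n + m)} (h : M j i = 0) : supertranspose n m M i j = 0 := by
  rw [supertranspose, h, smul_zero]

theorem supertranspose_one {A : Type} [Ring A] [Algebra ℂ A] :
    supertranspose n m (1 : Matrix (Fin (n + m)) (Fin (n + m)) A) = 1 := by
  ext i j
  rw [supertranspose, Matrix.one_apply, Matrix.one_apply]
  split_ifs with h h' h'
  · rw [h, CharTwo.add_self_eq_zero, mul_zero, sgn_zero, one_smul]
  · exact absurd h.symm h'
  · exact absurd h'.symm h
  · rw [smul_zero]

theorem supertranspose_map {A B : Type} [Ring A] [Algebra ℂ A] [Ring B] [Algebra ℂ B]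
    (f : A →ₐ[ℂ] B) (M : Matrix (Fin (n + m)) (Fin (n + m)) A) :
    (supertranspose n m M).map f = supertranspose n m (M.map f) := by
  ext i j
  exact map_smul f _ _

theorem counit_map_ddag {M : Matrix (Fin (n + m)) (Fin (n + m)) (FunSL n m)}
    (h : M.map (counit Bool n m) = 1) : (M.map (ddag n m)).map (counit Bool n m) = 1 := by
  ext i j
  have := congrFun (congrFun h i) j
  rw [Matrix.map_apply] at this
  rw [Matrix.map_apply, Matrix.map_apply, counit_ddag, this, Matrix.one_apply]
  split_ifs <;> simp

theorem counit_superAdjoint {M : Matrix (Fin (n + m)) (Fin (n + m)) (FunSL n m)}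
    (h : M.map (counit Bool n m) = 1) : (superAdjoint M).map (counit Bool n m) = 1 := by
  rw [superAdjoint, supertranspose_map, counit_map_ddag h, supertranspose_one]

theorem counit_map_mul {κ : Type} (M N : Matrix (Fin (n + m)) (Fin (n + m)) (SLPow κ n m)) :
    (M * N).map (counit κ n m) = M.map (counit κ n m) * N.map (counit κ n m) := Matrix.map_mul

theorem isUnit_supermatrix {κ : Type} {M : Matrix (Fin (n + m)) (Fin (n + m)) (SLPow κ n m)}
    (h : M.map (counit κ n m) = 1) : IsUnit M :=
  isUnit_matrix_of_map_eq_one (counit κ n m).toRingHom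
    (fun _ ha => isUnit_of_counit (ne_of_eq_of_ne ha one_ne_zero)) h

end Supermatrix

/-! ### The superdeterminant on the quotients -/

section Superdeterminant

variable {n m : ℕ}

theorem ringInverse_transpose {A : Type} [Ring A] {k : ℕ} {D : Matrix (Fin k) (Fin k) A}
    (hD : CentralMat D) (u : IsUnit (ncdet D)) :
    Ring.inverse D.transpose = (Ring.inverse D).transpose := by
  obtain ⟨v, c⟩ := isUnit_of_ncdet hD u
  have t : ∀ {M N : Matrix (Fin k) (Fin k) A}, CentralMat M →
      M.transpose * N.transpose = (N * M).transpose := fun {M N} hM => by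
    ext i j
    simp only [Matrix.mul_apply, Matrix.transpose_apply]
    exact Finset.sum_congr rfl fun l _ => center_mul_comm (hM _ _) _
  apply ringInverse_eq
  · rw [t hD, Ring.inverse_mul_cancel _ v, Matrix.transpose_one]
  · rw [t c, Ring.mul_inverse_cancel _ v, Matrix.transpose_one]

/-- Reversing two odd factors produces a minus sign, which the sign in -Bᵗ absorbs. The new Schur
complement is therefore the transpose of the old one. -/
theorem sdetBlocks_supertranspose {A : Type} [Ring A] {O : Submodule (Subring.center A) A}
    (hO : OddLaws O) {P : Matrix (Fin n) (Fin n) A} {B : Matrix (Fin n) (Fin m) A}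
    {C : Matrix (Fin m) (Fin n) A} {D : Matrix (Fin m) (Fin m) A} (hP : CentralMat P)
    (hB : MatIn O B) (hC : MatIn O C) (hD : CentralMat D) (u : IsUnit (ncdet D)) :
    sdetBlocks P.transpose C.transpose (-B.transpose) D.transpose = sdetBlocks P B C D := by
  obtain ⟨-, c⟩ := isUnit_of_ncdet hD u
  have e : P.transpose - C.transpose * (Ring.inverse D).transpose * -B.transpose =
      (P - B * Ring.inverse D * C).transpose := by
    rw [Matrix.mul_neg, sub_neg_eq_add, Matrix.transpose_sub, sub_eq_add_neg]
    congr 1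
    ext i j
    rw [Matrix.neg_apply, Matrix.transpose_apply, Matrix.mul_assoc]
    simp only [Matrix.mul_apply, Matrix.transpose_apply, Finset.mul_sum, Finset.sum_mul,
      ← Finset.sum_neg_distrib]
    refine Finset.sum_congr rfl fun k _ => Finset.sum_congr rfl fun l _ => ?_
    rw [center_mul_comm (c l k), ← mul_assoc, hO.anti _ (hC k i) _ (hB j l), neg_mul,
      mul_assoc (B j l), mul_assoc (B j l), center_mul_comm (c l k)]
  unfold sdetBlocks
  rw [ringInverse_transpose hD u, e,
    ncdet_transpose (hP.sub ((hB.mul_central c).mul hO hC)), ncdet_transpose hD]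

theorem sdet_supertranspose_series {X : Type} {p : X → ZMod 2}
    {M : Matrix (Fin (n + m)) (Fin (n + m)) (Series p)} (hM : IsSupermatrix n m M)
    (cM : M.map (const p) = 1) : sdet n m (supertranspose n m M) = sdet n m M := by
  rw [sdet, sdet, ← sdetBlocks_supertranspose (oddLaws p) (central_even hM) (matIn_upper hM)
    (matIn_lower hM) (central_odd hM) (isUnit_ncdet_of_const (const_natAdd cM))]
  congr 1 <;> ext i j <;>
    simp [supertranspose, par_castAdd, par_natAdd, sgn_zero, sgn_one, CharTwo.add_self_eq_zero]

variable {κ : Type}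

/-- Homogeneous classes have homogeneous representatives, so superdeterminant identities for power
series descend to the quotients. -/
theorem exists_supermatrix_lift {M : Matrix (Fin (n + m)) (Fin (n + m)) (SLPow κ n m)}
    (hM : IsSupermatrix n m M) (cM : M.map (counit κ n m) = 1) :
    ∃ N : Matrix (Fin (n + m)) (Fin (n + m)) (PS κ n m), IsSupermatrix n m N ∧
      N.map (const (genPar κ n m)) = 1 ∧ N.map (slMk κ n m) = M := by
  choose N hN hNM using fun i j => mem_homog_slPow.1 (hM i j)
  refine ⟨N, hN, ?_, Matrix.ext hNM⟩
  rw [← cM]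
  ext i j
  have h := counit_mk κ n m (N i j)
  rw [hNM] at h
  exact h.symm

theorem slMk_sdet_map {N : Matrix (Fin (n + m)) (Fin (n + m)) (PS κ n m)}
    (hN : IsSupermatrix n m N) (cN : N.map (const (genPar κ n m)) = 1) :
    sdet n m (N.map (slMk κ n m)) = slMk κ n m (sdet n m N) :=
  (map_sdet (slMk κ n m).toRingHom hN cN).symm

theorem sdet_mul_slPow {M N : Matrix (Fin (n + m)) (Fin (n + m)) (SLPow κ n m)}
    (hM : IsSupermatrix n m M) (hN : IsSupermatrix n m N) (cM : M.map (counit κ n m) = 1)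
    (cN : N.map (counit κ n m) = 1) : sdet n m (M * N) = sdet n m M * sdet n m N := by
  obtain ⟨M, hM', cM', rfl⟩ := exists_supermatrix_lift hM cM
  obtain ⟨N, hN', cN', rfl⟩ := exists_supermatrix_lift hN cN
  rw [← Matrix.map_mul, slMk_sdet_map hM' cM', slMk_sdet_map hN' cN',
    slMk_sdet_map (mul_isSupermatrix hM' hN') (const_mul cM' cN'), sdet_mul hM' hN' cM' cN', map_mul]

theorem sdet_supertranspose {M : Matrix (Fin (n + m)) (Fin (n + m)) (SLPow κ n m)}
    (hM : IsSupermatrix n m M) (cM : M.map (counit κ n m) = 1) :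
    sdet n m (supertranspose n m M) = sdet n m M := by
  obtain ⟨M, hM', cM', rfl⟩ := exists_supermatrix_lift hM cM
  rw [← supertranspose_map, slMk_sdet_map hM' cM', slMk_sdet_map,
    sdet_supertranspose_series hM' cM']
  · exact fun i j => Submodule.smul_mem _ _ (add_comm (par n m i) (par n m j) ▸ hM' j i)
  · rw [supertranspose_map, cM', supertranspose_one]

theorem sdet_gmat (c : κ) : sdet n m (gmat n m c) = 1 :=
  (slMk_sdet_map (ymat_isSupermatrix n m c) (const_ymat n m c)).trans (slMk_sdet n m c)

theorem map_sdet_slPow {A : Type} [Ring A] (f : SLPow κ n m →+* A)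
    {M : Matrix (Fin (n + m)) (Fin (n + m)) (SLPow κ n m)} (hM : IsSupermatrix n m M)
    (cM : M.map (counit κ n m) = 1) : f (sdet n m M) = sdet n m (M.map f) := by
  obtain ⟨M, hM', cM', rfl⟩ := exists_supermatrix_lift hM cM
  rw [slMk_sdet_map hM' cM']
  exact map_sdet (f.comp (slMk κ n m).toRingHom) hM' cM'

theorem counit_sdet {M : Matrix (Fin (n + m)) (Fin (n + m)) (FunSL n m)}
    (hM : IsSupermatrix n m M) (cM : M.map (counit Bool n m) = 1) :
    counit Bool n m (sdet n m M) = 1 := by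
  have h1 := map_sdet_slPow (counit Bool n m).toRingHom hM cM
  -- `M` and the generic supermatrix both reduce to the identity, and the superdeterminant of the
  -- latter is `1`. This avoids computing the superdeterminant of the identity.
  have h2 := map_sdet_slPow (counit Bool n m).toRingHom (isSupermatrix_gmat false)
    (counit_gmat false)
  rw [sdet_gmat, map_one] at h2
  rw [h2]
  refine h1.trans ?_
  congr 1
  exact cM.trans (counit_gmat false).symm

theorem ncdet_eq_of_diag_eq {A : Type} [Ring A] {k : ℕ} {M N : Matrix (Fin k) (Fin k) A}
    (hM : CentralMat M) (hN : CentralMat N) (uM : ∀ i j, j < i → M i j = 0)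
    (uN : ∀ i j, j < i → N i j = 0) (h : ∀ i, M i i = N i i) : ncdet M = ncdet N := by
  obtain ⟨M, rfl⟩ := hM.exists_lift
  obtain ⟨N, rfl⟩ := hN.exists_lift
  rw [ncdet_lift, ncdet_lift, Matrix.det_of_isUpperTriangular, Matrix.det_of_isUpperTriangular]
  · exact congrArg _ (Finset.prod_congr rfl fun i _ => Subtype.ext (h i))
  · exact fun i j hij => Subtype.ext (uN i j hij)
  · exact fun i j hij => Subtype.ext (uM i j hij)

/-- The superdeterminant of an upper triangular supermatrix depends on its diagonal only. -/
theorem sdet_eq_of_diag_eq {M N : Matrix (Fin (n + m)) (Fin (n + m)) (SLPow κ n m)}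
    (hM : IsSupermatrix n m M) (hN : IsSupermatrix n m N) (uM : ∀ i j, j < i → M i j = 0)
    (uN : ∀ i j, j < i → N i j = 0) (h : ∀ i, M i i = N i i) : sdet n m M = sdet n m N := by
  have cen : ∀ {a : SLPow κ n m}, a ∈ homog (A := SLPow κ n m) 0 → a ∈ Subring.center _ :=
    fun ha => Subring.mem_center_iff.2 fun g => (slPow_even_comm ha g).symm
  have zero : ∀ {M : Matrix (Fin (n + m)) (Fin (n + m)) (SLPow κ n m)},
      (∀ i j, j < i → M i j = 0) → M.submatrix (Fin.natAdd n) (Fin.castAdd m) = 0 := by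
    intro M u
    ext i j
    exact u _ _ (by rw [Fin.lt_def]; simp; omega)
  unfold sdet sdetBlocks
  -- The lower left block vanishes, so the Schur complement is the upper left block and only
  -- determinants of triangular blocks remain.
  rw [zero uM, zero uN, Matrix.mul_zero, Matrix.mul_zero, sub_zero, sub_zero]
  congr 1
  · refine ncdet_eq_of_diag_eq (fun i j => cen ?_) (fun i j => cen ?_)
      (fun i j hij => uM _ _ hij) (fun i j hij => uN _ _ hij) fun i => h _
    · simpa [par_castAdd] using hM (Fin.castAdd m i) (Fin.castAdd m j)
    · simpa [par_castAdd] using hN (Fin.castAdd m i) (Fin.castAdd m j)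
  · congr 1
    refine ncdet_eq_of_diag_eq (fun i j => cen ?_) (fun i j => cen ?_)
      (fun i j hij => uM _ _ (by simpa using hij)) (fun i j hij => uN _ _ (by simpa using hij))
      fun i => h _
    · simpa [par_natAdd, CharTwo.add_self_eq_zero] using hM (Fin.natAdd n i) (Fin.natAdd n j)
    · simpa [par_natAdd, CharTwo.add_self_eq_zero] using hN (Fin.natAdd n i) (Fin.natAdd n j)

end Superdeterminant

/-! ### Gauss, Cholesky and Iwasawa factorizations -/

section Factorization

variable {n m : ℕ}

/-- Equal diagonals turn the products of diagonal entries into squares, and square roots with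
constant term 1 are unique when one of them is even. -/
theorem symmetric_triangular_unique {L V L' V' : Matrix (Fin (n + m)) (Fin (n + m)) (FunSL n m)}
    (hL : ∀ i j, i < j → L i j = 0) (hV : ∀ i j, j < i → V i j = 0)
    (hL' : ∀ i j, i < j → L' i j = 0) (hV' : ∀ i j, j < i → V' i j = 0)
    (hd : ∀ i, L i i = V i i) (hd' : ∀ i, L' i i = V' i i)
    (he : ∀ i, V i i ∈ homog (A := FunSL n m) 0) (hc : ∀ i, counit Bool n m (V i i) = 1)
    (hc' : ∀ i, counit Bool n m (V' i i) = 1) (h : L * V = L' * V') : L = L' ∧ V = V' := by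
  have u : ∀ i, IsUnit (V i i) := fun i => isUnit_of_counit (by rw [hc]; exact one_ne_zero)
  refine lower_mul_upper_unique hL hV hL' hV' (fun i => hd i ▸ u i) u (fun i hi => ?_) h
  rw [hd, hd'] at hi ⊢
  have := eq_of_mul_self_eq_of_even (he i) (hc i) (hc' i) hi
  exact ⟨this, this⟩

theorem superAdjoint_gmat : superAdjoint (gmat n m false) = supertranspose n m (gmat n m true) := by
  rw [superAdjoint, gmat_map_ddag]

theorem counit_apply_diag {M : Matrix (Fin (n + m)) (Fin (n + m)) (FunSL n m)}
    (h : M.map (counit Bool n m) = 1) (i : Fin (n + m)) : counit Bool n m (M i i) = 1 := by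
  have := congrFun (congrFun h i) i
  rwa [Matrix.map_apply, Matrix.one_apply_eq] at this

theorem superAdjoint_diag (M : Matrix (Fin (n + m)) (Fin (n + m)) (FunSL n m)) (i : Fin (n + m)) :
    superAdjoint M i i = ddag n m (M i i) := supertranspose_diag _ i

theorem superAdjoint_eq_zero {M : Matrix (Fin (n + m)) (Fin (n + m)) (FunSL n m)}
    {i j : Fin (n + m)} (h : M j i = 0) : superAdjoint M i j = 0 :=
  supertranspose_eq_zero (by rw [Matrix.map_apply, h, map_zero])

/-- The Gauss decomposition of a supermatrix into supermatrices. -/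
theorem exists_supermatrix_lower_mul_upper
    {H : Matrix (Fin (n + m)) (Fin (n + m)) (FunSL n m)} (hH : IsSupermatrix n m H)
    (cH : H.map (counit Bool n m) = 1) :
    ∃ L V : Matrix (Fin (n + m)) (Fin (n + m)) (FunSL n m),
      IsSupermatrix n m L ∧ IsSupermatrix n m V ∧ (∀ i j, i < j → L i j = 0) ∧
      (∀ i j, j < i → V i j = 0) ∧ (∀ i, L i i = 1) ∧ V.map (counit Bool n m) = 1 ∧ L * V = H := by
  obtain ⟨L, V, hL, hV, hL1, hV1, hLV⟩ := exists_lower_mul_upper (counit Bool n m).toRingHom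
    (fun _ ha => isUnit_of_counit (ne_of_eq_of_ne ha one_ne_zero)) H cH
  -- The twisted factors form another Gauss factorization of `H` with unipotent lower factor, so
  -- uniqueness makes them fixed.
  have key : parityTwist L = L ∧ parityTwist V = V := by
    have t1 : ∀ i, parityTwist L i i = 1 := fun i => by
      rw [parityTwist, CharTwo.add_self_eq_zero, sgn_zero, one_smul, hL1, map_one, map_one]
    have tc : ∀ i, counit Bool n m (parityTwist V i i) = 1 := fun i => by
      rw [parityTwist, CharTwo.add_self_eq_zero, sgn_zero, one_smul, counit_ddag, counit_ddag,
        counit_apply_diag hV1]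
      simp
    refine lower_mul_upper_unique
      (fun i j hij => by rw [parityTwist, hL i j hij, map_zero, map_zero, smul_zero])
      (fun i j hij => by rw [parityTwist, hV i j hij, map_zero, map_zero, smul_zero]) hL hV
      (fun i => by rw [t1]; exact isUnit_one)
      (fun i => isUnit_of_counit (by rw [tc]; exact one_ne_zero)) (fun i hi => ?_) ?_
    · rw [t1, hL1, one_mul, one_mul] at hi
      exact ⟨by rw [t1, hL1], hi⟩
    · rw [← parityTwist_mul, hLV, isSupermatrix_iff.1 hH]
  exact ⟨L, V, isSupermatrix_iff.2 key.1, isSupermatrix_iff.2 key.2, hL, hV, hL1, hV1, hLV⟩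

/-- The ring endomorphism ‡‡ commutes with inversion, and evenness means being fixed by it. -/
theorem inverse_mem_homog {a : FunSL n m} (ha : a ∈ homog (A := FunSL n m) 0) (u : IsUnit a) :
    Ring.inverse a ∈ homog (A := FunSL n m) 0 := by
  rw [mem_homog_iff_ddag, sgn_zero, one_smul] at *
  rw [map_ringInverse _ u, map_ringInverse _ (u.map _), ha]

/-- The Cholesky decomposition of the supermatrix `y^* y`. -/
theorem exists_triangular (n m : ℕ) :
    ∃ Q : Matrix (Fin (n + m)) (Fin (n + m)) (FunSL n m), IsSANMatrix n m Q ∧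
      Q.map (counit Bool n m) = 1 ∧
      superAdjoint Q * Q = superAdjoint (gmat n m false) * gmat n m false := by
  have sy := isSupermatrix_gmat (n := n) (m := m) false
  have cy := counit_gmat (n := n) (m := m) false
  have sy' : IsSupermatrix n m (superAdjoint (gmat n m false)) := sy.superAdjoint
  have cy' := counit_superAdjoint cy
  obtain ⟨L, V, sL, sV, hL, hV, hL1, cV, hLV⟩ := exists_supermatrix_lower_mul_upper (sy'.mul sy)
    (by rw [counit_map_mul, cy, cy', mul_one])
  choose e he he1 hee using fun i => exists_sqrt (sV.diag i) (counit_apply_diag cV i)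
  have ue : ∀ i, IsUnit (e i) := fun i => isUnit_of_counit (by rw [he1]; exact one_ne_zero)
  let f : Fin (n + m) → FunSL n m := fun i => Ring.inverse (e i)
  have hef : ∀ i, e i * f i = 1 := fun i => Ring.mul_inverse_cancel _ (ue i)
  have hfe : ∀ i, f i * e i = 1 := fun i => Ring.inverse_mul_cancel _ (ue i)
  have cf : ∀ i, counit Bool n m (f i) = 1 := fun i => by
    have := congrArg (counit Bool n m) (hef i)
    rwa [map_mul, he1, one_mul, map_one] at this
  -- With `V i i = e i * e i`, passing one factor `e i` from `V` to `L` gives both factors the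
  -- diagonal `e`.
  let Q := Matrix.diagonal f * V
  let E := L * Matrix.diagonal e
  have Q_apply : ∀ i j, Q i j = f i * V i j := Matrix.diagonal_mul f V
  have E_apply : ∀ i j, E i j = L i j * e j := Matrix.mul_diagonal e L
  have hEQ : E * Q = superAdjoint (gmat n m false) * gmat n m false := by
    rw [← hLV, Matrix.mul_assoc, ← Matrix.mul_assoc (Matrix.diagonal e),
      Matrix.diagonal_mul_diagonal, funext hef, Matrix.diagonal_one, Matrix.one_mul]
  have sQ : IsSupermatrix n m Q :=
    (isSupermatrix_diagonal fun i => inverse_mem_homog (he i) (ue i)).mul sV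
  have sE : IsSupermatrix n m E := sL.mul (isSupermatrix_diagonal he)
  have dQ : ∀ i, Q i i = e i := fun i => by
    rw [Q_apply, ← hee, ← mul_assoc, hfe, one_mul]
  have dE : ∀ i, E i i = e i := fun i => by rw [E_apply, hL1, one_mul]
  have hQ : ∀ i j, j < i → Q i j = 0 := fun i j hij => by
    rw [Q_apply, hV i j hij, mul_zero]
  have hE : ∀ i j, i < j → E i j = 0 := fun i j hij => by
    rw [E_apply, hL i j hij, zero_mul]
  have cQ : Q.map (counit Bool n m) = 1 := by
    ext i j
    have := congrFun (congrFun cV i) j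
    rw [Matrix.map_apply] at this
    rw [Matrix.map_apply, Q_apply, map_mul, cf, one_mul, this]
  -- The adjoint of `E * Q` factors the same self-adjoint matrix with equal diagonals, so E = Q^*.
  -- Comparing diagonals also shows that `Q` has a real diagonal.
  obtain ⟨eE, eQ⟩ := symmetric_triangular_unique hE hQ
    (L' := superAdjoint Q) (V' := superAdjoint E)
    (fun i j hij => superAdjoint_eq_zero (hQ j i hij))
    (fun i j hij => superAdjoint_eq_zero (hE j i hij))
    (fun i => by rw [dE, dQ]) (fun i => by rw [superAdjoint_diag, superAdjoint_diag, dE, dQ])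
    (fun i => by rw [dQ]; exact he i) (fun i => by rw [dQ]; exact he1 i)
    (fun i => by rw [superAdjoint_diag, counit_ddag, dE, he1, map_one])
    (by rw [← superAdjoint_mul sE sQ, hEQ, superAdjoint_mul sy' sy, superAdjoint_superAdjoint sy])
  have real : ∀ i, ddag n m (Q i i) = Q i i := fun i => by
    rw [← superAdjoint_diag, ← eE, dE, dQ]
  have hQQ : superAdjoint Q * Q = superAdjoint (gmat n m false) * gmat n m false := by
    rw [← eE, hEQ]
  refine ⟨Q, ⟨sQ, ?_, fun i => counit_apply_diag cQ i, real, hQ⟩, cQ, hQQ⟩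
  -- The supertranspose preserves the superdeterminant, and ‡ preserves the diagonal, on which the
  -- superdeterminant of a triangular supermatrix depends.
  have s1 : sdet n m (superAdjoint Q) = sdet n m Q := by
    rw [superAdjoint, sdet_supertranspose sQ.ddag (counit_map_ddag cQ)]
    exact sdet_eq_of_diag_eq sQ.ddag sQ
      (fun i j hij => by rw [Matrix.map_apply, hQ i j hij, map_zero]) hQ real
  have s2 : sdet n m Q * sdet n m Q = 1 := by
    have h := congrArg (sdet n m) hQQ
    rwa [sdet_mul_slPow sQ.superAdjoint sQ (counit_superAdjoint cQ) cQ, s1,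
      sdet_mul_slPow sy' sy cy' cy, superAdjoint_gmat,
      sdet_supertranspose (isSupermatrix_gmat true) (counit_gmat true), sdet_gmat, sdet_gmat,
      mul_one] at h
  refine eq_of_mul_self_eq (Commute.one_right _) (by rw [s2, one_mul]) (isUnit_of_counit ?_)
  rw [map_add, counit_sdet sQ cQ, map_one]
  norm_num

/-- The complexified Cholesky decomposition is unique. -/
theorem triangular_unique {R Q Q' : Matrix (Fin (n + m)) (Fin (n + m)) (FunSL n m)}
    (hR : IsSANMatrix n m R)
    (hRR : superAdjoint R * R = superAdjoint (gmat n m false) * gmat n m false)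
    (hQ : ∀ i j, j < i → Q i j = 0) (hQ' : ∀ i j, j < i → Q' i j = 0)
    (hd : ∀ i, Q' i i = Q i i) (hc : ∀ i, counit Bool n m (Q i i) = 1)
    (h : supertranspose n m Q' * Q = superAdjoint (gmat n m false) * gmat n m false) :
    Q = R ∧ Q' = R.map (ddag n m) := by
  -- `Q'` is linked to `Q` only by the shared diagonal and the product. Uniqueness itself forces it
  -- to be the conjugate of `Q`, and this is what treats morphisms not assumed to respect ‡.
  obtain ⟨e1, e2⟩ := symmetric_triangular_unique (L := superAdjoint R) (V := R)
    (L' := supertranspose n m Q') (V' := Q)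
    (fun i j hij => superAdjoint_eq_zero (hR.upper j i hij)) hR.upper
    (fun i j hij => supertranspose_eq_zero (hQ' j i hij)) hQ
    (fun i => by rw [superAdjoint_diag, hR.real]) (fun i => by rw [supertranspose_diag, hd])
    hR.isSupermatrix.diag hR.normalized hc (by rw [hRR, h])
  exact ⟨e2.symm, (supertranspose_injective e1).symm⟩

/-- The Iwasawa decomposition of the generic supermatrix. -/
theorem exists_factorization (n m : ℕ) :
    ∃ P Q : Matrix (Fin (n + m)) (Fin (n + m)) (FunSL n m), IsIwasawaFactorization n m P Q ∧
      P.map (counit Bool n m) = 1 ∧ Q.map (counit Bool n m) = 1 ∧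
      superAdjoint Q * Q = superAdjoint (gmat n m false) * gmat n m false := by
  obtain ⟨Q, hQ, cQ, hQQ⟩ := exists_triangular n m
  have uQ := isUnit_supermatrix cQ
  have sQ := hQ.isSupermatrix
  have sy := isSupermatrix_gmat (n := n) (m := m) false
  let P := gmat n m false * Ring.inverse Q
  have hPQ : P * Q = gmat n m false := by
    rw [Matrix.mul_assoc, Ring.inverse_mul_cancel _ uQ, Matrix.mul_one]
  have sP : IsSupermatrix n m P := IsSupermatrix.of_mul (hPQ ▸ sy) sQ uQ
  have cP : P.map (counit Bool n m) = 1 := by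
    have := congrArg (fun M => M.map (counit Bool n m)) hPQ
    simpa only [counit_map_mul, cQ, mul_one, counit_gmat] using this
  refine ⟨P, Q, ⟨⟨sP, ?_, counit_apply_diag cP, ?_⟩, hQ, hPQ.symm⟩, cP, cQ, hQQ⟩
  · have := congrArg (sdet n m) hPQ
    rwa [sdet_mul_slPow sP sQ cP cQ, hQ.sdet_eq_one, mul_one, sdet_gmat] at this
  · change superAdjoint P * P = 1
    have uQ' := isUnit_supermatrix (counit_superAdjoint cQ)
    -- Unitarity is checked between Q^* and Q, where both sides become y^*y = (PQ)^*(PQ); the two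
    -- outer factors are invertible.
    apply uQ'.mul_right_injective
    apply uQ.mul_left_injective
    change superAdjoint Q * (superAdjoint P * P) * Q = superAdjoint Q * 1 * Q
    rw [Matrix.mul_one, hQQ, ← Matrix.mul_assoc, ← superAdjoint_mul sP sQ, Matrix.mul_assoc, hPQ]

theorem superAdjoint_mul_self_of_factorization
    {P Q : Matrix (Fin (n + m)) (Fin (n + m)) (FunSL n m)} (h : IsIwasawaFactorization n m P Q) :
    superAdjoint Q * Q = superAdjoint (gmat n m false) * gmat n m false := by
  obtain ⟨hP, hQ, e⟩ := h
  have u : superAdjoint P * P = 1 := hP.unitary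
  rw [e, superAdjoint_mul hP.isSupermatrix hQ.isSupermatrix, Matrix.mul_assoc,
    ← Matrix.mul_assoc (superAdjoint P), u, Matrix.one_mul]

/-- Both upper factors are Cholesky factors of y^*y, and the unitary factors follow by cancellation.
Full reduction to `1` is asked of one factorization only, since normalization controls just the
diagonal of the other. -/
theorem factorization_unique {P Q P' Q' : Matrix (Fin (n + m)) (Fin (n + m)) (FunSL n m)}
    (h : IsIwasawaFactorization n m P Q) (cQ : Q.map (counit Bool n m) = 1)
    (h' : IsIwasawaFactorization n m P' Q') : P' = P ∧ Q' = Q := by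
  have e : Q' = Q := (triangular_unique h.2.1 (superAdjoint_mul_self_of_factorization h)
    h'.2.1.upper (Q' := Q'.map (ddag n m))
    (fun i j hij => by rw [Matrix.map_apply, h'.2.1.upper i j hij, map_zero]) h'.2.1.real
    h'.2.1.normalized (superAdjoint_mul_self_of_factorization h')).1
  refine ⟨(isUnit_supermatrix cQ).mul_left_injective ?_, e⟩
  exact (e ▸ h'.2.2.symm).trans h.2.2

end Factorization

/-! ### Superalgebra morphisms and matrix factorizations -/

section Morphisms

variable {n m : ℕ}

/-- The morphism given by a family of supermatrices. -/
theorem exists_superHom {κ : Type} (N : κ → Matrix (Fin (n + m)) (Fin (n + m)) (FunSL n m))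
    (sN : ∀ c, IsSupermatrix n m (N c)) (cN : ∀ c, (N c).map (counit Bool n m) = 1)
    (dN : ∀ c, sdet n m (N c) = 1) :
    ∃ f : SLPow κ n m →ₐ[ℂ] FunSL n m, IsSuperHom f ∧ ∀ c, (gmat n m c).map f = N c := by
  choose T sT cT hT using fun c => exists_supermatrix_lift (sN c) (cN c)
  -- Lifts to power series are needed in order to substitute. Since y = 1 + x, the variables go to
  -- the lift minus the identity, which has no constant term.
  let s : κ × Fin (n + m) × Fin (n + m) → PS Bool n m := fun t =>
    T t.1 t.2.1 t.2.2 - (1 : Matrix _ _ (PS Bool n m)) t.2.1 t.2.2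
  let g : PS κ n m →ₐ[ℂ] PS Bool n m := subst (genPar κ n m) (genPar Bool n m) s
    (fun t => Submodule.sub_mem _ (sT t.1 t.2.1 t.2.2) (one_isSupermatrix _ n m t.2.1 t.2.2))
    (fun t => by
      have h1 := congrFun (congrFun (cT t.1) t.2.1) t.2.2
      have h2 := congrFun (congrFun (const_one_map (k := n + m) (genPar Bool n m)) t.2.1) t.2.2
      rw [Matrix.map_apply] at h1 h2
      rw [map_sub, h1, h2, sub_self])
  have hg : ∀ c, (ymat n m c).map g.toRingHom = T c := fun c => by
    refine (ymat_map g.toRingHom c (fun i j => s (c, i, j)) fun i j => subst_var _ _ _ _ _ _).trans ?_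
    ext1 i j
    exact add_sub_cancel _ _
  have rel : ∀ ⦃x y⦄, SLRel κ n m x y → (slMk Bool n m).comp g x = (slMk Bool n m).comp g y := by
    rintro _ _ ⟨c⟩
    rw [map_one]
    refine slMk_map_sdet g.toRingHom c (hg c) ?_
    rw [← slMk_sdet_map (sT c) (cT c), hT, dN]
  have lift : ∀ a, SQuot.liftAlg ((slMk Bool n m).comp g) rel (slMk κ n m a) = slMk Bool n m (g a) :=
    fun a => SQuot.liftAlg_mk _ rel a
  refine ⟨SQuot.liftAlg ((slMk Bool n m).comp g) rel, fun q a ha => ?_, fun c => ?_⟩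
  · obtain ⟨b, hb, rfl⟩ := mem_homog_slPow.1 ha
    rw [lift]
    exact mem_homog_slPow.2 ⟨_, subst_mem_homog _ _ _ _ _ hb, rfl⟩
  · rw [← hT c, ← hg c]
    ext i j
    exact lift _

theorem IsSuperHom.liftAlg {A B : Type} [Ring A] [Algebra ℂ A] [SuperGraded A] [Ring B]
    [Algebra ℂ B] [SuperGraded B] {r : A → A → Prop} {f : A →ₐ[ℂ] B} (hf : IsSuperHom f)
    (w : ∀ ⦃x y⦄, r x y → f x = f y) : IsSuperHom (SQuot.liftAlg f w) := by
  rintro q _ ⟨a, ha, rfl⟩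
  exact (SQuot.liftAlg_mk f w a).symm ▸ hf q a ha

/-- The matrix form of the SU relations is (y‡)^st = y⁻¹. The sign (-1)^((|i|+|j|)|j|) is that of
the supertranspose at `(j, i)`, and the -δ in the antipode matches the 1 in y‡ = 1 + x‡. -/
theorem antipode_relation_iff (F : FunSL n m →ₐ[ℂ] FunSL n m) :
    (∀ i j, F (sgn ((par n m i + par n m j) * par n m j) • antipodeCoord n m j i) =
      F (coord n m true i j)) ↔
    supertranspose n m ((gmat n m true).map F) * (gmat n m false).map F = 1 := by
  have u := isUnit_supermatrix (counit_gmat (n := n) (m := m) false)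
  have e1 : (Ring.inverse (gmat n m false)).map F * (gmat n m false).map F = 1 := by
    rw [← Matrix.map_mul, Ring.inverse_mul_cancel _ u]
    exact map_one F.mapMatrix
  have uF : IsUnit ((gmat n m false).map F) := u.map F.mapMatrix
  have e2 : supertranspose n m ((gmat n m true).map F) * (gmat n m false).map F = 1 ↔
      supertranspose n m ((gmat n m true).map F) = (Ring.inverse (gmat n m false)).map F := by
    rw [← e1]
    exact uF.mul_left_inj
  rw [e2, ← Matrix.ext_iff, forall_comm]
  refine forall_congr' fun j => forall_congr' fun i => ?_
  have h : sgn ((par n m i + par n m j) * par n m j) • (gmat n m true i j) -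
      Ring.inverse (gmat n m false) j i = sgn ((par n m i + par n m j) * par n m j) •
        (coord n m true i j -
          sgn ((par n m i + par n m j) * par n m j) • antipodeCoord n m j i) := by
    rw [smul_sub, smul_smul, sgn_mul_self, one_smul, antipodeCoord, gmat_apply, smul_add,
      Matrix.one_apply]
    by_cases hij : i = j
    · subst hij
      rw [CharTwo.add_self_eq_zero, zero_mul, sgn_zero, if_pos rfl]
      simp only [one_smul]
      abel
    · rw [if_neg hij, if_neg (Ne.symm hij), smul_zero]
      abel
  have h2 := congrArg F h
  rw [map_sub, map_smul, map_smul, map_sub] at h2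
  rw [supertranspose, Matrix.map_apply, Matrix.map_apply, mul_comm (par n m j),
    add_comm (par n m j), ← sub_eq_zero (b := F (Ring.inverse (gmat n m false) j i)), h2,
    smul_eq_zero_iff_right (sgn_ne_zero _), sub_eq_zero, eq_comm]

theorem copyMap_gmat {κ κ' : Type} (g : κ → κ') (c : κ) (i j : Fin (n + m)) :
    copyMap n m g (gmat n m c i j) = gmat n m (g c) i j := by
  have h := ymat_map (copySubst n m g).toRingHom c _ (copySubst_var n m g c)
  refine (copyMap_mk n m g _).trans ?_
  exact congrArg (slMk κ' n m) (congrFun (congrFun h i) j)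

theorem counit_map_algHom {κ κ' : Type} (f : SLPow κ n m →ₐ[ℂ] SLPow κ' n m)
    (c : κ) : ((gmat n m c).map f).map (counit κ' n m) = 1 := by
  rw [← counit_gmat c]
  ext i j
  exact counit_algHom f _

/-- The morphisms send (y, y‡) to (P, P^‡) and (Q, Q^‡); unitarity of `P` and the shape of `Q` are
the relations that let them factor. The map `μ` does both on the two copies, and all identities are
tested on coordinates. On the antiholomorphic copy the identity is the conjugate of y = PQ. -/
theorem exists_iwasawaPair {P Q : Matrix (Fin (n + m)) (Fin (n + m)) (FunSL n m)}
    (h : IsIwasawaFactorization n m P Q) (cP : P.map (counit Bool n m) = 1)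
    (cQ : Q.map (counit Bool n m) = 1) :
    ∃ (φ : FunSU n m →ₐ[ℂ] FunSL n m) (ψ : FunSAN n m →ₐ[ℂ] FunSL n m),
      IsIwasawaPair n m φ ψ := by
  obtain ⟨hP, hQ, hPQ⟩ := h
  have conj : ∀ {M : Matrix (Fin (n + m)) (Fin (n + m)) (FunSL n m)}, IsSupermatrix n m M →
      M.map (counit Bool n m) = 1 → sdet n m M = 1 →
      ∀ c : Bool, IsSupermatrix n m (bif c then M.map (ddag n m) else M) ∧
        (bif c then M.map (ddag n m) else M).map (counit Bool n m) = 1 ∧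
        sdet n m (bif c then M.map (ddag n m) else M) = 1 := by
    rintro M sM cM dM (_ | _)
    · exact ⟨sM, cM, dM⟩
    · exact ⟨sM.ddag, counit_map_ddag cM, by rw [cond_true, ← map_sdet_slPow _ sM cM, dM, map_one]⟩
  have kP := conj hP.isSupermatrix cP hP.sdet_eq_one
  have kQ := conj hQ.isSupermatrix cQ hQ.sdet_eq_one
  obtain ⟨F, sF, hF⟩ := exists_superHom _ (fun c => (kP c).1) (fun c => (kP c).2.1)
    (fun c => (kP c).2.2)
  obtain ⟨G, sG, hG⟩ := exists_superHom _ (fun c => (kQ c).1) (fun c => (kQ c).2.1)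
    (fun c => (kQ c).2.2)
  obtain ⟨μ, sμ, hμ⟩ := exists_superHom (κ := Bool ⊕ Bool)
    (Sum.elim (fun c => bif c then P.map (ddag n m) else P)
      (fun c => bif c then Q.map (ddag n m) else Q))
    (by rintro (c | c); exacts [(kP c).1, (kQ c).1])
    (by rintro (c | c); exacts [(kP c).2.1, (kQ c).2.1])
    (by rintro (c | c); exacts [(kP c).2.2, (kQ c).2.2])
  have hF' : ∀ c i j, F (gmat n m c i j) = (bif c then P.map (ddag n m) else P) i j :=
    fun c i j => congrFun (congrFun (hF c) i) j
  have hG' : ∀ c i j, G (gmat n m c i j) = (bif c then Q.map (ddag n m) else Q) i j :=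
    fun c i j => congrFun (congrFun (hG c) i) j
  have hμ' : ∀ c i j, μ (gmat n m c i j) = Sum.elim (fun c => bif c then P.map (ddag n m) else P)
      (fun c => bif c then Q.map (ddag n m) else Q) c i j :=
    fun c i j => congrFun (congrFun (hμ c) i) j
  have wF : ∀ ⦃x y⦄, SURel n m x y → F x = F y := by
    rintro _ _ ⟨i, j⟩
    refine (antipode_relation_iff F).2 ?_ i j
    rw [hF, hF]
    exact hP.unitary
  have wG : ∀ ⦃x y⦄, SANRel n m x y → G x = G y := by
    have e : ∀ c i j, G (coord n m c i j) =
        (bif c then Q.map (ddag n m) else Q) i j - (1 : Matrix _ _ (FunSL n m)) i j :=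
      fun c i j => by
        rw [← hG', gmat_apply, map_add, Matrix.one_apply, apply_ite G, map_one, map_zero]
        exact (add_sub_cancel_left _ _).symm
    rintro _ _ (⟨c, i, j, hij⟩ | ⟨i⟩)
    · rw [e, map_zero, Matrix.one_apply_ne (ne_of_gt hij), sub_zero]
      cases c
      · exact hQ.upper i j hij
      · rw [cond_true, Matrix.map_apply, hQ.upper i j hij, map_zero]
    · rw [e, e, cond_true, cond_false, Matrix.map_apply, hQ.real]
  refine ⟨SQuot.liftAlg F wF, SQuot.liftAlg G wG, sF.liftAlg wF, sG.liftAlg wG, μ, sμ, ?_, ?_⟩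
  · have e1 : μ.comp (copyMap n m Sum.inl) = F := slPow_algHom_ext fun c i j => by
      rw [AlgHom.comp_apply, copyMap_gmat, hμ', hF']; rfl
    have e2 : μ.comp (copyMap n m Sum.inr) = G := slPow_algHom_ext fun c i j => by
      rw [AlgHom.comp_apply, copyMap_gmat, hμ', hG']; rfl
    intro f g
    rw [map_mul]
    refine congrArg₂ (· * ·) ?_ ?_
    · exact (DFunLike.congr_fun e1 f).trans (SQuot.liftAlg_mk F wF f).symm
    · exact (DFunLike.congr_fun e2 g).trans (SQuot.liftAlg_mk G wG g).symm
  · have e : μ.comp (coprod Bool n m) = AlgHom.id ℂ _ := slPow_algHom_ext fun c i j => by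
      rw [AlgHom.comp_apply, coprod_gmat, map_sum]
      simp only [map_mul, hμ', Sum.elim_inl, Sum.elim_inr]
      rw [← Matrix.mul_apply]
      cases c
      · exact (congrFun (congrFun hPQ i) j).symm
      · simp only [cond_true]
        rw [← ddag_map_mul, ← hPQ, gmat_map_ddag]
        rfl
    exact DFunLike.congr_fun e

/-- Eliminating the SU factor from the equations for y and y‡ leaves a complexified Cholesky
decomposition of y^*y. Its uniqueness fixes both triangular images, and cancelling them fixes the SU
images. -/
theorem IsIwasawaPair.map_gmat {P Q : Matrix (Fin (n + m)) (Fin (n + m)) (FunSL n m)}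
    (h : IsIwasawaFactorization n m P Q) (cQ : Q.map (counit Bool n m) = 1)
    {φ : FunSU n m →ₐ[ℂ] FunSL n m} {ψ : FunSAN n m →ₐ[ℂ] FunSL n m}
    (hp : IsIwasawaPair n m φ ψ) :
    (gmat n m false).map (φ.comp (projSU n m)) = P ∧
    (gmat n m true).map (φ.comp (projSU n m)) = P.map (ddag n m) ∧
    (gmat n m false).map (ψ.comp (projSAN n m)) = Q ∧
    (gmat n m true).map (ψ.comp (projSAN n m)) = Q.map (ddag n m) := by
  obtain ⟨sφ, sψ, μ, sμ, hμ, hΔ⟩ := hp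
  set F := φ.comp (projSU n m) with hF
  set G := ψ.comp (projSAN n m) with hG
  have mul : ∀ c, (gmat n m c).map F * (gmat n m c).map G = gmat n m c := fun c => by
    ext i j
    rw [← hΔ (gmat n m c i j), coprod_gmat, map_sum, Matrix.mul_apply]
    refine Finset.sum_congr rfl fun k _ => ?_
    rw [← copyMap_gmat, ← copyMap_gmat, hμ]
    rfl
  have unit : supertranspose n m ((gmat n m true).map F) * (gmat n m false).map F = 1 :=
    (antipode_relation_iff F).1 fun i j => congrArg φ (SQuot.mk_rel _ (SURel.mk i j))
  have upper : ∀ c i j, j < i → (gmat n m c).map G i j = 0 := fun c i j hij => by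
    have : G (coord n m c i j) = G 0 := congrArg ψ (SQuot.mk_rel _ (SANRel.lower c i j hij))
    rw [Matrix.map_apply, gmat_apply, Matrix.one_apply_ne (ne_of_gt hij), zero_add, this, map_zero]
  have diag : ∀ i, (gmat n m true).map G i i = (gmat n m false).map G i i := fun i => by
    have : G (coord n m false i i) = G (coord n m true i i) :=
      congrArg ψ (SQuot.mk_rel _ (SANRel.diag i))
    rw [Matrix.map_apply, Matrix.map_apply, gmat_apply, gmat_apply, map_add, map_add, this]
  have sF : ∀ c, IsSupermatrix n m ((gmat n m c).map F) := fun c i j =>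
    sφ _ _ ⟨_, isSupermatrix_gmat c i j, rfl⟩
  have sG : ∀ c, IsSupermatrix n m ((gmat n m c).map G) := fun c i j =>
    sψ _ _ ⟨_, isSupermatrix_gmat c i j, rfl⟩
  obtain ⟨e1, e2⟩ := triangular_unique h.2.1 (superAdjoint_mul_self_of_factorization h)
    (upper false) (upper true) diag (counit_apply_diag (counit_map_algHom G false)) (by
      -- Here y^* is the supertranspose of y‡. Expanding both through `mul` places F(y‡)^st F(y) = 1
      -- in the middle.
      rw [superAdjoint_gmat, ← mul true, supertranspose_mul (sF true) (sG true)]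
      conv_rhs => rw [← mul false]
      rw [Matrix.mul_assoc, ← Matrix.mul_assoc _ ((gmat n m false).map F), mul true, unit,
        Matrix.one_mul])
  have uQ := isUnit_supermatrix cQ
  refine ⟨uQ.mul_left_injective ?_, ?_, e1, e2⟩
  · change (gmat n m false).map F * Q = P * Q
    rw [← h.2.2, ← e1, mul]
  · have uQ' : IsUnit (Q.map (ddag n m)) := uQ.map (ddag n m).mapMatrix
    apply uQ'.mul_left_injective
    change (gmat n m true).map F * Q.map (ddag n m) = P.map (ddag n m) * Q.map (ddag n m)
    rw [← ddag_map_mul, ← h.2.2, gmat_map_ddag, ← e2, mul]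

/-- The composites with the projections agree on coordinates, hence everywhere by automatic
continuity, and the projections are surjective. -/
theorem IsIwasawaPair.unique {P Q : Matrix (Fin (n + m)) (Fin (n + m)) (FunSL n m)}
    (h : IsIwasawaFactorization n m P Q) (cQ : Q.map (counit Bool n m) = 1)
    {φ φ' : FunSU n m →ₐ[ℂ] FunSL n m} {ψ ψ' : FunSAN n m →ₐ[ℂ] FunSL n m}
    (hp : IsIwasawaPair n m φ ψ) (hp' : IsIwasawaPair n m φ' ψ') : φ' = φ ∧ ψ' = ψ := by
  obtain ⟨a, b, c, d⟩ := hp.map_gmat h cQ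
  obtain ⟨a', b', c', d'⟩ := hp'.map_gmat h cQ
  have e1 : φ'.comp (projSU n m) = φ.comp (projSU n m) := slPow_algHom_ext fun t i j => by
    cases t
    · exact congrFun (congrFun (a'.trans a.symm) i) j
    · exact congrFun (congrFun (b'.trans b.symm) i) j
  have e2 : ψ'.comp (projSAN n m) = ψ.comp (projSAN n m) := slPow_algHom_ext fun t i j => by
    cases t
    · exact congrFun (congrFun (c'.trans c.symm) i) j
    · exact congrFun (congrFun (d'.trans d.symm) i) j
  constructor
  · refine AlgHom.ext fun x => ?_
    obtain ⟨x, rfl⟩ := SQuot.mk_surjective _ x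
    exact DFunLike.congr_fun e1 x
  · refine AlgHom.ext fun x => ?_
    obtain ⟨x, rfl⟩ := SQuot.mk_surjective _ x
    exact DFunLike.congr_fun e2 x

end Morphisms


end SuperIwasawa

/-! ### The Iwasawa decomposition -/

theorem theorem3p1 (n m : ℕ) :
    -- the unique pair of superalgebra morphisms
    (∃! p : (SuperIwasawa.FunSU n m →ₐ[ℂ] SuperIwasawa.FunSL n m) ×
        (SuperIwasawa.FunSAN n m →ₐ[ℂ] SuperIwasawa.FunSL n m),
      SuperIwasawa.IsIwasawaPair n m p.1 p.2) ∧
    -- the unique factorization of the generic supermatrix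
    (∃! q : Matrix (Fin (n + m)) (Fin (n + m)) (SuperIwasawa.FunSL n m) ×
        Matrix (Fin (n + m)) (Fin (n + m)) (SuperIwasawa.FunSL n m),
      SuperIwasawa.IsIwasawaFactorization n m q.1 q.2) ∧
    -- the two determine each other
    (∀ (φ : SuperIwasawa.FunSU n m →ₐ[ℂ] SuperIwasawa.FunSL n m)
      (ψ : SuperIwasawa.FunSAN n m →ₐ[ℂ] SuperIwasawa.FunSL n m)
      (P Q : Matrix (Fin (n + m)) (Fin (n + m)) (SuperIwasawa.FunSL n m)),
      SuperIwasawa.IsIwasawaPair n m φ ψ → SuperIwasawa.IsIwasawaFactorization n m P Q →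
      ∀ i j : Fin (n + m),
        φ (SuperIwasawa.projSU n m (SuperIwasawa.gmat n m false i j)) = P i j ∧
        φ (SuperIwasawa.projSU n m (SuperIwasawa.gmat n m true i j)) =
          SuperIwasawa.ddag n m (P i j) ∧
        ψ (SuperIwasawa.projSAN n m (SuperIwasawa.gmat n m false i j)) = Q i j ∧
        ψ (SuperIwasawa.projSAN n m (SuperIwasawa.gmat n m true i j)) =
          SuperIwasawa.ddag n m (Q i j)) := by
  obtain ⟨P, Q, h, cP, cQ, -⟩ := SuperIwasawa.exists_factorization n m
  obtain ⟨φ, ψ, hp⟩ := SuperIwasawa.exists_iwasawaPair h cP cQ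
  refine ⟨⟨(φ, ψ), hp, fun p hp' => ?_⟩, ⟨(P, Q), h, fun q h' => ?_⟩,
    fun φ' ψ' P' Q' hp' h' i j => ?_⟩
  · obtain ⟨e1, e2⟩ := hp.unique h cQ hp'
    exact Prod.ext e1 e2
  · obtain ⟨e1, e2⟩ := SuperIwasawa.factorization_unique h cQ h'
    exact Prod.ext e1 e2
  · obtain ⟨rfl, rfl⟩ := SuperIwasawa.factorization_unique h cQ h'
    obtain ⟨e1, e2, e3, e4⟩ := hp'.map_gmat h' cQ
    exact ⟨congrFun (congrFun e1 i) j, congrFun (congrFun e2 i) j, congrFun (congrFun e3 i) j,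
      congrFun (congrFun e4 i) j⟩
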